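/- Conventions. Let $G$ be a finite group acting transitively on a finite set $\Omega$, and let $H=G_\alpha$ be the stabilizer of a point $\alpha\in\Omega$. A \emph{realization} of $(G,\Omega)$ is a $G$-equivariant map $A\colon\Omega\to V$ into a Euclidean space $V$ on which $G$ acts by orthogonal transformations; it is \emph{pure} if the linear span $S$ of its image is a simple $\mathbb{R}G$-module. Let $\mathbb{D}=\operatorname{End}_{\mathbb{R}G}(S)$; by Schur's lemma and Frobenius's theorem it is isomorphic to $\mathbb{R}$, $\mathbb{C}$ or $\mathbb{H}$, and the pure realization is accordingly of real, complex or quaternion type. Its \emph{essential Wythoff dimension} is the dimension over $\mathbb{D}$ of the space $\{v\in S : hv=v \text{ for all } h\in H\}$. For an abstract regular polytope $P$, realizations of $P$ are those of $(\operatorname{Aut}(P),\Omega)$, with $\Omega$ the vertex set of $P$. A group $G=\langle s_0,\dots,s_{n-1}\rangle$ is a \emph{string C-group} with respect to these generators if all $s_i$ are involutions, $s_is_j=s_js_i$ for $|i-j|\ge 2$, and $\langle s_i\mid i\in I\rangle\cap\langle s_j\mid j\in J\rangle=\langle s_k\mid k\in I\cap J\rangle$ for all $I,J\subseteq\{0,\dots,n-1\}$.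 For an odd prime $p$, a \emph{Weil representation} of $\mathrm{SL}(2,p)$ is a representation $\rho$ on the space of functions $f\colon\mathbb{F}_p\to\mathbb{C}$ with $\rho(g)T_v=T_{gv}\rho(g)$ for all $g\in\mathrm{SL}(2,p)$ and $v=(x,y)\in\mathbb{F}_p^2$, where $(T_vf)(t)=e^{2\pi i(yt+xy/2)/p}f(t+x)$ (the division by $2$ being in $\mathbb{F}_p$). Theorem. There are abstract regular polytopes which have a pure realization of complex type with arbitrarily large essential Wythoff dimension. More precisely, for every $N\in\mathbb{N}$ there are a prime $p$ with $p\equiv -1 \pmod 4$ and $p\equiv 1\pmod 7$, elements $s_0,s_1,s_2$ with respect to which $\mathrm{PSL}(2,p)$ is a string C-group, a finite abstract regular polytope $P$ of rank $3$, and an isomorphism $\mathrm{PSL}(2,p)\cong\operatorname{Aut}(P)$ taking $s_0,s_1,s_2$ to the distinguished generators of $\operatorname{Aut}(P)$ with respect to some base flag, such that $P$ has a pure realization of complex type whose essential Wythoff dimension (with respect to any vertex) is at least $N$. Moreover, the span of the image of this realization affords the character $\chi+\overline{\chi}$ of $\mathrm{PSL}(2,p)$, where $\chi(\pm g)=\tfrac12\bigl(\psi(g)+\psi(-g)\bigr)$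 for $g\in\mathrm{SL}(2,p)$ and $\psi$ is the character of a Weil representation of $\mathrm{SL}(2,p)$. In particular, it is false that every pure realization of a finite abstract regular polytope has essential Wythoff dimension at most $1$ or is of real type (an assertion of Herman and Monson). -/

import Mathlib

open scoped MatrixGroups

/-! ### Abstract regular polytopes -/

section Polytopes

variable (n : ℕ) (P : Type) [PartialOrder P] [BoundedOrder P]

/-- Abstract polytopes of rank `n`: posets with a least face `⊥` (rank `-1`) and a greatest face `⊤`
(rank `n`), all of whose flags have `n + 2` faces, which are strongly connected and satisfy the
diamond condition.  As all flags have the same length, `P` is graded by rank.  So `rank G = rank F + 2`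
for `F < G` means that there is a face `H` with `F ⋖ H ⋖ G`, and the section `G / F` has rank at
least `2` if and only if `F < G` can be refined to a chain `F < H < K < G`. -/
structure IsAbstractPolytope : Prop where
  /-- every flag (maximal chain) has exactly `n + 2` faces -/
  flag_card : ∀ Φ : Flag P, (Φ : Set P).ncard = n + 2
  /-- every section of rank at least `2` is connected: any two of its proper faces are joined by a
  sequence of proper faces of the section in which consecutive faces are incident -/
  connected : ∀ F G : P, (∃ H K : P, F < H ∧ H < K ∧ K < G) →
    ∀ x ∈ Set.Ioo F G, ∀ y ∈ Set.Ioo F G,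
      Relation.ReflTransGen
        (fun a b : P => a ∈ Set.Ioo F G ∧ b ∈ Set.Ioo F G ∧ (a ≤ b ∨ b ≤ a)) x y
  /-- diamond condition: between two incident faces whose ranks differ by `2` there are exactly two
  faces -/
  diamond : ∀ F G : P, (∃ H : P, F ⋖ H ∧ H ⋖ G) → (Set.Ioo F G).ncard = 2

/-- An abstract polytope is regular if its automorphism group is transitive on the flags. -/
structure IsAbstractRegularPolytope : Prop extends IsAbstractPolytope n P where
  flag_transitive : ∀ Φ Ψ : Flag P, ∃ γ : P ≃o P, γ '' (Φ : Set P) = (Ψ : Set P)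

/-- The vertices are the faces of rank `0`, that is, the atoms. -/
def PolytopeVertex : Type := {v : P // IsAtom v}

/-- The automorphism group acts on the vertices. -/
instance PolytopeVertex.instMulAction : MulAction (P ≃o P) (PolytopeVertex P) where
  smul γ v := ⟨γ v.1, (OrderIso.isAtom_iff γ v.1).2 v.2⟩
  one_smul _ := rfl
  mul_smul _ _ _ := rfl

end Polytopes

/-- `t 0, …, t (n - 1)` are the distinguished generators of the automorphism group of the polytope
`P` of rank `n` with respect to the base flag `Φ` (where `Φ j` has rank `j - 1`): the automorphism
`t i` sends `Φ` to the flag which differs from `Φ` in the face of rank `i` and in no other face. -/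
def AreDistinguishedGenerators {n : ℕ} {P : Type} [PartialOrder P] [BoundedOrder P]
    (Φ : Fin (n + 2) → P) (t : Fin n → (P ≃o P)) : Prop :=
  ∀ (i : Fin n) (j : Fin (n + 2)), t i (Φ j) = Φ j ↔ (j : ℕ) ≠ (i : ℕ) + 1

/-- `s 0, …, s (n - 1)` are generators of `G` that make `G` a string C-group. -/
structure IsStringCGroup {n : ℕ} {G : Type} [Group G] (s : Fin n → G) : Prop where
  closure_eq_top : Subgroup.closure (Set.range s) = ⊤
  involution : ∀ i, orderOf (s i) = 2
  intersection : ∀ I J : Set (Fin n),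
    Subgroup.closure (s '' I) ⊓ Subgroup.closure (s '' J) = Subgroup.closure (s '' (I ∩ J))
  commute : ∀ i j : Fin n, (i : ℕ) + 2 ≤ (j : ℕ) → s i * s j = s j * s i

/-! ### Types and Wythoff spaces of real representations -/

section Representations

variable {G S : Type} [Group G] [AddCommGroup S] [Module ℝ S] (σ : Representation ℝ G S)

/-- A real representation is of real type if its centralizer ring is `ℝ`. -/
def IsOfRealType : Prop := Nonempty (σ.IntertwiningMap σ ≃ₐ[ℝ] ℝ)

/-- A real representation is of complex type if its centralizer ring is `ℂ`. -/
def IsOfComplexType : Prop := Nonempty (σ.IntertwiningMap σ ≃ₐ[ℝ] ℂ)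

/-- The Wythoff space: the vectors fixed by the subgroup `H`. -/
def wythoffSpace (H : Subgroup G) : Submodule ℝ S where
  carrier := {v | ∀ h ∈ H, σ h v = v}
  add_mem' hv hw h hh := by rw [map_add, hv h hh, hw h hh]
  zero_mem' h _ := map_zero _
  smul_mem' c v hv h hh := by rw [map_smul, hv h hh]

/-- The centralizer ring acts on the Wythoff space. -/
instance wythoffSpace.instModule (H : Subgroup G) :
    Module (σ.IntertwiningMap σ) (wythoffSpace σ H) where
  smul d v := ⟨d v.1, fun h hh => by rw [← d.isIntertwining, v.2 h hh]⟩
  one_smul _ := rfl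
  mul_smul _ _ _ := rfl
  smul_zero d := Subtype.ext (map_zero d)
  smul_add d v w := Subtype.ext (map_add d v.1 w.1)
  add_smul _ _ _ := rfl
  zero_smul _ := rfl

/-- The essential Wythoff dimension: the dimension of the Wythoff space over the centralizer
ring. -/
noncomputable def essentialWythoffDim (H : Subgroup G) : ℕ :=
  Module.finrank (σ.IntertwiningMap σ) (wythoffSpace σ H)

end Representations

/-! ### Realizations -/

/-- A realization of the `G`-set `Ω` in the euclidean space `V`: an orthogonal action of `G` on `V`
together with a `G`-equivariant map `Ω → V`. -/
structure Realization (G Ω V : Type) [Group G] [MulAction G Ω]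
    [NormedAddCommGroup V] [InnerProductSpace ℝ V] where
  rep : Representation ℝ G V
  orthogonal : ∀ (g : G) (v w : V), inner ℝ (rep g v) (rep g w) = inner ℝ v w
  toFun : Ω → V
  equivariant : ∀ (g : G) (ω : Ω), toFun (g • ω) = rep g (toFun ω)

namespace Realization

variable {G Ω V : Type} [Group G] [MulAction G Ω] [NormedAddCommGroup V] [InnerProductSpace ℝ V]
  (A : Realization G Ω V)

/-- The `G`-invariant subspace spanned by the image of a realization. -/
def spanSubrep : Subrepresentation A.rep where
  toSubmodule := Submodule.span ℝ (Set.range A.toFun)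
  apply_mem_toSubmodule g v hv := by
    induction hv using Submodule.span_induction with
    | mem x hx =>
      obtain ⟨ω, rfl⟩ := hx
      rw [← A.equivariant]
      exact Submodule.subset_span ⟨_, rfl⟩
    | zero => rw [map_zero]; exact Submodule.zero_mem _
    | add x y _ _ hx hy => rw [map_add]; exact Submodule.add_mem _ hx hy
    | smul c x _ hx => rw [map_smul]; exact Submodule.smul_mem _ c hx

/-- The representation of `G` on the span of the image of a realization. -/
def spanRep : Representation ℝ G A.spanSubrep.toSubmodule := A.spanSubrep.toRepresentation

/-- A realization is pure if the span of its image is a simple `G`-module. -/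
def IsPure : Prop := A.spanRep.IsIrreducible

end Realization

/-- The assertion that every pure realization of a finite abstract regular polytope is of real type
or has essential Wythoff dimension at most `1`. -/
def HermanMonsonAssertion : Prop :=
  ∀ (n : ℕ) (P : Type) [PartialOrder P] [BoundedOrder P] [Finite P],
    IsAbstractRegularPolytope n P →
    ∀ (d : ℕ) (A : Realization (P ≃o P) (PolytopeVertex P) (EuclideanSpace ℝ (Fin d))),
      A.IsPure → ∀ α : PolytopeVertex P,
        essentialWythoffDim A.spanRep (MulAction.stabilizer (P ≃o P) α) ≤ 1 ∨
          IsOfRealType A.spanRep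

/-! ### The Weil representation of `SL(2, p)` -/

section Weil

variable (p : ℕ) [Fact p.Prime]

/-- The operators `(T v f)(t) = ζ ^ (y t + x y / 2) f(t + x)`, for `v = (x, y)` and
`ζ = exp (2 π i / p)`, of the Schrödinger representation of the Heisenberg group.  They satisfy
`T v ∘ T w = ζ ^ (ω(v, w) / 2) T (v + w)` with `ω(v, w) = v 0 * w 1 - w 0 * v 1`. -/
noncomputable def heisenbergOperator (v : Fin 2 → ZMod p) :
    (ZMod p → ℂ) →ₗ[ℂ] (ZMod p → ℂ) where
  toFun f t := ZMod.stdAddChar (v 1 * t + v 0 * v 1 / 2) * f (t + v 0)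
  map_add' f g := by funext t; exact mul_add _ _ _
  map_smul' c f := by funext t; exact mul_left_comm _ _ _

/-- A Weil representation of `SL(2, p)` (`p` odd): a representation on the space of the Schrödinger
representation which implements the action of `SL(2, p)` on the Heisenberg group. -/
def IsWeilRepresentation (ρ : Representation ℂ SL(2, ZMod p) (ZMod p → ℂ)) : Prop :=
  ∀ (g : SL(2, ZMod p)) (v : Fin 2 → ZMod p),
    ρ g ∘ₗ heisenbergOperator p v = heisenbergOperator p (g.1.mulVec v) ∘ₗ ρ g

variable {p}

/-- The character of the subrepresentation of `ρ` on which `-1` acts trivially. -/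
noncomputable def evenCharacter (ρ : Representation ℂ SL(2, ZMod p) (ZMod p → ℂ))
    (g : SL(2, ZMod p)) : ℂ :=
  (ρ.character g + ρ.character (-g)) / 2

end Weil

/-! The vertex stabilizer is kept of bounded size while the representation grows with `p`. Take `p ≡
15 (mod 28)`, `ν` of order `14` in `ZMod p`, `w = [[0, 1], [-1, 0]]` and `y = diag(ν, ν⁻¹)`. The
classes of `w` and `w * y` serve as `s 1` and `s 2`; they generate a dihedral group of order `14`,
the stabilizer of the base vertex. As `-1` is not a square, `-1` acts in the Weil representation by
`f(t) ↦ -f(-t)`, so the part that descends to `PSL(2, p)` is the space of odd functions, of complex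
dimension `(p - 1) / 2`.

Complex type: lower unipotent matrices act diagonally on the odd functions, and the complex lines
spanned by the functions `oddSingle s` carry distinct characters, none of them conjugate to another
because `-1` is not a square. Hence even real-linear commuting maps preserve these lines; they are
complex linear there because a nonreal root of unity acts, and diagonal matrices permute the lines
transitively. This gives commutant `ℂ` (`oddRep_commutant`) and irreducibility over `ℝ`
(`oddRep_isIrreducible`).

Large Wythoff space: if `u(νt) = -u(t)`, then `u` is odd and fixed by `y`, so `u + w u` is fixed by
the dihedral group. On combinations of `N` alternating orbit sums this symmetrization is injective
once `(14 N) ^ 2 < p`, since `w` is a Fourier transform with factor of modulus `p ^ (-1/2)` and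
cannot reproduce a function with small support (`symmetrize_comp_injective`).

Generation: `s 0` comes from a traceless matrix that anticommutes with `w * y`, built from a
solution of `e ^ 2 + f ^ 2 = -1`. To see that the three matrices generate `SL(2, p)`, let `K` be
their span. If `p` divides the order of `K`, transvections with two different centres occur and `K`
is everything (`eq_top_of_dvd_card`). Otherwise centralizers of noncentral elements partition the
noncentral part of `K`, and a class equation shows that a torus with at least `14` elements
containing an inverted `y` is normalized by all of `K` (`IsTorusLike.normalizes`), which `s 0`
violates. The intersection property follows because `s 1 * s 2` has prime order `7` and no two
involutions generate `PSL(2, p)`.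

The polytope is the coset geometry of the string C-group, and Wythoff's construction turns a fixed
vector into a pure realization. -/

/-! ### Class equation for groups in which commuting is transitive off the centre -/

section CentralizerCounting

variable {Γ : Type*} [Group Γ]

/-- Commuting is a transitive relation on the elements outside `{1, z}`, where `z` is a central
involution, squares of such elements are not trivial, and an element which normalizes the
centralizer of `g ∉ {1, z}` fixes or inverts `g`. -/
structure IsTorusLike (z : Γ) : Prop where
  ne_one : z ≠ 1
  central : ∀ g, Commute z g
  trans : ∀ g h k : Γ, h ≠ 1 → h ≠ z → Commute g h → Commute h k → Commute g k
  conj : ∀ g x : Γ, g ≠ 1 → g ≠ z → Commute (x * g * x⁻¹) g → x * g * x⁻¹ = g ∨ x * g * x⁻¹ = g⁻¹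
  sq_ne : ∀ g : Γ, g ≠ 1 → g ≠ z → g ^ 2 ≠ 1
  sq_z : z * z = 1

variable {z : Γ}

theorem IsTorusLike.conj_ne (hz : IsTorusLike z) {g : Γ} (x : Γ) (h1 : g ≠ 1) (h2 : g ≠ z) :
    x * g * x⁻¹ ≠ 1 ∧ x * g * x⁻¹ ≠ z := by
  constructor
  · simpa [conj_eq_one_iff] using h1
  · intro h
    apply h2
    have := (hz.central x).eq
    rw [mul_inv_eq_iff_eq_mul, this] at h
    exact mul_left_cancel h

theorem commute_conj_iff (x g h : Γ) : Commute (x * g * x⁻¹) (x * h * x⁻¹) ↔ Commute g h :=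
  SemiconjBy.conj_iff

variable [Fintype Γ]

open Classical in
/-- The noncentral elements (those outside `{1, z}`) conjugate to an element commuting with `g`. -/
noncomputable def conjCommuting (z g : Γ) : Finset Γ :=
  Finset.univ.filter fun h => h ≠ 1 ∧ h ≠ z ∧ ∃ x : Γ, Commute (x * h * x⁻¹) g

open Classical in
/-- The order of the centralizer of `g`. -/
noncomputable def commCard (g : Γ) : ℕ := (Finset.univ.filter fun h : Γ => Commute h g).card

open Classical in
/-- The number of elements which conjugate `g` into its centralizer. -/
noncomputable def normCard (g : Γ) : ℕ :=
  (Finset.univ.filter fun x : Γ => Commute (x * g * x⁻¹) g).card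

theorem commCard_eq (g : Γ) : commCard g = Nat.card (Subgroup.centralizer {g}) := by
  classical
  unfold commCard
  rw [← Nat.card_eq_finsetCard]
  apply Nat.card_congr
  refine Equiv.subtypeEquivRight fun x => ?_
  simp [Subgroup.mem_centralizer_singleton_iff, Commute, SemiconjBy, eq_comm]

/-- Conjugating `g` into its centralizer means fixing or inverting `g`, and these exclude each other
because `g ^ 2 ≠ 1`. The elements that invert `g` form the empty set or a coset of the centralizer.
-/
theorem IsTorusLike.normCard_cases (hz : IsTorusLike z) {g : Γ} (h1 : g ≠ 1) (h2 : g ≠ z) :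
    normCard g = commCard g ∨ normCard g = 2 * commCard g := by
  classical
  have hgg : g ≠ g⁻¹ := fun h => hz.sq_ne g h1 h2 (by rw [sq]; nth_rewrite 2 [h]; simp)
  have key : ∀ x : Γ, Commute (x * g * x⁻¹) g ↔ Commute x g ∨ x * g * x⁻¹ = g⁻¹ := by
    intro x
    constructor
    · intro h
      rcases hz.conj g x h1 h2 h with h | h
      · left; exact mul_inv_eq_iff_eq_mul.1 h
      · right; exact h
    · rintro (h | h)
      · rw [h.eq, mul_inv_cancel_right]
      · rw [h]; exact (Commute.refl g).inv_left
  have hsplit : normCard g = commCard g + (Finset.univ.filter fun x : Γ => x * g * x⁻¹ = g⁻¹).card := by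
    unfold normCard commCard
    rw [← Finset.card_union_of_disjoint, ← Finset.filter_or]
    · simp only [key]
    · rw [Finset.disjoint_filter]
      rintro x - h h'
      rw [h.eq, mul_inv_cancel_right] at h'
      exact hgg h'
  by_cases hex : ∃ n : Γ, n * g * n⁻¹ = g⁻¹
  · right
    obtain ⟨n, hn⟩ := hex
    rw [hsplit, two_mul]
    congr 1
    unfold commCard
    symm
    apply Finset.card_bij (fun x _ => n * x)
    · intro x hx
      simp only [Finset.mem_filter, Finset.mem_univ, true_and] at hx ⊢
      rw [mul_inv_rev, mul_assoc, mul_assoc, ← mul_assoc g, ← mul_assoc x, ← mul_assoc x, hx.eq,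
        mul_inv_cancel_right, ← mul_assoc, hn]
    · intro a _ b _ h; exact mul_left_cancel h
    · intro b hb
      simp only [Finset.mem_filter, Finset.mem_univ, true_and] at hb ⊢
      refine ⟨n⁻¹ * b, ?_, by simp⟩
      have : b * g = n * g * n⁻¹ * b := by rw [hn, ← hb]; group
      show n⁻¹ * b * g = g * (n⁻¹ * b)
      rw [mul_assoc, this]; group
  · left
    push Not at hex
    rw [hsplit, Finset.filter_false_of_mem (fun x _ => hex x)]
    simp

/-- Double counting of the pairs `(x, h)` with `h` noncentral and `x * h * x⁻¹` commuting with `g`.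
For fixed `x`, conjugation matches the `h` with the noncentral part of the centralizer; for fixed
admissible `h`, transitivity of commuting makes the `x` a right translate of the set counted by
`normCard g`. -/
theorem IsTorusLike.card_mul (hz : IsTorusLike z) {g : Γ} (h1 : g ≠ 1) (h2 : g ≠ z) :
    normCard g * (conjCommuting z g).card = Fintype.card Γ * (commCard g - 2) := by
  classical
  have hcomm : (Finset.univ.filter fun h : Γ => Commute h g ∧ h ≠ 1 ∧ h ≠ z).card = commCard g - 2 := by
    unfold commCard
    have : (Finset.univ.filter fun h : Γ => Commute h g ∧ h ≠ 1 ∧ h ≠ z) =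
        (Finset.univ.filter fun h : Γ => Commute h g) \ {1, z} := by
      ext x; simp
    rw [this, Finset.card_sdiff_of_subset, Finset.card_pair hz.ne_one.symm]
    intro x hx
    simp only [Finset.mem_insert, Finset.mem_singleton] at hx
    rcases hx with rfl | rfl
    · simp
    · simpa using hz.central g
  have hA := Finset.sum_card_bipartiteAbove_eq_sum_card_bipartiteBelow
    (s := (Finset.univ : Finset Γ)) (t := Finset.univ)
    (fun x h => (Commute (x * h * x⁻¹) g ∧ h ≠ 1 ∧ h ≠ z : Prop))
  have hL : ∀ x ∈ (Finset.univ : Finset Γ), (Finset.bipartiteAbove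
      (fun x h => (Commute (x * h * x⁻¹) g ∧ h ≠ 1 ∧ h ≠ z : Prop)) Finset.univ x).card =
      commCard g - 2 := by
    intro x _
    rw [← hcomm]
    unfold Finset.bipartiteAbove
    apply Finset.card_bij (fun h _ => x * h * x⁻¹)
    · intro h hh
      simp only [Finset.mem_filter, Finset.mem_univ, true_and] at hh ⊢
      exact ⟨hh.1, hz.conj_ne x hh.2.1 hh.2.2⟩
    · intro a _ b _ h; simpa using h
    · intro b hb
      simp only [Finset.mem_filter, Finset.mem_univ, true_and] at hb ⊢
      refine ⟨x⁻¹ * b * x, ⟨?_, ?_⟩, by group⟩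
      · convert hb.1 using 1; group
      · simpa using hz.conj_ne x⁻¹ hb.2.1 hb.2.2
  rw [Finset.sum_congr rfl hL, Finset.sum_const, Finset.card_univ, smul_eq_mul] at hA
  rw [hA]
  have hR : ∀ h ∈ (Finset.univ : Finset Γ), (Finset.bipartiteBelow
      (fun x h => (Commute (x * h * x⁻¹) g ∧ h ≠ 1 ∧ h ≠ z : Prop)) Finset.univ h).card =
      if h ∈ conjCommuting z g then normCard g else 0 := by
    intro h _
    unfold Finset.bipartiteBelow
    split_ifs with hh
    · simp only [conjCommuting, Finset.mem_filter, Finset.mem_univ, true_and] at hh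
      obtain ⟨hh1, hh2, x₀, hx₀⟩ := hh
      unfold normCard
      have hk := hz.conj_ne x₀ hh1 hh2
      apply Finset.card_bij (fun x _ => x * x₀⁻¹)
      · intro x hx
        simp only [Finset.mem_filter, Finset.mem_univ, true_and] at hx ⊢
        have e : x * h * x⁻¹ = (x * x₀⁻¹) * (x₀ * h * x₀⁻¹) * (x * x₀⁻¹)⁻¹ := by group
        have h3 := (commute_conj_iff (x * x₀⁻¹) _ _).2 hx₀
        rw [← e] at h3
        have h4 := hz.conj_ne x hh1 hh2
        exact hz.trans _ _ _ h4.1 h4.2 h3.symm hx.1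
      · intro a _ b _ h; exact mul_right_cancel h
      · intro n hn
        simp only [Finset.mem_filter, Finset.mem_univ, true_and] at hn ⊢
        refine ⟨n * x₀, ⟨?_, hh1, hh2⟩, by simp⟩
        have e : n * x₀ * h * (n * x₀)⁻¹ = n * (x₀ * h * x₀⁻¹) * n⁻¹ := by group
        rw [e]
        have h3 := (commute_conj_iff n _ _).2 hx₀
        have h4 := hz.conj_ne n h1 h2
        exact hz.trans _ _ _ h4.1 h4.2 h3 hn
    · rw [Finset.card_eq_zero, Finset.filter_eq_empty_iff]
      intro x _ hx
      exact hh (by simp only [conjCommuting, Finset.mem_filter, Finset.mem_univ, true_and]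
                   exact ⟨hx.2.1, hx.2.2, x, hx.1⟩)
  rw [Finset.sum_congr rfl hR]
  simp [Finset.sum_ite_mem, mul_comm]

theorem IsTorusLike.even_commCard (hz : IsTorusLike z) (g : Γ) : 2 ∣ commCard g := by
  rw [commCard_eq]
  have h : orderOf z = 2 := orderOf_eq_prime (by rw [sq]; exact hz.sq_z) hz.ne_one
  have : z ∈ Subgroup.centralizer {g} := by
    rw [Subgroup.mem_centralizer_singleton_iff]; exact (hz.central g).eq
  have h2 := orderOf_dvd_natCard (⟨z, this⟩ : Subgroup.centralizer {g})
  rwa [Subgroup.orderOf_mk, h] at h2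

theorem IsTorusLike.four_le_commCard (hz : IsTorusLike z) {g : Γ} (h1 : g ≠ 1) (h2 : g ≠ z) :
    4 ≤ commCard g := by
  classical
  obtain ⟨k, hk⟩ := hz.even_commCard g
  have : ({1, z, g} : Finset Γ).card ≤ commCard g := by
    apply Finset.card_le_card
    intro x hx
    simp only [Finset.mem_insert, Finset.mem_singleton] at hx
    rcases hx with rfl | rfl | rfl
    · simp
    · simpa using hz.central g
    · simp
  rw [Finset.card_eq_three.2 ⟨1, z, g, hz.ne_one.symm, h1.symm, h2.symm, rfl⟩] at this
  omega

/-- Having commuting conjugates is an equivalence relation on noncentral elements, and the sets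
`conjCommuting` are its classes. -/
theorem IsTorusLike.disjoint (hz : IsTorusLike z) {g g' : Γ}
    (h : g' ∉ conjCommuting z g) (h1' : g' ≠ 1) (h2' : g' ≠ z) :
    Disjoint (conjCommuting z g) (conjCommuting z g') := by
  classical
  rw [Finset.disjoint_left]
  intro k hk hk'
  apply h
  simp only [conjCommuting, Finset.mem_filter, Finset.mem_univ, true_and] at hk hk' ⊢
  obtain ⟨k1, k2, x, hx⟩ := hk
  obtain ⟨-, -, x', hx'⟩ := hk'
  refine ⟨h1', h2', x * x'⁻¹, ?_⟩
  have e : x * k * x⁻¹ = (x * x'⁻¹) * (x' * k * x'⁻¹) * (x * x'⁻¹)⁻¹ := by group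
  have h3 := (commute_conj_iff (x * x'⁻¹) _ _).2 hx'
  rw [← e] at h3
  have h4 := hz.conj_ne x k1 k2
  exact hz.trans _ _ _ h4.1 h4.2 h3.symm hx

/-- Here `u` is the index of the centralizer. Its order is even and at least `4`, so it is `4` or at
least `6`; this gap in `u` drives the numerical cases of `IsTorusLike.normalizes`. -/
theorem IsTorusLike.card_cases (hz : IsTorusLike z) {g : Γ} (h1 : g ≠ 1) (h2 : g ≠ z) :
    ∃ u : ℚ, 0 < u ∧ u * commCard g = Fintype.card Γ ∧
      (u = Fintype.card Γ / 4 ∨ u ≤ Fintype.card Γ / 6) ∧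
      ((normCard g = commCard g ∧ ((conjCommuting z g).card : ℚ) = Fintype.card Γ - 2 * u) ∨
        (normCard g = 2 * commCard g ∧
          ((conjCommuting z g).card : ℚ) = Fintype.card Γ / 2 - u)) := by
  have h4 := hz.four_le_commCard h1 h2
  have hk : (0 : ℚ) < Fintype.card Γ := by exact_mod_cast Fintype.card_pos
  have hm := hz.card_mul h1 h2
  zify [show 2 ≤ commCard g by omega] at hm
  have hm' : (normCard g : ℚ) * (conjCommuting z g).card = Fintype.card Γ * (commCard g - 2) := by
    exact_mod_cast hm
  have hc : (4 : ℚ) ≤ commCard g := by exact_mod_cast h4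
  have hc0 : (commCard g : ℚ) ≠ 0 := by positivity
  refine ⟨Fintype.card Γ / commCard g, by positivity, by field_simp, ?_, ?_⟩
  · obtain ⟨m, hm⟩ := hz.even_commCard g
    rcases Nat.lt_or_ge m 3 with h | h
    · left
      have : commCard g = 4 := by omega
      rw [this]; norm_num
    · right
      have : (6 : ℚ) ≤ commCard g := by exact_mod_cast (by omega : 6 ≤ commCard g)
      gcongr
  · rcases hz.normCard_cases h1 h2 with h | h
    · left
      refine ⟨h, ?_⟩
      rw [h] at hm'
      field_simp
      linarith
    · right
      refine ⟨h, ?_⟩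
      rw [h] at hm'
      push_cast at hm'
      field_simp
      linarith

/-- The set counted by `normCard g` is disjoint from its left translate by `x`. -/
theorem IsTorusLike.two_mul_normCard_le (hz : IsTorusLike z) {g x : Γ} (h1 : g ≠ 1) (h2 : g ≠ z)
    (hx : ¬ Commute (x * g * x⁻¹) g) : 2 * normCard g ≤ Fintype.card Γ := by
  classical
  set N := Finset.univ.filter fun x : Γ => Commute (x * g * x⁻¹) g with hN
  have hd : Disjoint N (N.image (x * ·)) := by
    rw [Finset.disjoint_right]
    intro a ha ha'
    obtain ⟨m, hm, rfl⟩ := Finset.mem_image.1 ha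
    simp only [hN, Finset.mem_filter, Finset.mem_univ, true_and] at hm ha'
    apply hx
    have h3 := (commute_conj_iff x _ _).2 hm
    have e : x * m * g * (x * m)⁻¹ = x * (m * g * m⁻¹) * x⁻¹ := by group
    rw [e] at ha'
    have h4 := hz.conj_ne (x * m) h1 h2
    rw [e] at h4
    exact (hz.trans _ _ _ h4.1 h4.2 ha'.symm h3).symm
  have := Finset.card_le_univ (N ∪ N.image (x * ·))
  rw [Finset.card_union_of_disjoint hd, Finset.card_image_of_injective _ (mul_right_injective x)]
    at this
  show 2 * N.card ≤ _
  omega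

theorem IsTorusLike.exists_notMem (hz : IsTorusLike z) (S : Finset Γ)
    (h : (S.card : ℚ) < Fintype.card Γ - 2) : ∃ g, g ≠ 1 ∧ g ≠ z ∧ g ∉ S := by
  classical
  by_contra! hc
  have : (Finset.univ : Finset Γ) ⊆ S ∪ {1, z} := by
    intro g _
    simp only [Finset.mem_union, Finset.mem_insert, Finset.mem_singleton]
    by_cases h1 : g = 1
    · simp [h1]
    by_cases h2 : g = z
    · simp [h2]
    exact Or.inl (hc g h1 h2)
  have h3 := (Finset.card_le_card this).trans (Finset.card_union_le _ _)
  rw [Finset.card_pair hz.ne_one.symm, Finset.card_univ] at h3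
  have : (Fintype.card Γ : ℚ) ≤ S.card + 2 := by exact_mod_cast h3
  linarith

theorem IsTorusLike.card_le (hz : IsTorusLike z) (S : Finset Γ) (h1 : (1 : Γ) ∉ S) (h2 : z ∉ S) :
    (S.card : ℚ) ≤ Fintype.card Γ - 2 := by
  classical
  have h3 := Finset.card_le_univ (S ∪ {1, z})
  rw [Finset.card_union_of_disjoint, Finset.card_pair hz.ne_one.symm] at h3
  · have : (S.card : ℚ) + 2 ≤ Fintype.card Γ := by exact_mod_cast h3
    linarith
  · rw [Finset.disjoint_right]; simp [h1, h2]

/-- If the centralizer of `y` has at least `14` elements and `y` is conjugate to its inverse,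
then every element fixes or inverts `y`. -/
theorem IsTorusLike.normalizes (hz : IsTorusLike z) {y w : Γ} (h1 : y ≠ 1) (h2 : y ≠ z)
    (h14 : 14 ≤ commCard y) (hw : w * y * w⁻¹ = y⁻¹) (x : Γ) :
    x * y * x⁻¹ = y ∨ x * y * x⁻¹ = y⁻¹ := by
  classical
  apply hz.conj y x h1 h2
  -- If `x` does not normalize the centralizer of `y`, the class equation is contradicted: with `k`
  -- the order of the group, too many classes are needed to exhaust the `k - 2` noncentral elements.
  by_contra hx
  have hle := hz.two_mul_normCard_le h1 h2 hx
  have hn1 : ∀ g, (1 : Γ) ∉ conjCommuting z g := fun g => by simp [conjCommuting]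
  have hnz : ∀ g, z ∉ conjCommuting z g := fun g => by simp [conjCommuting]
  have hmem : ∀ g, g ≠ 1 → g ≠ z → g ∈ conjCommuting z g := fun g h h' => by
    simp only [conjCommuting, Finset.mem_filter, Finset.mem_univ, true_and]
    exact ⟨h, h', 1, by simp⟩
  have hk : (0 : ℚ) < Fintype.card Γ := by exact_mod_cast Fintype.card_pos
  obtain ⟨v, hv0, hvk, -, hv⟩ := hz.card_cases h1 h2
  have hv : normCard y = 2 * commCard y ∧
      ((conjCommuting z y).card : ℚ) = Fintype.card Γ / 2 - v := by
    -- The element `w` inverts `y` and so lies outside its centralizer, which excludes the case of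
    -- equality.
    refine hv.resolve_left fun ⟨h, _⟩ => ?_
    have h3 : normCard y ≤ commCard y := h.le
    have h4 : w ∈ (Finset.univ.filter fun x : Γ => Commute (x * y * x⁻¹) y) := by
      simp [hw]
    have h5 : (Finset.univ.filter fun h : Γ => Commute h y) ⊆
        (Finset.univ.filter fun x : Γ => Commute (x * y * x⁻¹) y) := by
      intro a ha
      simp only [Finset.mem_filter, Finset.mem_univ, true_and] at ha ⊢
      rw [ha.eq, mul_inv_cancel_right]
    rw [← Finset.eq_of_subset_of_card_le h5 h3] at h4
    simp only [Finset.mem_filter, Finset.mem_univ, true_and] at h4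
    rw [h4.eq, mul_inv_cancel_right] at hw
    exact hz.sq_ne y h1 h2 (by rw [sq]; nth_rewrite 2 [hw]; simp)
  obtain ⟨hv1, hv2⟩ := hv
  have h14' : (14 : ℚ) ≤ commCard y := by exact_mod_cast h14
  have hle' : 4 * (commCard y : ℚ) ≤ Fintype.card Γ := by
    rw [hv1] at hle
    exact_mod_cast (by omega : 4 * commCard y ≤ Fintype.card Γ)
  -- The centralizer has index `v`: at most `k / 14` by its size, and at least `4` because its
  -- normalizer is twice as large and proper.
  have hv14 : v ≤ Fintype.card Γ / 14 := by nlinarith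
  have hv4 : 4 ≤ v := by
    rw [← hvk] at hle'
    exact le_of_mul_le_mul_right hle' (by linarith)
  obtain ⟨g, hg1, hgz, hg⟩ := hz.exists_notMem (conjCommuting z y) (by linarith)
  have hd := hz.disjoint hg hg1 hgz
  have hs := Finset.card_union_of_disjoint hd
  have hsl := hz.card_le (conjCommuting z y ∪ conjCommuting z g) (by simp [hn1]) (by simp [hnz])
  have hs' : ((conjCommuting z y ∪ conjCommuting z g).card : ℚ) =
    (conjCommuting z y).card + (conjCommuting z g).card := by exact_mod_cast hs
  obtain ⟨u, hu0, -, hu, hug⟩ := hz.card_cases hg1 hgz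
  -- The two classes have `k - v - u` elements together, or `k - v` if the second is
  -- self-normalizing with `u = k / 4`; both are less than `k - 2`. The self-normalizing case with
  -- `u ≤ k / 6` exceeds the bound `hsl`.
  have step : ((conjCommuting z y ∪ conjCommuting z g).card : ℚ) < Fintype.card Γ - 2 := by
    rcases hug with ⟨-, h⟩ | ⟨-, h⟩ <;> rcases hu with h' | h' <;> linarith
  obtain ⟨g₂, hg₂1, hg₂z, hg₂⟩ := hz.exists_notMem _ step
  rw [Finset.mem_union, not_or] at hg₂
  have hd₂ : Disjoint (conjCommuting z y ∪ conjCommuting z g) (conjCommuting z g₂) :=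
    Finset.disjoint_union_left.2
      ⟨hz.disjoint hg₂.1 hg₂1 hg₂z, hz.disjoint hg₂.2 hg₂1 hg₂z⟩
  have hs₂ := Finset.card_union_of_disjoint hd₂
  have hsl₂ := hz.card_le (conjCommuting z y ∪ conjCommuting z g ∪ conjCommuting z g₂)
    (by simp [hn1]) (by simp [hnz])
  have hs₂' : ((conjCommuting z y ∪ conjCommuting z g ∪ conjCommuting z g₂).card : ℚ) =
    (conjCommuting z y ∪ conjCommuting z g).card + (conjCommuting z g₂).card := by
      exact_mod_cast hs₂
  obtain ⟨u₂, hu₂0, -, hu₂, hug₂⟩ := hz.card_cases hg₂1 hg₂z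
  -- Only one case survives the bound `hsl₂`: both new normalizers are twice the centralizers and `u
  -- = u₂ = k / 4`, so that the total is `k - v`. In any other case `v ≤ k / 14` pushes the total
  -- above `k`.
  have step₂ : ((conjCommuting z y ∪ conjCommuting z g ∪ conjCommuting z g₂).card : ℚ) <
      Fintype.card Γ - 2 := by
    rcases hug with ⟨-, h⟩ | ⟨-, h⟩ <;> rcases hu with h' | h' <;>
      rcases hug₂ with ⟨-, h₂⟩ | ⟨-, h₂⟩ <;> rcases hu₂ with h₂' | h₂' <;> linarith
  obtain ⟨g₃, hg₃1, hg₃z, hg₃⟩ := hz.exists_notMem _ step₂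
  rw [Finset.mem_union, Finset.mem_union, not_or, not_or] at hg₃
  have hd₃ : Disjoint (conjCommuting z y ∪ conjCommuting z g ∪ conjCommuting z g₂)
      (conjCommuting z g₃) :=
    Finset.disjoint_union_left.2 ⟨Finset.disjoint_union_left.2
      ⟨hz.disjoint hg₃.1.1 hg₃1 hg₃z, hz.disjoint hg₃.1.2 hg₃1 hg₃z⟩,
      hz.disjoint hg₃.2 hg₃1 hg₃z⟩
  have hs₃ := Finset.card_union_of_disjoint hd₃
  have hsl₃ := hz.card_le
    (conjCommuting z y ∪ conjCommuting z g ∪ conjCommuting z g₂ ∪ conjCommuting z g₃)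
    (by simp [hn1]) (by simp [hnz])
  have hs₃' : ((conjCommuting z y ∪ conjCommuting z g ∪ conjCommuting z g₂ ∪
      conjCommuting z g₃).card : ℚ) =
    (conjCommuting z y ∪ conjCommuting z g ∪ conjCommuting z g₂).card +
      (conjCommuting z g₃).card := by exact_mod_cast hs₃
  obtain ⟨u₃, hu₃0, -, hu₃, hug₃⟩ := hz.card_cases hg₃1 hg₃z
  have q : ∀ t : ℚ, (t = Fintype.card Γ / 4 ∨ t ≤ Fintype.card Γ / 6) → t ≤ Fintype.card Γ / 4 := by
    rintro t (h | h) <;> linarith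
  have := q _ hu
  have := q _ hu₂
  have := q _ hu₃
  -- Each of the three further classes has at least `k / 4` elements and that of `y` has at least `k
  -- / 2 - k / 14`, which is more than `k` in all.
  rcases hug with ⟨-, h⟩ | ⟨-, h⟩ <;> rcases hug₂ with ⟨-, h₂⟩ | ⟨-, h₂⟩ <;>
    rcases hug₃ with ⟨-, h₃⟩ | ⟨-, h₃⟩ <;> linarith

end CentralizerCounting

/-! ### Commutation and conjugation in SL(2, F) -/

section SL2

variable {F : Type*} [Field F]

/-- The matrix with the given entries, as an element of `SL(2, F)`. -/
def sl2 (a b c d : F) (h : a * d - b * c = 1) : SL(2, F) :=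
  ⟨!![a, b; c, d], by rw [Matrix.det_fin_two_of]; exact h⟩

theorem sl2_congr {a b c d a' b' c' d' : F} {h : a * d - b * c = 1} {h' : a' * d' - b' * c' = 1}
    (ha : a = a') (hb : b = b') (hc : c = c') (hd : d = d') : sl2 a b c d h = sl2 a' b' c' d' h' := by
  subst ha hb hc hd; rfl

theorem sl2_eq (g : SL(2, F)) : ∃ a b c d h, g = sl2 a b c d h := by
  induction g using Matrix.SpecialLinearGroup.fin_two_induction with
  | h a b c d h => exact ⟨a, b, c, d, h, rfl⟩

theorem sl2_mul (a b c d : F) (h) (a' b' c' d' : F) (h') : sl2 a b c d h * sl2 a' b' c' d' h' =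
    sl2 (a * a' + b * c') (a * b' + b * d') (c * a' + d * c') (c * b' + d * d')
      (by linear_combination (a' * d' - b' * c') * h + h') := by
  apply Subtype.ext
  show !![a, b; c, d] * !![a', b'; c', d'] = _
  rw [Matrix.mul_fin_two]; rfl

theorem sl2_inv (a b c d : F) (h) : (sl2 a b c d h)⁻¹ = sl2 d (-b) (-c) a (by linear_combination h) := by
  apply Subtype.ext
  rw [Matrix.SpecialLinearGroup.coe_inv]
  show Matrix.adjugate !![a, b; c, d] = _
  rw [Matrix.adjugate_fin_two_of]; rfl

theorem sl2_neg (a b c d : F) (h) : -(sl2 a b c d h) = sl2 (-a) (-b) (-c) (-d) (by linear_combination h) := by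
  apply Subtype.ext
  rw [Matrix.SpecialLinearGroup.coe_neg]
  show -!![a, b; c, d] = !![-a, -b; -c, -d]
  simp

theorem sl2_one : (1 : SL(2, F)) = sl2 1 0 0 1 (by ring) := by
  apply Subtype.ext
  exact Matrix.one_fin_two

theorem sl2_inj {a b c d : F} {h} {a' b' c' d' : F} {h'} :
    sl2 a b c d h = sl2 a' b' c' d' h' ↔ a = a' ∧ b = b' ∧ c = c' ∧ d = d' := by
  constructor
  · intro e
    have := congrArg Subtype.val e
    simp only [sl2] at this
    have h1 := congrFun (congrFun this 0) 0
    have h2 := congrFun (congrFun this 0) 1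
    have h3 := congrFun (congrFun this 1) 0
    have h4 := congrFun (congrFun this 1) 1
    exact ⟨h1, h2, h3, h4⟩
  · rintro ⟨h1, h2, h3, h4⟩
    exact sl2_congr h1 h2 h3 h4

/-- Two matrices commute exactly when their traceless parts, with coordinates `(a - d, b, c)`, are
proportional. Transitivity of commuting off `±1` follows, since the traceless part is nonzero there.
-/
theorem sl2_commute_iff {a b c d : F} {h} {a' b' c' d' : F} {h'} :
    Commute (sl2 a b c d h) (sl2 a' b' c' d' h') ↔
      b * c' = b' * c ∧ (a - d) * b' = (a' - d') * b ∧ (a - d) * c' = (a' - d') * c := by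
  unfold Commute SemiconjBy
  rw [sl2_mul, sl2_mul, sl2_inj]
  constructor
  · rintro ⟨h1, h2, h3, h4⟩
    exact ⟨by linear_combination h1, by linear_combination h2, by linear_combination - h3⟩
  · rintro ⟨h1, h2, h3⟩
    exact ⟨by linear_combination h1, by linear_combination h2, by linear_combination - h3,
      by linear_combination -h1⟩

theorem sl2_scalar {a b c d : F} {h} (hb : b = 0) (hc : c = 0) (hd : a = d) :
    sl2 a b c d h = 1 ∨ sl2 a b c d h = -1 := by
  subst hb hc hd
  have : (a - 1) * (a + 1) = 0 := by linear_combination h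
  rw [sl2_one, sl2_neg, sl2_inj, sl2_inj]
  rcases mul_eq_zero.1 this with h | h
  · left; have : a = 1 := by linear_combination h
    simp [this]
  · right; have : a = -1 := by linear_combination h
    simp [this]

theorem sl2_ne_scalar {a b c d : F} {h} (h1 : sl2 a b c d h ≠ 1) (h2 : sl2 a b c d h ≠ -1) :
    b ≠ 0 ∨ c ≠ 0 ∨ a - d ≠ 0 := by
  by_contra! hc
  rcases sl2_scalar (h := h) hc.1 hc.2.1 (sub_eq_zero.1 hc.2.2) with h | h
  · exact h1 h
  · exact h2 h

theorem sl2_commute_trans {g h k : SL(2, F)} (h1 : h ≠ 1) (h2 : h ≠ -1) (hgh : Commute g h)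
    (hhk : Commute h k) : Commute g k := by
  obtain ⟨a, b, c, d, hd, rfl⟩ := sl2_eq g
  obtain ⟨a', b', c', d', hd', rfl⟩ := sl2_eq h
  obtain ⟨a'', b'', c'', d'', hd'', rfl⟩ := sl2_eq k
  rw [sl2_commute_iff] at *
  obtain ⟨p1, p2, p3⟩ := hgh
  obtain ⟨q1, q2, q3⟩ := hhk
  rcases sl2_ne_scalar h1 h2 with h | h | h
  · refine ⟨mul_left_cancel₀ h ?_, mul_left_cancel₀ h ?_, mul_left_cancel₀ h ?_⟩ <;> grind
  · refine ⟨mul_left_cancel₀ h ?_, mul_left_cancel₀ h ?_, mul_left_cancel₀ h ?_⟩ <;> grind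
  · refine ⟨mul_left_cancel₀ h ?_, mul_left_cancel₀ h ?_, mul_left_cancel₀ h ?_⟩ <;> grind

theorem sl2_conj_eq (x : SL(2, F)) {a b c d : F} (h : a * d - b * c = 1) :
    ∃ a' b' c' d' h', x * sl2 a b c d h * x⁻¹ = sl2 a' b' c' d' h' ∧ a' + d' = a + d := by
  obtain ⟨p, q, r, s, hx, rfl⟩ := sl2_eq x
  rw [sl2_inv, sl2_mul, sl2_mul]
  exact ⟨_, _, _, _, _, rfl, by linear_combination (a + d) * hx⟩

/-- The traceless part of the conjugate is `β` times that of `g`. Both have the same discriminant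
`(a - d) ^ 2 + 4 b c`, which is nonzero by `htr`, so `β ^ 2 = 1`; the traces agree as well. -/
theorem sl2_conj_cases {g x : SL(2, F)} (htr : (g 0 0 + g 1 1) ^ 2 ≠ 4) (h2 : (2 : F) ≠ 0)
    (hc : Commute (x * g * x⁻¹) g) : x * g * x⁻¹ = g ∨ x * g * x⁻¹ = g⁻¹ := by
  obtain ⟨a, b, c, d, hd, rfl⟩ := sl2_eq g
  obtain ⟨a', b', c', d', hd', he, ht⟩ := sl2_conj_eq x hd
  rw [he] at hc ⊢
  rw [sl2_commute_iff] at hc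
  replace htr : (a + d) ^ 2 ≠ 4 := htr
  obtain ⟨p1, p2, p3⟩ := hc
  rw [sl2_inv, sl2_inj, sl2_inj]
  have hQ : (a - d) ^ 2 + 4 * b * c ≠ 0 := fun h => htr (by linear_combination h + 4 * hd)
  have hQ' : (a' - d') ^ 2 + 4 * b' * c' = (a - d) ^ 2 + 4 * b * c := by
    linear_combination (a' + d' + a + d) * ht - 4 * hd' + 4 * hd
  have hβ : ∃ β : F, a' - d' = β * (a - d) ∧ b' = β * b ∧ c' = β * c := by
    by_cases hb : b = 0
    · have had : a - d ≠ 0 := fun h => hQ (by rw [h, hb]; ring)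
      refine ⟨(a' - d') / (a - d), ?_, ?_, ?_⟩ <;> field_simp
      · linear_combination -p2
      · linear_combination -p3
    · refine ⟨b' / b, ?_, ?_, ?_⟩ <;> field_simp
      · linear_combination p2
      · linear_combination -p1
  obtain ⟨β, hβ1, hβ2, hβ3⟩ := hβ
  have : (β - 1) * (β + 1) = 0 := by
    apply mul_left_cancel₀ hQ
    rw [hβ1, hβ2, hβ3] at hQ'
    linear_combination hQ'
  rcases mul_eq_zero.1 this with h | h
  · left
    obtain rfl : β = 1 := by linear_combination h
    refine ⟨mul_left_cancel₀ h2 ?_, by rw [hβ2, one_mul], by rw [hβ3, one_mul],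
      mul_left_cancel₀ h2 ?_⟩ <;> grind
  · right
    obtain rfl : β = -1 := by linear_combination h
    refine ⟨mul_left_cancel₀ h2 ?_, by rw [hβ2]; ring, by rw [hβ3]; ring,
      mul_left_cancel₀ h2 ?_⟩ <;> grind

theorem sl2_sq_ne_one {g : SL(2, F)} (h2 : (2 : F) ≠ 0) (h1 : g ≠ 1) (hm : g ≠ -1) : g ^ 2 ≠ 1 := by
  intro h
  obtain ⟨a, b, c, d, hd, rfl⟩ := sl2_eq g
  rw [sq, mul_eq_one_iff_eq_inv, sl2_inv, sl2_inj] at h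
  rcases sl2_ne_scalar h1 hm with h' | h' | h' <;> apply h' <;> apply mul_left_cancel₀ h2
  · linear_combination h.2.1
  · linear_combination h.2.2.1
  · linear_combination 2 * h.1

/-- The matrix with rows `(a, b)` and `(c, -a)` has square zero. -/
theorem sl2_unipotent_pow {a b c : F} (h : a ^ 2 + b * c = 0) (k : ℕ) :
    (sl2 (1 + a) b c (1 - a) (by linear_combination -h)) ^ k =
      sl2 (1 + k * a) (k * b) (k * c) (1 - k * a) (by linear_combination -k ^ 2 * h) := by
  induction k with
  | zero => rw [pow_zero, sl2_one]; apply sl2_congr <;> simp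
  | succ k ih =>
    rw [pow_succ, ih, sl2_mul]
    apply sl2_congr <;> push_cast
    · linear_combination k * h
    · ring
    · ring
    · linear_combination k * h

end SL2

/-! ### Subgroups of SL(2, p) that contain w and a large split torus -/

section Generation

variable {p : ℕ} [Fact p.Prime]

theorem sl2_neg_one : (-1 : SL(2, ZMod p)) = sl2 (-1) 0 0 (-1) (by ring) := by
  rw [sl2_one, sl2_neg]; apply sl2_congr <;> simp

theorem sl2_unipotent_pow_char {a b c : ZMod p} (h : a ^ 2 + b * c = 0) :
    (sl2 (1 + a) b c (1 - a) (by linear_combination -h)) ^ p = 1 := by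
  rw [sl2_unipotent_pow h, sl2_one]; apply sl2_congr <;> simp

theorem sl2_of_trace_two {g : SL(2, ZMod p)} (h : g 0 0 + g 1 1 = 2) :
    ∃ (a b c : ZMod p) (h : a ^ 2 + b * c = 0),
      g = sl2 (1 + a) b c (1 - a) (by linear_combination -h) := by
  obtain ⟨a, b, c, d, hd, rfl⟩ := sl2_eq g
  replace h : a + d = 2 := h
  refine ⟨a - 1, b, c, ?_, ?_⟩
  · linear_combination a * h - hd
  · apply sl2_congr
    · ring
    · rfl
    · rfl
    · linear_combination h

theorem sl2_pow_char_of_trace_two {g : SL(2, ZMod p)} (h : g 0 0 + g 1 1 = 2) : g ^ p = 1 := by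
  obtain ⟨a, b, c, h', rfl⟩ := sl2_of_trace_two h
  exact sl2_unipotent_pow_char h'

/-- In characteristic `p`, `(g - 1) ^ p = g ^ p - 1 = 0`, so `g - 1` is nilpotent and has trace
zero. -/
theorem sl2_trace_of_pow_char {g : SL(2, ZMod p)} (h : g ^ p = 1) : g 0 0 + g 1 1 = 2 := by
  have h1 : ((g : Matrix (Fin 2) (Fin 2) (ZMod p)) - 1) ^ p = 0 := by
    rw [sub_pow_char_of_commute p (Commute.one_right _), one_pow, ← Matrix.SpecialLinearGroup.coe_pow, h]
    simp
  have h2 := Matrix.isNilpotent_trace_of_isNilpotent ⟨p, h1⟩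
  have h3 := h2.eq_zero
  rw [Matrix.trace_fin_two] at h3
  simp only [Matrix.sub_apply, Matrix.one_apply_eq] at h3
  linear_combination h3

theorem eq_one_of_pow_char {K : Subgroup SL(2, ZMod p)} (hK : ¬ p ∣ Nat.card K)
    {g : SL(2, ZMod p)} (hg : g ∈ K) (h : g ^ p = 1) : g = 1 := by
  have h1 : orderOf g ∣ p := orderOf_dvd_of_pow_eq_one h
  have h2 := Subgroup.orderOf_dvd_natCard K hg
  have h3 := Nat.dvd_gcd h1 h2
  rw [((Nat.Prime.coprime_iff_not_dvd Fact.out).2 hK).gcd_eq_one, Nat.dvd_one] at h3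
  exact orderOf_eq_one_iff.1 h3

/-- Without elements of order `p`, no element of `K` other than `±1` has trace `±2`, so all of them
are semisimple and `sl2_conj_cases` applies. -/
theorem isTorusLike_of_not_dvd (h2 : (2 : ZMod p) ≠ 0) {K : Subgroup SL(2, ZMod p)}
    (hK : ¬ p ∣ Nat.card K) (hm : -1 ∈ K) : IsTorusLike (⟨-1, hm⟩ : K) where
  ne_one h := by
    have : (-1 : SL(2, ZMod p)) = 1 := congrArg Subtype.val h
    rw [sl2_neg_one, sl2_one, sl2_inj] at this
    exact h2 (by linear_combination -this.1)
  central g := Subtype.ext (by simp)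
  trans g h k h1 hm hgh hhk := by
    have := sl2_commute_trans (fun h => h1 (Subtype.ext h)) (fun h => hm (Subtype.ext h))
      (congrArg Subtype.val hgh.eq) (congrArg Subtype.val hhk.eq)
    exact Subtype.ext this
  conj g x h1 h3 hc := by
    have htr : ((g : SL(2, ZMod p)) 0 0 + (g : SL(2, ZMod p)) 1 1) ^ 2 ≠ 4 := by
      intro h
      have : ((g : SL(2, ZMod p)) 0 0 + (g : SL(2, ZMod p)) 1 1 - 2) *
          ((g : SL(2, ZMod p)) 0 0 + (g : SL(2, ZMod p)) 1 1 + 2) = 0 := by linear_combination h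
      rcases mul_eq_zero.1 this with h | h
      · exact h1 (Subtype.ext (eq_one_of_pow_char hK g.2
          (sl2_pow_char_of_trace_two (sub_eq_zero.1 h))))
      · have hg : -(g : SL(2, ZMod p)) ∈ K := by
          have := K.mul_mem hm g.2
          rwa [neg_one_mul] at this
        have := eq_one_of_pow_char hK hg (sl2_pow_char_of_trace_two (by
          rw [Matrix.SpecialLinearGroup.coe_neg, Matrix.neg_apply, Matrix.neg_apply]
          linear_combination -h))
        exact h3 (Subtype.ext (neg_eq_iff_eq_neg.1 this))
    rcases sl2_conj_cases htr h2 (congrArg Subtype.val hc.eq) with h | h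
    · exact Or.inl (Subtype.ext h)
    · exact Or.inr (Subtype.ext h)
  sq_ne g h1 h3 h := sl2_sq_ne_one h2 (fun h => h1 (Subtype.ext h)) (fun h => h3 (Subtype.ext h))
    (congrArg Subtype.val h)
  sq_z := Subtype.ext (by simp)

theorem eq_top_of_elementary_mem {K : Subgroup SL(2, ZMod p)}
    (hu : ∀ x, sl2 1 x 0 1 (by ring) ∈ K) (hl : ∀ x, sl2 1 0 x 1 (by ring) ∈ K) : K = ⊤ := by
  rw [eq_top_iff]
  intro g _
  refine Matrix.SL2.transvection_induction (· ∈ K) ?_ (fun A B => K.mul_mem) g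
  intro i j hij x
  fin_cases i <;> fin_cases j
  · exact absurd rfl hij
  · convert hu x
    ext i j
    fin_cases i <;> fin_cases j <;> simp [Matrix.SpecialLinearGroup.transvection_coe, sl2]
  · convert hl x
    ext i j
    fin_cases i <;> fin_cases j <;> simp [Matrix.SpecialLinearGroup.transvection_coe, sl2]
  · exact absurd rfl hij

/-- The transvections with centre `(1, m)`. -/
theorem eq_top_of_two_transvection_groups {K : Subgroup SL(2, ZMod p)} {m n : ZMod p} (hmn : m ≠ n)
    (hm : ∀ x, sl2 (1 - x * m) x (-x * m ^ 2) (1 + x * m) (by ring) ∈ K)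
    (hn : ∀ x, sl2 (1 - x * n) x (-x * n ^ 2) (1 + x * n) (by ring) ∈ K) : K = ⊤ := by
  have hnm : n - m ≠ 0 := sub_ne_zero.2 hmn.symm
  -- The columns of `P` span the two centres, so conjugation by `P` carries the elementary matrices
  -- to the given transvections.
  set P : SL(2, ZMod p) := sl2 1 (n - m)⁻¹ m (n / (n - m)) (by field_simp) with hP
  have : K.comap (MulAut.conj P).toMonoidHom = ⊤ := by
    apply eq_top_of_elementary_mem
    · intro x
      show P * _ * P⁻¹ ∈ K
      convert hm x using 1
      rw [hP, sl2_mul, sl2_inv, sl2_mul]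
      apply sl2_congr <;> field_simp <;> ring
    · intro x
      show P * _ * P⁻¹ ∈ K
      convert hn (-x / (n - m) ^ 2) using 1
      rw [hP, sl2_mul, sl2_inv, sl2_mul]
      apply sl2_congr <;> field_simp <;> ring
  rw [eq_top_iff]
  intro g _
  have h : P⁻¹ * g * P ∈ K.comap (MulAut.conj P).toMonoidHom := by rw [this]; trivial
  have h' : P * (P⁻¹ * g * P) * P⁻¹ ∈ K := h
  convert h' using 1
  group

theorem sl2_unipotent_mem {K : Subgroup SL(2, ZMod p)} {a b c : ZMod p} (h : a ^ 2 + b * c = 0)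
    (hK : sl2 (1 + a) b c (1 - a) (by linear_combination -h) ∈ K) (x : ZMod p) :
    sl2 (1 + x * a) (x * b) (x * c) (1 - x * a) (by linear_combination -x ^ 2 * h) ∈ K := by
  have := K.pow_mem hK x.val
  rw [sl2_unipotent_pow h] at this
  simpa using this

/-- Cauchy's theorem gives a transvection in `K`. As `-1` is not a square, `w` fixes no point of the
projective line, so conjugation by `w` yields a second centre, and two full transvection groups
generate. -/
theorem eq_top_of_dvd_card (hsq : ∀ x : ZMod p, x ^ 2 ≠ -1) {K : Subgroup SL(2, ZMod p)}
    (hw : sl2 0 1 (-1) 0 (by ring) ∈ K) (hK : p ∣ Nat.card K) : K = ⊤ := by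
  have h2 : (2 : ZMod p) ≠ 0 := by
    intro h; exact hsq 1 (by linear_combination h)
  obtain ⟨⟨g, hg⟩, hord⟩ := exists_prime_orderOf_dvd_card' p hK
  have hord' : orderOf g = p := (Subgroup.orderOf_mk g hg).symm.trans hord
  have hgp : g ^ p = 1 := orderOf_dvd_iff_pow_eq_one.1 hord'.dvd
  obtain ⟨a, b, c, h, rfl⟩ := sl2_of_trace_two (sl2_trace_of_pow_char hgp)
  have hx := sl2_unipotent_mem h hg
  have hconj : ∀ (a b c d : ZMod p) (h), sl2 a b c d h ∈ K →
      sl2 d (-c) (-b) a (by linear_combination h) ∈ K := by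
    intro a b c d h hm
    have := K.mul_mem (K.mul_mem hw hm) (K.inv_mem hw)
    rw [sl2_mul, sl2_inv, sl2_mul] at this
    convert this using 1
    apply sl2_congr <;> ring
  by_cases hb : b = 0
  · subst hb
    have ha : a = 0 := by simpa using h
    subst ha
    have hc : c ≠ 0 := by
      rintro rfl
      have h1 : sl2 (1 + 0) 0 0 (1 - 0) (by ring) = (1 : SL(2, ZMod p)) := by
        rw [sl2_one]; apply sl2_congr <;> ring
      rw [h1, orderOf_one] at hord'
      exact (Fact.out : p.Prime).one_lt.ne hord'
    have hl : ∀ x, sl2 1 0 x 1 (by ring) ∈ K := by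
      intro x
      convert hx (x / c) using 1
      apply sl2_congr <;> field_simp <;> ring
    refine eq_top_of_elementary_mem (fun x => ?_) hl
    convert hconj _ _ _ _ _ (hl (-x)) using 1
    apply sl2_congr <;> ring
  · have hm : ∀ x, sl2 (1 - x * (-a / b)) x (-x * (-a / b) ^ 2) (1 + x * (-a / b)) (by ring) ∈ K := by
      intro x
      convert hx (x / b) using 1
      apply sl2_congr <;> field_simp
      · ring
      · linear_combination -x * h
      · ring
    have hm' := fun x => hconj _ _ _ _ _ (hm x)
    by_cases ha : a = 0
    · subst ha
      have hu : ∀ x, sl2 1 x 0 1 (by ring) ∈ K := by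
        intro x
        convert hm x using 1
        apply sl2_congr <;> simp
      refine eq_top_of_elementary_mem hu (fun x => ?_)
      convert hconj _ _ _ _ _ (hu (-x)) using 1
      apply sl2_congr <;> ring
    -- The centre has slope `-a / b` and its image under `w` has slope `b / a`; equality would make
    -- `-1` a square.
    · refine eq_top_of_two_transvection_groups (m := -a / b) (n := b / a) ?_ hm ?_
      · intro h
        field_simp at h
        apply hsq (b / a)
        field_simp
        linear_combination -h
      · intro x
        convert hm' (x * b ^ 2 / a ^ 2) using 1
        apply sl2_congr <;> field_simp <;> ring

/-- A subgroup of `SL(2, p)` which contains `diag(ν, ν⁻¹)`, where `ν` has order at least `14`, and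
`w`, is everything as soon as it contains an element that does not preserve `{0, ∞}`. -/
theorem eq_top_of_torus_mem (hsq : ∀ x : ZMod p, x ^ 2 ≠ -1) {K : Subgroup SL(2, ZMod p)}
    (hw : sl2 0 1 (-1) 0 (by ring) ∈ K) {ν : ZMod p} (hν : 14 ≤ orderOf ν) (hν0 : ν ≠ 0)
    (hy : sl2 ν 0 0 ν⁻¹ (by field_simp; ring) ∈ K) {a b c d : ZMod p} (h : a * d - b * c = 1)
    (hg : sl2 a b c d h ∈ K) (ha : a ≠ 0) (hb : b ≠ 0) : K = ⊤ := by
  have h2 : (2 : ZMod p) ≠ 0 := by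
    intro h; exact hsq 1 (by linear_combination h)
  apply eq_top_of_dvd_card hsq hw
  by_contra hK
  have hm : (-1 : SL(2, ZMod p)) ∈ K := by
    have := K.mul_mem hw hw
    rw [sl2_mul] at this
    rw [sl2_neg_one]
    convert this using 1
    apply sl2_congr <;> ring
  have hz := isTorusLike_of_not_dvd h2 hK hm
  have := Fintype.ofFinite K
  have hν2 : ν ^ 2 ≠ 1 := by
    intro h
    have := orderOf_le_of_pow_eq_one two_pos h
    omega
  have h1ν : sl2 ν 0 0 ν⁻¹ (by field_simp; ring) ≠ (1 : SL(2, ZMod p)) := by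
    rw [sl2_one, Ne, sl2_inj]
    rintro ⟨h, -⟩
    exact hν2 (by rw [h]; ring)
  have h1ν' : sl2 ν 0 0 ν⁻¹ (by field_simp; ring) ≠ (-1 : SL(2, ZMod p)) := by
    rw [sl2_neg_one, Ne, sl2_inj]
    rintro ⟨h, -⟩
    exact hν2 (by rw [h]; ring)
  have hpow : ∀ k : ℕ, (sl2 ν 0 0 ν⁻¹ (by field_simp; ring)) ^ k =
      sl2 (ν ^ k) 0 0 (ν ^ k)⁻¹ (by field_simp; ring) := by
    intro k
    induction k with
    | zero => rw [pow_zero, sl2_one]; apply sl2_congr <;> simp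
    | succ k ih => rw [pow_succ, ih, sl2_mul]; apply sl2_congr <;> field_simp <;> ring
  have hord : 14 ≤ commCard (⟨_, hy⟩ : K) := by
    rw [commCard_eq]
    have h3 := Subgroup.orderOf_dvd_natCard (Subgroup.centralizer {(⟨_, hy⟩ : K)}) (x := ⟨_, hy⟩)
      (by rw [Subgroup.mem_centralizer_singleton_iff])
    refine le_trans ?_ (Nat.le_of_dvd Nat.card_pos h3)
    rw [Subgroup.orderOf_mk]
    refine hν.trans (Nat.le_of_dvd (orderOf_pos _) (orderOf_dvd_of_pow_eq_one ?_))
    have h4 := pow_orderOf_eq_one (sl2 ν 0 0 ν⁻¹ (by field_simp; ring))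
    rw [hpow, sl2_one, sl2_inj] at h4
    exact h4.1
  have := hz.normalizes (y := ⟨_, hy⟩) (w := ⟨_, hw⟩) (fun h => h1ν (congrArg Subtype.val h))
    (fun h => h1ν' (congrArg Subtype.val h)) hord
    (by apply Subtype.ext
        change sl2 0 1 (-1) 0 (by ring) * sl2 ν 0 0 ν⁻¹ (by field_simp; ring) *
          (sl2 0 1 (-1) 0 (by ring))⁻¹ = (sl2 ν 0 0 ν⁻¹ (by field_simp; ring))⁻¹
        rw [sl2_inv, sl2_inv, sl2_mul, sl2_mul]
        apply sl2_congr <;> ring) ⟨_, hg⟩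
  -- As `ν ^ 2 ≠ 1`, commuting with `diag(ν, ν⁻¹)` forces `b = 0` and inverting it forces `a = 0`.
  rcases this with h' | h'
  · have := congrArg Subtype.val (mul_inv_eq_iff_eq_mul.1 h')
    change sl2 a b c d h * sl2 ν 0 0 ν⁻¹ (by field_simp; ring) =
      sl2 ν 0 0 ν⁻¹ (by field_simp; ring) * sl2 a b c d h at this
    rw [sl2_mul, sl2_mul, sl2_inj] at this
    have h3 := this.2.1
    apply hν2
    apply mul_left_cancel₀ hb
    field_simp at h3
    linear_combination -h3
  · have := congrArg Subtype.val (mul_inv_eq_iff_eq_mul.1 h')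
    change sl2 a b c d h * sl2 ν 0 0 ν⁻¹ (by field_simp; ring) =
      (sl2 ν 0 0 ν⁻¹ (by field_simp; ring))⁻¹ * sl2 a b c d h at this
    rw [sl2_inv, sl2_mul, sl2_mul, sl2_inj] at this
    have h3 := this.1
    apply hν2
    apply mul_left_cancel₀ ha
    field_simp at h3
    linear_combination h3

end Generation

/-! ### Dihedral groups and the intersection property in rank 3 -/

section StringCGroup

variable {G : Type} [Group G]

/-- The elements of the group generated by two involutions. -/
theorem mem_closure_pair_involutions {a b : G} (ha : a * a = 1) (hb : b * b = 1) {x : G}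
    (hx : x ∈ Subgroup.closure {a, b}) : ∃ n : ℤ, x = (a * b) ^ n ∨ x = (a * b) ^ n * a := by
  have ha' : a⁻¹ = a := inv_eq_of_mul_eq_one_left ha
  have hb' : b⁻¹ = b := inv_eq_of_mul_eq_one_left hb
  have hconj : ∀ n : ℤ, a * (a * b) ^ n = (a * b) ^ (-n) * a := by
    intro n
    have : a * (a * b) * a⁻¹ = (a * b)⁻¹ := by
      rw [mul_inv_rev, ha', hb', ← mul_assoc, ha, one_mul]
    have h2 := conj_zpow (i := n) (a := a) (b := a * b)
    rw [this, inv_zpow'] at h2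
    rw [h2, inv_mul_cancel_right]
  induction hx using Subgroup.closure_induction with
  | mem y hy =>
    rcases hy with rfl | hy
    · exact ⟨0, Or.inr (by simp)⟩
    · rw [Set.mem_singleton_iff] at hy
      subst hy
      refine ⟨-1, Or.inr ?_⟩
      rw [zpow_neg_one, mul_inv_rev, ha', hb', mul_assoc, ha, mul_one]
  | one => exact ⟨0, Or.inl (by simp)⟩
  | mul y z _ _ hy hz =>
    obtain ⟨m, hm⟩ := hy
    obtain ⟨n, hn⟩ := hz
    rcases hm with rfl | rfl <;> rcases hn with rfl | rfl
    · exact ⟨m + n, Or.inl (by rw [zpow_add])⟩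
    · exact ⟨m + n, Or.inr (by rw [zpow_add, mul_assoc])⟩
    · exact ⟨m + -n, Or.inr (by rw [zpow_add, mul_assoc, hconj, mul_assoc])⟩
    · exact ⟨m + -n, Or.inl (by
        rw [zpow_add, mul_assoc, ← mul_assoc a, hconj, mul_assoc _ a a, ha, mul_one])⟩
  | inv y _ hy =>
    obtain ⟨m, rfl | rfl⟩ := hy
    · exact ⟨-m, Or.inl (by rw [zpow_neg])⟩
    · exact ⟨m, Or.inr (by rw [mul_inv_rev, ha', ← zpow_neg, hconj, neg_neg])⟩

/-- In a dihedral group every square is a power of the rotation `a * b`. This is the obstruction to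
generating `PSL(2, p)` by two involutions. -/
theorem commute_sq_of_closure_pair_eq_top {a b : G} (ha : a * a = 1) (hb : b * b = 1)
    (h : Subgroup.closure {a, b} = ⊤) (x y : G) : Commute (x ^ 2) (y ^ 2) := by
  have key : ∀ x : G, ∃ n : ℤ, x ^ 2 = (a * b) ^ n := by
    intro x
    have ha' : a⁻¹ = a := inv_eq_of_mul_eq_one_left ha
    have hb' : b⁻¹ = b := inv_eq_of_mul_eq_one_left hb
    obtain ⟨n, rfl | rfl⟩ := mem_closure_pair_involutions ha hb (h ▸ Subgroup.mem_top x)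
    · exact ⟨n + n, by rw [sq, zpow_add]⟩
    · refine ⟨0, ?_⟩
      have h2 := conj_zpow (i := n) (a := a) (b := a * b)
      have h3 : a * (a * b) * a⁻¹ = (a * b)⁻¹ := by
        rw [mul_inv_rev, ha', hb', ← mul_assoc, ha, one_mul]
      rw [h3, ha'] at h2
      rw [sq, mul_assoc, ← mul_assoc a, ← h2, inv_zpow, zpow_zero, mul_inv_cancel]
  obtain ⟨m, hm⟩ := key x
  obtain ⟨n, hn⟩ := key y
  rw [hm, hn]
  exact Commute.zpow_zpow_self _ _ _

theorem mem_closure_singleton_involution {a : G} (ha : a * a = 1) {x : G}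
    (hx : x ∈ Subgroup.closure {a}) : x = 1 ∨ x = a := by
  rw [← Set.pair_eq_singleton] at hx
  obtain ⟨n, hn⟩ := mem_closure_pair_involutions ha ha hx
  simpa [ha] using hn

theorem mem_closure_commuting_involutions {a b : G} (ha : a * a = 1) (hb : b * b = 1)
    (hab : a * b = b * a) {x : G} (hx : x ∈ Subgroup.closure {a, b}) :
    x = 1 ∨ x = a ∨ x = b ∨ x = a * b := by
  have h2 : (a * b) ^ (2 : ℤ) = 1 := by
    rw [zpow_two]; nth_rewrite 2 [hab]; rw [mul_assoc, ← mul_assoc b, hb, one_mul, ha]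
  obtain ⟨n, hn⟩ := mem_closure_pair_involutions ha hb hx
  have hb2 : a * b * a = b := by rw [hab, mul_assoc, ha, mul_one]
  rcases Int.even_or_odd' n with ⟨k, rfl | rfl⟩
  · rw [zpow_mul, h2, one_zpow, one_mul] at hn
    tauto
  · rw [zpow_add, zpow_mul, h2, one_zpow, one_mul, zpow_one, hb2] at hn
    tauto

/-- A criterion for the intersection property in rank `3`. -/
theorem isStringCGroup_of_notMem (s : Fin 3 → G) (htop : Subgroup.closure (Set.range s) = ⊤)
    (hinv : ∀ i, orderOf (s i) = 2) (hcomm : s 0 * s 2 = s 2 * s 0)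
    (hs : ∀ i, s i ∉ Subgroup.closure (s '' {i}ᶜ))
    (hint : ∀ x ∈ Subgroup.closure {s 0, s 1}, x ∈ Subgroup.closure {s 1, s 2} →
      x ∈ Subgroup.closure {s 1}) : IsStringCGroup s where
  closure_eq_top := htop
  involution := hinv
  commute i j hij := by
    have hi : i = 0 := by omega
    have hj : j = 2 := by omega
    subst hi hj
    exact hcomm
  intersection I J := by
    have hsq : ∀ i, s i * s i = 1 := fun i => by
      rw [← sq, ← hinv i]; exact pow_orderOf_eq_one _
    have hmono : ∀ {I J : Set (Fin 3)}, I ⊆ J →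
        Subgroup.closure (s '' I) ≤ Subgroup.closure (s '' J) :=
      fun h => Subgroup.closure_mono (Set.image_mono h)
    have hsing : ∀ i (J : Set (Fin 3)), i ∉ J → ∀ x ∈ Subgroup.closure (s '' {i}),
        x ∈ Subgroup.closure (s '' J) → x = 1 := by
      intro i J hi x hx hxJ
      rw [Set.image_singleton] at hx
      rcases mem_closure_singleton_involution (hsq i) hx with h | rfl
      · exact h
      · exact absurd (hmono (Set.subset_compl_singleton_iff.2 hi) hxJ) (hs i)
    have hpair : ∀ i j k : Fin 3, i < j → i ≠ k → j ≠ k → ∀ x ∈ Subgroup.closure (s '' {i, k}),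
        x ∈ Subgroup.closure (s '' {j, k}) → x ∈ Subgroup.closure (s '' {k}) := by
      intro i j k hij hik hjk x hxi hxj
      rw [Set.image_pair] at hxi hxj
      rw [Set.image_singleton]
      have hcl : ∀ i j k : Fin 3, i ≠ k → j ≠ k → s k ∉ Subgroup.closure {s i, s j} := by
        intro i j k h1 h2 hm
        apply hs k
        rw [← Set.image_pair] at hm
        refine hmono ?_ hm
        intro a ha
        rcases ha with rfl | rfl <;> assumption
      have hA : ∀ i j : Fin 3, s i ∈ Subgroup.closure {s i, s j} := fun i j =>
        Subgroup.subset_closure (by simp)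
      have hB : ∀ i j : Fin 3, s j ∈ Subgroup.closure {s i, s j} := fun i j =>
        Subgroup.subset_closure (by simp)
      have hk := Subgroup.subset_closure (Set.mem_singleton (s k))
      have cases3 : (i = 1 ∧ j = 2 ∧ k = 0) ∨ (i = 0 ∧ j = 2 ∧ k = 1) ∨ (i = 0 ∧ j = 1 ∧ k = 2) := by
        omega
      -- For `k = 0` or `k = 2` one of the two groups is the four-group generated by `s 0` and `s
      -- 2`, whose elements are checked one by one; `k = 1` is the hypothesis `hint`.
      rcases cases3 with ⟨rfl, rfl, rfl⟩ | ⟨rfl, rfl, rfl⟩ | ⟨rfl, rfl, rfl⟩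
      · rcases mem_closure_commuting_involutions (hsq 2) (hsq 0) hcomm.symm hxj with h | h | h | h
        · rw [h]; exact one_mem _
        · rw [h] at hxi; exact absurd hxi (hcl 1 0 2 (by decide) (by decide))
        · rw [h]; exact hk
        · rw [h] at hxi
          exact absurd ((Subgroup.mul_mem_cancel_right _ (hB _ _)).1 hxi)
            (hcl 1 0 2 (by decide) (by decide))
      · rw [Set.pair_comm (s 2)] at hxj
        exact hint x hxi hxj
      · rcases mem_closure_commuting_involutions (hsq 0) (hsq 2) hcomm hxi with h | h | h | h
        · rw [h]; exact one_mem _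
        · rw [h] at hxj; exact absurd hxj (hcl 1 2 0 (by decide) (by decide))
        · rw [h]; exact hk
        · rw [h] at hxj
          exact absurd ((Subgroup.mul_mem_cancel_right _ (hB _ _)).1 hxj)
            (hcl 1 2 0 (by decide) (by decide))
    apply le_antisymm
    · rintro x ⟨hxI, hxJ⟩
      by_cases hIJ : I ⊆ J
      · rwa [Set.inter_eq_left.2 hIJ]
      by_cases hJI : J ⊆ I
      · rwa [Set.inter_eq_right.2 hJI]
      obtain ⟨i, hiI, hiJ⟩ := Set.not_subset.1 hIJ
      obtain ⟨j, hjJ, hjI⟩ := Set.not_subset.1 hJI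
      have hij : i ≠ j := fun h => hjI (h ▸ hiI)
      obtain ⟨k, hki, hkj⟩ := (by decide : ∀ i j : Fin 3, ∃ k, k ≠ i ∧ k ≠ j) i j
      have htri : ∀ l, l = i ∨ l = j ∨ l = k := by omega
      have hI : I ⊆ {i, k} := by
        intro l hl
        rcases htri l with rfl | rfl | rfl
        · simp
        · exact absurd hl hjI
        · simp
      have hJ : J ⊆ {j, k} := by
        intro l hl
        rcases htri l with rfl | rfl | rfl
        · exact absurd hl hiJ
        · simp
        · simp
      by_cases hkI : k ∈ I
      · by_cases hkJ : k ∈ J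
        · have : x ∈ Subgroup.closure (s '' {k}) := by
            rcases lt_or_gt_of_ne hij with h | h
            · exact hpair i j k h hki.symm hkj.symm x (hmono hI hxI) (hmono hJ hxJ)
            · exact hpair j i k h hkj.symm hki.symm x (hmono hJ hxJ) (hmono hI hxI)
          exact hmono (I := {k}) (Set.singleton_subset_iff.2 (Set.mem_inter hkI hkJ)) this
        · have : J ⊆ {j} := fun l hl => (hJ hl).resolve_right fun h => hkJ (h ▸ hl)
          rw [hsing j I hjI x (hmono this hxJ) hxI]
          exact one_mem _
      · have : I ⊆ {i} := fun l hl => (hI hl).resolve_right fun h => hkI (h ▸ hl)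
        rw [hsing i J hiJ x (hmono this hxI) hxJ]
        exact one_mem _
    · exact le_inf (hmono Set.inter_subset_left) (hmono Set.inter_subset_right)

end StringCGroup

/-! ### String C-group generators of PSL(2, p) -/

section PSL

variable {p : ℕ} [Fact p.Prime]

theorem psl2_mk_eq_one_iff {g : SL(2, ZMod p)} :
    (QuotientGroup.mk g : PSL(2, ZMod p)) = 1 ↔ g = 1 ∨ g = -1 := by
  rw [QuotientGroup.eq_one_iff, Matrix.SpecialLinearGroup.mem_center_iff]
  constructor
  · rintro ⟨r, hr, h⟩
    obtain ⟨a, b, c, d, hd, rfl⟩ := sl2_eq g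
    have h1 := congrFun (congrFun h 0) 0
    have h2 := congrFun (congrFun h 0) 1
    have h3 := congrFun (congrFun h 1) 0
    have h4 := congrFun (congrFun h 1) 1
    simp [sl2] at h1 h2 h3 h4
    exact sl2_scalar h2.symm h3.symm (h1.symm.trans h4)
  · rintro (rfl | rfl)
    · exact ⟨1, by simp, by simp⟩
    · exact ⟨-1, by simp, by rw [map_neg, map_one]; rfl⟩

theorem psl2_mk_eq_iff {g h : SL(2, ZMod p)} :
    (QuotientGroup.mk g : PSL(2, ZMod p)) = QuotientGroup.mk h ↔ g = h ∨ g = -h := by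
  rw [← mul_inv_eq_one, ← QuotientGroup.mk_inv, ← QuotientGroup.mk_mul, psl2_mk_eq_one_iff,
    mul_inv_eq_one, mul_inv_eq_iff_eq_mul, neg_one_mul]

theorem psl2_sq_not_commute (h2 : (2 : ZMod p) ≠ 0) :
    ∃ x y : PSL(2, ZMod p), ¬ Commute (x ^ 2) (y ^ 2) := by
  refine ⟨QuotientGroup.mk (sl2 1 1 0 1 (by ring)), QuotientGroup.mk (sl2 1 0 1 1 (by ring)), ?_⟩
  intro h
  have h' := h.eq
  rw [sq, sq] at h'
  simp only [← QuotientGroup.mk_mul] at h'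
  rw [psl2_mk_eq_iff] at h'
  simp only [sl2_mul, sl2_neg, sl2_inj] at h'
  have h4 : (2 : ZMod p) * 2 ≠ 0 := mul_ne_zero h2 h2
  rcases h' with h | h
  · apply h4; linear_combination h.1
  · apply h4; linear_combination h.2.1

/-- By Cayley–Hamilton, a traceless matrix of determinant one has square `-1`. -/
theorem psl2_orderOf_eq_two (h2 : (2 : ZMod p) ≠ 0) {a b c : ZMod p} (h : a * (-a) - b * c = 1) :
    orderOf (QuotientGroup.mk (sl2 a b c (-a) h) : PSL(2, ZMod p)) = 2 := by
  apply orderOf_eq_prime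
  · rw [sq, ← QuotientGroup.mk_mul, psl2_mk_eq_one_iff]
    right
    rw [sl2_mul, sl2_neg_one]
    apply sl2_congr
    · linear_combination -h
    · ring
    · ring
    · linear_combination -h
  · rw [Ne, psl2_mk_eq_one_iff, sl2_neg_one, sl2_one, sl2_inj, sl2_inj]
    rintro (h' | h')
    · exact h2 (by linear_combination -h'.1 - h'.2.2.2)
    · exact h2 (by linear_combination h'.1 + h'.2.2.2)

/-- String C-group generators of `PSL(2, p)` such that `s 1 * s 2` is the class of `diag(ν, ν⁻¹)`. -/
theorem exists_isStringCGroup_psl2 (hsq : ∀ x : ZMod p, x ^ 2 ≠ -1) {ν : ZMod p} (hν0 : ν ≠ 0)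
    (hν : orderOf ν = 14) : ∃ s : Fin 3 → PSL(2, ZMod p), IsStringCGroup s ∧
      s 1 = QuotientGroup.mk (sl2 0 1 (-1) 0 (by ring)) ∧
      s 2 = QuotientGroup.mk (sl2 0 ν⁻¹ (-ν) 0 (by field_simp; ring)) := by
  have h2 : (2 : ZMod p) ≠ 0 := by
    intro h; exact hsq 1 (by linear_combination h)
  obtain ⟨e, f, hef⟩ := ZMod.sq_add_sq p (-1)
  have he : e ≠ 0 := by
    rintro rfl; exact hsq f (by linear_combination hef)
  have hf : f ≠ 0 := by
    rintro rfl; exact hsq e (by linear_combination hef)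
  have hν7 : ν ^ 7 = -1 := by
    have h := pow_orderOf_eq_one ν
    rw [hν] at h
    have h' : (ν ^ 7 - 1) * (ν ^ 7 + 1) = 0 := by linear_combination h
    rcases mul_eq_zero.1 h' with h' | h'
    · have := orderOf_le_of_pow_eq_one (by norm_num : 0 < 7) (sub_eq_zero.1 h')
      omega
    · linear_combination h'
  have hdet₀ : e * (-e) - f * ν⁻¹ * (f * ν) = 1 := by field_simp; linear_combination -hef
  have hdet₂ : (0 : ZMod p) * 0 - ν⁻¹ * (-ν) = 1 := by field_simp; ring
  -- Traceless, of determinant one by `e ^ 2 + f ^ 2 = -1`, and anticommuting with `t₂`, so that the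
  -- classes of `t₀` and `t₂` commute. Since `e` and `f` are nonzero, `t₀` does not normalize the
  -- diagonal torus.
  set t₀ : SL(2, ZMod p) := sl2 e (f * ν⁻¹) (f * ν) (-e) hdet₀ with ht₀
  set t₁ : SL(2, ZMod p) := sl2 0 1 (-1) 0 (by ring) with ht₁
  set t₂ : SL(2, ZMod p) := sl2 0 ν⁻¹ (-ν) 0 hdet₂ with ht₂
  have hK : Subgroup.closure {t₀, t₁, t₂} = ⊤ := by
    have h₀ : t₀ ∈ Subgroup.closure {t₀, t₁, t₂} := Subgroup.subset_closure (by simp)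
    have h₁ : t₁ ∈ Subgroup.closure {t₀, t₁, t₂} := Subgroup.subset_closure (by simp)
    have h₂ : t₂ ∈ Subgroup.closure {t₀, t₁, t₂} := Subgroup.subset_closure (by simp)
    refine eq_top_of_torus_mem hsq h₁ hν.ge hν0 ?_ hdet₀ h₀ he (mul_ne_zero hf (inv_ne_zero hν0))
    have := mul_mem (inv_mem h₁) h₂
    rw [ht₁, ht₂, sl2_inv, sl2_mul] at this
    convert this using 1
    apply sl2_congr <;> ring
  set s : Fin 3 → PSL(2, ZMod p) :=
    ![QuotientGroup.mk t₀, QuotientGroup.mk t₁, QuotientGroup.mk t₂] with hs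
  have hinv : ∀ i, orderOf (s i) = 2 := by
    intro i
    fin_cases i
    · exact psl2_orderOf_eq_two h2 hdet₀
    · convert psl2_orderOf_eq_two h2 (a := 0) (b := 1) (c := -1) (by ring) using 2
      simp [s, ht₁]
    · convert psl2_orderOf_eq_two h2 (a := 0) (b := ν⁻¹) (c := -ν) (by field_simp; ring) using 2
      simp [s, ht₂]
  have hsq' : ∀ i, s i * s i = 1 := fun i => by
    rw [← sq]; exact orderOf_dvd_iff_pow_eq_one.1 (hinv i).dvd
  have htop : Subgroup.closure (Set.range s) = ⊤ := by
    have h := congrArg (Subgroup.map (QuotientGroup.mk' (Subgroup.center SL(2, ZMod p)))) hK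
    rw [MonoidHom.map_closure, Subgroup.map_top_of_surjective _ (QuotientGroup.mk'_surjective _)] at h
    rw [← h]
    congr 1
    ext x
    simp [s, Set.image_insert_eq]
    tauto
  have hr : s 1 * s 2 = QuotientGroup.mk (sl2 (-ν) 0 0 (-ν⁻¹) (by field_simp; ring)) := by
    show (QuotientGroup.mk t₁ : PSL(2, ZMod p)) * QuotientGroup.mk t₂ = _
    rw [← QuotientGroup.mk_mul, ht₁, ht₂, sl2_mul]
    congr 1
    apply sl2_congr <;> ring
  have hr7 : (s 1 * s 2) ^ 7 = 1 := by
    have hpow : ∀ k : ℕ, (sl2 (-ν) 0 0 (-ν⁻¹) (by field_simp; ring)) ^ k =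
        sl2 ((-ν) ^ k) 0 0 ((-ν) ^ k)⁻¹
          (by rw [mul_inv_cancel₀ (pow_ne_zero _ (neg_ne_zero.2 hν0))]; ring) := by
      intro k
      induction k with
      | zero => rw [pow_zero, sl2_one]; apply sl2_congr <;> simp
      | succ k ih =>
        rw [pow_succ, ih, sl2_mul]
        apply sl2_congr
        · ring
        · ring
        · ring
        · rw [pow_succ, mul_inv, inv_neg]; ring
    rw [hr, ← QuotientGroup.mk_pow, hpow, psl2_mk_eq_one_iff]
    left
    rw [sl2_one]
    have : (-ν) ^ 7 = 1 := by linear_combination -hν7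
    apply sl2_congr <;> simp [this]
  -- A redundant generator would leave `PSL(2, p)` generated by two involutions, so that all squares
  -- would commute.
  have hclosure : ∀ i, s i ∉ Subgroup.closure (s '' {i}ᶜ) := by
    intro i hi
    obtain ⟨x, y, hxy⟩ := psl2_sq_not_commute h2
    obtain ⟨j, k, hjk⟩ := (by decide : ∀ i : Fin 3, ∃ j k, ∀ l, l = i ∨ l = j ∨ l = k) i
    have hsub : s '' {i}ᶜ ⊆ {s j, s k} := by
      rintro _ ⟨l, hl, rfl⟩
      rcases hjk l with h | h | h
      · exact absurd h hl
      · simp [h]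
      · simp [h]
    have htop' : Subgroup.closure {s j, s k} = ⊤ := by
      rw [eq_top_iff, ← htop, Subgroup.closure_le]
      rintro _ ⟨l, rfl⟩
      rcases hjk l with rfl | rfl | rfl
      · exact Subgroup.closure_mono hsub hi
      · exact Subgroup.subset_closure (by simp)
      · exact Subgroup.subset_closure (by simp)
    exact hxy (commute_sq_of_closure_pair_eq_top (hsq' j) (hsq' k) htop' x y)
  refine ⟨s, isStringCGroup_of_notMem s htop hinv ?_ hclosure ?_, rfl, rfl⟩
  · show (QuotientGroup.mk t₀ : PSL(2, ZMod p)) * QuotientGroup.mk t₂ =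
      QuotientGroup.mk t₂ * QuotientGroup.mk t₀
    rw [← QuotientGroup.mk_mul, ← QuotientGroup.mk_mul, psl2_mk_eq_iff]
    right
    rw [ht₀, ht₂, sl2_mul, sl2_mul, sl2_neg]
    apply sl2_congr <;> field_simp <;> ring
  · intro x hx hx'
    have h1 : s 1 ∈ Subgroup.closure {s 0, s 1} := Subgroup.subset_closure (by simp)
    have hn2 : s 2 ∉ Subgroup.closure {s 0, s 1} := by
      intro h
      apply hclosure 2
      convert h using 2
      rw [show ({2}ᶜ : Set (Fin 3)) = {0, 1} by ext i; fin_cases i <;> simp, Set.image_pair]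
    -- As `7` is prime, a nontrivial power of `s 1 * s 2` generates `s 1 * s 2`, and `s 2` would lie
    -- in the group generated by `s 0` and `s 1`.
    have key : ∀ n : ℤ, (s 1 * s 2) ^ n ∈ Subgroup.closure {s 0, s 1} → (s 1 * s 2) ^ n = 1 := by
      intro n hn
      by_cases h7 : (7 : ℤ) ∣ n
      · obtain ⟨k, rfl⟩ := h7
        rw [zpow_mul]
        have : (s 1 * s 2) ^ (7 : ℤ) = 1 := by exact_mod_cast hr7
        rw [this, one_zpow]
      · exfalso
        apply hn2
        have hco : IsCoprime (7 : ℤ) n :=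
          (Nat.prime_iff_prime_int.1 (by norm_num : Nat.Prime 7)).coprime_iff_not_dvd.2 h7
        obtain ⟨u, v, huv⟩ := hco
        have h3 : s 1 * s 2 = ((s 1 * s 2) ^ n) ^ v := by
          rw [← zpow_mul]
          have : n * v = 1 + 7 * (-u) := by linear_combination huv
          rw [this, zpow_add, zpow_mul]
          have : (s 1 * s 2) ^ (7 : ℤ) = 1 := by exact_mod_cast hr7
          rw [this, one_zpow, mul_one, zpow_one]
        have h4 : s 1 * s 2 ∈ Subgroup.closure {s 0, s 1} := by
          rw [h3]; exact zpow_mem hn v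
        exact (Subgroup.mul_mem_cancel_left _ h1).1 h4
    obtain ⟨n, rfl | rfl⟩ := mem_closure_pair_involutions (hsq' 1) (hsq' 2) hx'
    · rw [key n hx]; exact one_mem _
    · rw [key n ((Subgroup.mul_mem_cancel_right _ h1).1 hx), one_mul]
      exact Subgroup.subset_closure (by simp)

end PSL

/-! ### The coset geometry: order and flags -/

section CosetPoset

variable {G : Type} [Group G] {s : Fin 3 → G}

/-- The stabilizer of the face of rank `i - 1` of the base flag. -/
def faceStabilizer (s : Fin 3 → G) (i : Fin 5) : Subgroup G :=
  Subgroup.closure (s '' {j | (j : ℕ) + 1 ≠ i})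

/-- The faces of the coset geometry of a string C-group of rank `3`, with improper faces. -/
def CosetPoset (_ : IsStringCGroup s) : Type := Σ i : Fin 5, G ⧸ faceStabilizer s i

variable (hs : IsStringCGroup s)

namespace CosetPoset

/-- The face of rank `i - 1` of the flag `g`. -/
def face (g : G) (i : Fin 5) : CosetPoset hs := ⟨i, QuotientGroup.mk g⟩

variable {hs}

/-- The index of a face, which is its rank plus one. -/
def index (x : CosetPoset hs) : Fin 5 := x.1

@[simp] theorem index_face (g : G) (i : Fin 5) : (face hs g i).index = i := rfl

theorem exists_eq_face (x : CosetPoset hs) : ∃ g, x = face hs g x.index := by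
  obtain ⟨i, q⟩ := x
  obtain ⟨g, rfl⟩ := QuotientGroup.mk_surjective q
  exact ⟨g, rfl⟩

theorem face_eq_iff {g h : G} {i : Fin 5} :
    face hs g i = face hs h i ↔ g⁻¹ * h ∈ faceStabilizer s i := by
  rw [← QuotientGroup.eq]
  constructor
  · intro e
    exact eq_of_heq (Sigma.mk.inj e).2
  · intro e
    exact congrArg (Sigma.mk i) e

theorem faceStabilizer_zero (hs : IsStringCGroup s) : faceStabilizer s 0 = ⊤ := by
  rw [← hs.closure_eq_top, ← Set.image_univ]
  unfold faceStabilizer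
  congr 2
  ext j
  simp

theorem faceStabilizer_four (hs : IsStringCGroup s) : faceStabilizer s 4 = ⊤ := by
  rw [← hs.closure_eq_top, ← Set.image_univ]
  unfold faceStabilizer
  congr 2
  ext j
  fin_cases j <;> simp

theorem face_zero (g h : G) : face hs g 0 = face hs h 0 := by
  rw [face_eq_iff, faceStabilizer_zero hs]; trivial

theorem face_four (g h : G) : face hs g 4 = face hs h 4 := by
  rw [face_eq_iff, faceStabilizer_four hs]; trivial

theorem mem_faceStabilizer {j : Fin 3} {i : Fin 5} (h : (j : ℕ) + 1 ≠ i) :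
    s j ∈ faceStabilizer s i :=
  Subgroup.subset_closure ⟨j, h, rfl⟩

theorem mul_self_eq_one (hs : IsStringCGroup s) (j : Fin 3) : s j * s j = 1 := by
  rw [← sq]; exact orderOf_dvd_iff_pow_eq_one.1 (hs.involution j).dvd

theorem ne_one (hs : IsStringCGroup s) (j : Fin 3) : s j ≠ 1 := by
  intro h
  have := hs.involution j
  rw [h, orderOf_one] at this
  omega

theorem notMem_faceStabilizer (hs : IsStringCGroup s) {j : Fin 3} {i : Fin 5}
    (h : (j : ℕ) + 1 = i) : s j ∉ faceStabilizer s i := by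
  intro hm
  have h1 : s j ∈ Subgroup.closure (s '' {j}) := Subgroup.subset_closure (by simp)
  have h2 : s j ∈ Subgroup.closure (s '' {j}) ⊓ faceStabilizer s i := ⟨h1, hm⟩
  unfold faceStabilizer at h2
  rw [hs.intersection] at h2
  have : ({j} : Set (Fin 3)) ∩ {j | (j : ℕ) + 1 ≠ i} = ∅ := by
    ext k; simp only [Set.mem_inter_iff, Set.mem_singleton_iff, Set.mem_ofPred_eq,
      Set.mem_empty_iff_false, iff_false, not_and, not_not]
    rintro rfl; exact h
  rw [this, Set.image_empty, Subgroup.closure_empty, Subgroup.mem_bot] at h2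
  exact ne_one hs j h2

/-- The stabilizers belonging to the other two generators already meet in the group generated by `s
j`, by the intersection property. Hence a flag has only one other flag adjacent to it in a given
rank. -/
theorem eq_one_or_eq_of_mem (hs : IsStringCGroup s) (j : Fin 3) {x : G}
    (hx : ∀ i : Fin 5, (i : ℕ) ≠ j + 1 → x ∈ faceStabilizer s i) : x = 1 ∨ x = s j := by
  obtain ⟨a, b, ha, hb, hab⟩ := (by decide : ∀ j : Fin 3, ∃ a b : Fin 5, (a : ℕ) ≠ j + 1 ∧
    (b : ℕ) ≠ j + 1 ∧ ∀ k : Fin 3, ((k : ℕ) + 1 ≠ a ∧ (k : ℕ) + 1 ≠ b) → k = j) j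
  have h2 : x ∈ faceStabilizer s a ⊓ faceStabilizer s b := ⟨hx a ha, hx b hb⟩
  unfold faceStabilizer at h2
  rw [hs.intersection] at h2
  apply mem_closure_singleton_involution (mul_self_eq_one hs j)
  rw [← Set.image_singleton]
  exact Subgroup.closure_mono (Set.image_mono fun k hk => hab k hk) h2

/-- Since `s 0` and `s 2` commute, the stabilizer of the base edge is a product of a part that fixes
the base vertex and a part that fixes the base `2`-face. This makes incidence transitive: two flags
sharing an edge can be merged. -/
theorem exists_mul_of_mem_two (hs : IsStringCGroup s) {x : G} (hx : x ∈ faceStabilizer s 2) :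
    ∃ a b, x = a * b ∧ a ∈ faceStabilizer s 1 ∧ a ∈ faceStabilizer s 2 ∧
      b ∈ faceStabilizer s 2 ∧ b ∈ faceStabilizer s 3 := by
  have hx' : x ∈ Subgroup.closure {s 2, s 0} := by
    have : {j : Fin 3 | (j : ℕ) + 1 ≠ (2 : Fin 5)} = {2, 0} := by
      ext j; fin_cases j <;> simp
    unfold faceStabilizer at hx
    rwa [this, Set.image_pair] at hx
  have h2 := fun i h => mem_faceStabilizer (s := s) (j := 2) (i := i) h
  have h0 := fun i h => mem_faceStabilizer (s := s) (j := 0) (i := i) h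
  rcases mem_closure_commuting_involutions (mul_self_eq_one hs 2) (mul_self_eq_one hs 0)
    (hs.commute 0 2 le_rfl).symm hx' with rfl | rfl | rfl | rfl
  · exact ⟨1, 1, by simp, one_mem _, one_mem _, one_mem _, one_mem _⟩
  · exact ⟨s 2, 1, by simp, h2 1 (by decide), h2 2 (by decide), one_mem _, one_mem _⟩
  · exact ⟨1, s 0, by simp, one_mem _, one_mem _, h0 2 (by decide), h0 3 (by decide)⟩
  · exact ⟨s 2, s 0, rfl, h2 1 (by decide), h2 2 (by decide), h0 2 (by decide), h0 3 (by decide)⟩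

theorem exists_common_of_two {g h : G} (e : face hs g 2 = face hs h 2) :
    ∃ k, face hs k 1 = face hs g 1 ∧ face hs k 2 = face hs g 2 ∧ face hs k 3 = face hs h 3 := by
  obtain ⟨a, b, hab, ha1, ha2, hb2, hb3⟩ := exists_mul_of_mem_two hs (face_eq_iff.1 e)
  have h1 : (g * a)⁻¹ * h = b := by
    rw [mul_inv_rev, mul_assoc, hab, inv_mul_cancel_left]
  refine ⟨g * a, ?_, ?_, ?_⟩
  · rw [face_eq_iff]; simpa using ha1
  · rw [face_eq_iff]; simpa using ha2
  · rw [face_eq_iff, h1]; exact hb3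

instance : PartialOrder (CosetPoset hs) where
  le x y := ∃ g i j, i ≤ j ∧ x = face hs g i ∧ y = face hs g j
  le_refl x := by
    obtain ⟨g, hg⟩ := exists_eq_face x
    exact ⟨g, _, _, le_rfl, hg, hg⟩
  le_trans := by
    rintro x y z ⟨g, i, j, hij, rfl, rfl⟩ ⟨h, j', k, hjk, e, rfl⟩
    obtain rfl : j = j' := congrArg index e
    by_cases h1 : i = j
    · subst h1
      exact ⟨h, i, k, hjk, e, rfl⟩
    by_cases h2 : j = k
    · subst h2
      exact ⟨g, i, j, hij, rfl, e.symm⟩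
    by_cases h3 : i = 0
    · subst h3
      exact ⟨h, 0, k, Fin.zero_le _, face_zero _ _, rfl⟩
    by_cases h4 : k = 4
    · subst h4
      exact ⟨g, i, 4, hij.trans hjk, rfl, face_four _ _⟩
    -- With improper faces and coincidences set aside, only vertex, edge and `2`-face remain.
    obtain ⟨rfl, rfl, rfl⟩ : i = 1 ∧ j = 2 ∧ k = 3 := by omega
    obtain ⟨m, hm1, -, hm3⟩ := exists_common_of_two e
    exact ⟨m, 1, 3, by decide, hm1.symm, hm3.symm⟩
  le_antisymm := by
    rintro x y ⟨g, i, j, hij, rfl, rfl⟩ ⟨h, j', i', hji, e, e'⟩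
    obtain rfl : j = j' := congrArg index e
    obtain rfl : i = i' := congrArg index e'
    obtain rfl : i = j := le_antisymm hij hji
    rfl

theorem le_iff {x y : CosetPoset hs} :
    x ≤ y ↔ ∃ g i j, i ≤ j ∧ x = face hs g i ∧ y = face hs g j := Iff.rfl

theorem face_le_face (g : G) {i j : Fin 5} (h : i ≤ j) : face hs g i ≤ face hs g j :=
  ⟨g, i, j, h, rfl, rfl⟩

theorem face_strictMono (g : G) : StrictMono (face hs g) := by
  intro i j h
  refine lt_of_le_of_ne (face_le_face g h.le) fun e => h.ne (congrArg index e)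

theorem index_strictMono : StrictMono (index : CosetPoset hs → Fin 5) := by
  intro x y h
  obtain ⟨g, i, j, hij, rfl, rfl⟩ := le_iff.1 h.le
  refine lt_of_le_of_ne hij ?_
  rintro e
  change i = j at e
  subst e
  exact lt_irrefl _ h

instance : BoundedOrder (CosetPoset hs) where
  bot := face hs 1 0
  bot_le x := by
    obtain ⟨g, hg⟩ := exists_eq_face x
    rw [face_zero 1 g, hg]
    exact face_le_face g (Fin.zero_le _)
  top := face hs 1 4
  le_top x := by
    obtain ⟨g, hg⟩ := exists_eq_face x
    rw [face_four 1 g, hg]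
    exact face_le_face g (Fin.le_last _)

instance [Finite G] : Finite (CosetPoset hs) := by
  unfold CosetPoset; infer_instance

theorem eq_of_le_of_index_eq {x y : CosetPoset hs} (h : x ≤ y) (e : x.index = y.index) : x = y := by
  by_contra hne
  exact (index_strictMono (lt_of_le_of_ne h hne)).ne e

theorem exists_flag_of_index {x y z : CosetPoset hs} (hx : x.index = 1) (hy : y.index = 2)
    (hz : z.index = 3) (hxy : x ≤ y) (hyz : y ≤ z) :
    ∃ g, x = face hs g 1 ∧ y = face hs g 2 ∧ z = face hs g 3 := by
  obtain ⟨g, i, j, -, rfl, rfl⟩ := hxy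
  obtain ⟨h, j', k, -, e, rfl⟩ := hyz
  change i = 1 at hx; change j = 2 at hy; change k = 3 at hz
  subst hx hy hz
  obtain rfl : 2 = j' := congrArg index e
  obtain ⟨m, h1, h2, h3⟩ := exists_common_of_two e
  exact ⟨m, h1.symm, h2.symm, h3.symm⟩

/-- Every chain is contained in one of the flags `face g`. -/
theorem exists_subset_range_face {C : Set (CosetPoset hs)} (hC : IsChain (· ≤ ·) C) :
    ∃ g, C ⊆ Set.range (face hs g) := by
  have hle : ∀ x ∈ C, ∀ y ∈ C, x.index ≤ y.index → x ≤ y := by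
    intro x hx y hy hxy
    rcases hC.total hx hy with h | h
    · exact h
    · rcases h.lt_or_eq with h | h
      · exact absurd (index_strictMono h) (not_lt.2 hxy)
      · exact h.ge
  have hle' : ∀ x ∈ C, ∀ y ∈ C, x.index = y.index → x = y := fun x hx y hy h =>
    eq_of_le_of_index_eq (hle x hx y hy h.le) h
  suffices H : ∃ g, ∀ x ∈ C, x.index = 1 ∨ x.index = 2 ∨ x.index = 3 → x = face hs g x.index by
    obtain ⟨g, hg⟩ := H
    refine ⟨g, fun x hx => ⟨x.index, ?_⟩⟩
    by_cases h : x.index = 1 ∨ x.index = 2 ∨ x.index = 3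
    · exact (hg x hx h).symm
    · obtain ⟨k, hk⟩ := exists_eq_face x
      rw [hk]
      rcases (by omega : x.index = 0 ∨ x.index = 4) with h' | h' <;> rw [h'] <;> rw [index_face]
      · exact face_zero _ _
      · exact face_four _ _
  -- If the chain has an edge, a missing vertex or `2`-face is supplied by a flag through that edge
  -- and the pieces are merged. Without an edge, an incident vertex and `2`-face share a flag by the
  -- definition of the order.
  by_cases h2 : ∃ y ∈ C, y.index = 2
  · obtain ⟨y, hy, hy2⟩ := h2
    obtain ⟨g, hg⟩ := exists_eq_face y
    rw [hy2] at hg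
    obtain ⟨x, hx1, hxy, hx⟩ : ∃ x : CosetPoset hs, x.index = 1 ∧ x ≤ y ∧
        ∀ x' ∈ C, x'.index = 1 → x' = x := by
      by_cases h1 : ∃ x ∈ C, x.index = 1
      · obtain ⟨x, hx, hx1⟩ := h1
        exact ⟨x, hx1, hle x hx y hy (by rw [hx1, hy2]; decide),
          fun x' hx' h => hle' x' hx' x hx (h.trans hx1.symm)⟩
      · exact ⟨face hs g 1, rfl, hg ▸ face_le_face g (by decide),
          fun x' hx' h => absurd ⟨x', hx', h⟩ h1⟩
    obtain ⟨z, hz3, hyz, hz⟩ : ∃ z : CosetPoset hs, z.index = 3 ∧ y ≤ z ∧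
        ∀ z' ∈ C, z'.index = 3 → z' = z := by
      by_cases h3 : ∃ z ∈ C, z.index = 3
      · obtain ⟨z, hz, hz3⟩ := h3
        exact ⟨z, hz3, hle y hy z hz (by rw [hz3, hy2]; decide),
          fun x' hx' h => hle' x' hx' z hz (h.trans hz3.symm)⟩
      · exact ⟨face hs g 3, rfl, hg ▸ face_le_face g (by decide),
          fun x' hx' h => absurd ⟨x', hx', h⟩ h3⟩
    obtain ⟨k, k1, k2, k3⟩ := exists_flag_of_index hx1 hy2 hz3 hxy hyz
    refine ⟨k, fun w hw hw' => ?_⟩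
    rcases hw' with h | h | h <;> rw [h]
    · rw [← k1]; exact hx w hw h
    · rw [← k2]; exact hle' w hw y hy (h.trans hy2.symm)
    · rw [← k3]; exact hz w hw h
  · by_cases h1 : ∃ x ∈ C, x.index = 1
    · obtain ⟨x, hx, hx1⟩ := h1
      by_cases h3 : ∃ z ∈ C, z.index = 3
      · obtain ⟨z, hz, hz3⟩ := h3
        obtain ⟨g, i, j, -, e, e'⟩ := hle x hx z hz (by rw [hx1, hz3]; decide)
        obtain rfl : i = 1 := by rw [← hx1, e]; rfl
        obtain rfl : j = 3 := by rw [← hz3, e']; rfl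
        refine ⟨g, fun w hw hw' => ?_⟩
        rcases hw' with h | h | h
        · rw [h, ← e]; exact hle' w hw x hx (h.trans hx1.symm)
        · exact absurd ⟨w, hw, h⟩ h2
        · rw [h, ← e']; exact hle' w hw z hz (h.trans hz3.symm)
      · obtain ⟨g, hg⟩ := exists_eq_face x
        rw [hx1] at hg
        refine ⟨g, fun w hw hw' => ?_⟩
        rcases hw' with h | h | h
        · rw [h, ← hg]; exact hle' w hw x hx (h.trans hx1.symm)
        · exact absurd ⟨w, hw, h⟩ h2
        · exact absurd ⟨w, hw, h⟩ h3
    · by_cases h3 : ∃ z ∈ C, z.index = 3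
      · obtain ⟨z, hz, hz3⟩ := h3
        obtain ⟨g, hg⟩ := exists_eq_face z
        rw [hz3] at hg
        refine ⟨g, fun w hw hw' => ?_⟩
        rcases hw' with h | h | h
        · exact absurd ⟨w, hw, h⟩ h1
        · exact absurd ⟨w, hw, h⟩ h2
        · rw [h, ← hg]; exact hle' w hw z hz (h.trans hz3.symm)
      · refine ⟨1, fun w hw hw' => ?_⟩
        rcases hw' with h | h | h
        · exact absurd ⟨w, hw, h⟩ h1
        · exact absurd ⟨w, hw, h⟩ h2
        · exact absurd ⟨w, hw, h⟩ h3

theorem isChain_range_face (g : G) : IsChain (· ≤ ·) (Set.range (face hs g)) := by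
  rintro _ ⟨i, rfl⟩ _ ⟨j, rfl⟩ -
  rcases le_total i j with h | h
  · exact Or.inl (face_le_face g h)
  · exact Or.inr (face_le_face g h)

theorem exists_flag_eq (Φ : Flag (CosetPoset hs)) : ∃ g, (Φ : Set (CosetPoset hs)) = Set.range (face hs g) := by
  obtain ⟨g, hg⟩ := exists_subset_range_face Φ.chain_le
  exact ⟨g, Φ.max_chain' (isChain_range_face g) hg⟩

/-- A chain with one face of each rank is one of the flags `face g`. -/
theorem exists_eq_face_of_monotone {F : Fin 5 → CosetPoset hs} (hF : Monotone F)
    (hi : ∀ i, (F i).index = i) : ∃ g, ∀ i, F i = face hs g i := by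
  have hC : IsChain (· ≤ ·) (Set.range F) := by
    rintro _ ⟨i, rfl⟩ _ ⟨j, rfl⟩ -
    rcases le_total i j with h | h
    · exact Or.inl (hF h)
    · exact Or.inr (hF h)
  obtain ⟨g, hg⟩ := exists_subset_range_face hC
  refine ⟨g, fun i => ?_⟩
  obtain ⟨j, hj⟩ := hg ⟨i, rfl⟩
  have := congrArg index hj
  rw [hi] at this
  change j = i at this
  rw [← hj, this]

theorem face_mul_generator (g : G) {j : Fin 3} {i : Fin 5} (h : (i : ℕ) ≠ j + 1) :
    face hs (g * s j) i = face hs g i := by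
  rw [eq_comm, face_eq_iff, inv_mul_cancel_left]
  exact mem_faceStabilizer h.symm

theorem face_mul_generator_ne (g : G) {j : Fin 3} {i : Fin 5} (h : (i : ℕ) = j + 1) :
    face hs (g * s j) i ≠ face hs g i := by
  rw [ne_comm, Ne, face_eq_iff, inv_mul_cancel_left]
  exact notMem_faceStabilizer hs h.symm

theorem eq_or_eq_of_face_eq {g h : G} (j : Fin 3)
    (e : ∀ i : Fin 5, (i : ℕ) ≠ j + 1 → face hs h i = face hs g i) : h = g ∨ h = g * s j := by
  rcases eq_one_or_eq_of_mem hs j fun i hi => face_eq_iff.1 (e i hi).symm with h | h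
  · left; rw [inv_mul_eq_one] at h; exact h.symm
  · right; rw [← h, mul_inv_cancel_left]

end CosetPoset
end CosetPoset

/-! ### Automorphisms of the coset geometry and the polytope axioms -/

namespace CosetPoset

variable {G : Type} [Group G] {s : Fin 3 → G} {hs : IsStringCGroup s}

/-- Left translation of faces. -/
def translate (g : G) (x : CosetPoset hs) : CosetPoset hs := ⟨x.1, g • x.2⟩

theorem translate_mul (g h : G) (x : CosetPoset hs) :
    translate (g * h) x = translate g (translate h x) :=
  Sigma.ext rfl (heq_of_eq (mul_smul _ _ _))

theorem translate_one (x : CosetPoset hs) : translate 1 x = x :=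
  Sigma.ext rfl (heq_of_eq (one_smul _ _))

theorem translate_le (g : G) {x y : CosetPoset hs} (h : x ≤ y) : translate g x ≤ translate g y := by
  obtain ⟨h, i, j, hij, rfl, rfl⟩ := h
  exact ⟨g * h, i, j, hij, rfl, rfl⟩

/-- Left multiplication by an element of the group is an automorphism of the coset geometry. -/
def leftMul (hs : IsStringCGroup s) : G →* (CosetPoset hs ≃o CosetPoset hs) where
  toFun g :=
    { toFun := translate g
      invFun := translate g⁻¹
      left_inv := fun x => by rw [← translate_mul, inv_mul_cancel, translate_one]
      right_inv := fun x => by rw [← translate_mul, mul_inv_cancel, translate_one]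
      map_rel_iff' := by
        intro x y
        refine ⟨fun h => ?_, translate_le g⟩
        have h' := translate_le g⁻¹ h
        change translate g⁻¹ (translate g x) ≤ translate g⁻¹ (translate g y) at h'
        rwa [← translate_mul, ← translate_mul, inv_mul_cancel, translate_one, translate_one] at h' }
  map_one' := by ext x; exact translate_one x
  map_mul' g h := by ext x; exact translate_mul g h x

@[simp] theorem leftMul_face (g h : G) (i : Fin 5) :
    leftMul hs g (face hs h i) = face hs (g * h) i := rfl

/-- The image of a flag has five strictly increasing indices in `Fin 5`, which leaves no choice. -/
theorem index_map_face (γ : CosetPoset hs ≃o CosetPoset hs) (g : G) (i : Fin 5) :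
    (γ (face hs g i)).index = i := by
  have h : StrictMono fun i => (γ (face hs g i)).index :=
    index_strictMono.comp (γ.strictMono.comp (face_strictMono g))
  have h0 := h (show (0 : Fin 5) < 1 by decide)
  have h1 := h (show (1 : Fin 5) < 2 by decide)
  have h2 := h (show (2 : Fin 5) < 3 by decide)
  have h3 := h (show (3 : Fin 5) < 4 by decide)
  dsimp only at h0 h1 h2 h3
  fin_cases i <;> simp only [Fin.reduceFinMk, Fin.zero_eta, Fin.mk_one] <;> omega

theorem exists_map_face_eq (γ : CosetPoset hs ≃o CosetPoset hs) (g : G) :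
    ∃ h, ∀ i, γ (face hs g i) = face hs h i :=
  exists_eq_face_of_monotone (γ.monotone.comp (face_strictMono g).monotone) (index_map_face γ g)

/-- An automorphism which fixes the base flag is trivial. -/
theorem eq_refl_of_fixes_base {γ : CosetPoset hs ≃o CosetPoset hs}
    (h1 : ∀ i, γ (face hs 1 i) = face hs 1 i) : γ = 1 := by
  -- Fixing a flag passes to adjacent flags: the image of the flag `x * s j` agrees with `x` outside
  -- rank `j`, so it is `x` or `x * s j`, and injectivity of `γ` excludes `x`.
  have step : ∀ (x : G) (j : Fin 3), (∀ i, γ (face hs x i) = face hs x i) →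
      ∀ i, γ (face hs (x * s j) i) = face hs (x * s j) i := by
    intro x j ih
    obtain ⟨h, hh⟩ := exists_map_face_eq γ (x * s j)
    have : h = x ∨ h = x * s j := by
      apply eq_or_eq_of_face_eq (hs := hs) j
      intro i hi
      rw [← hh, face_mul_generator x hi, ih]
    rcases this with rfl | rfl
    · exfalso
      have hi := hh ⟨j + 1, by omega⟩
      rw [← ih] at hi
      exact face_mul_generator_ne h rfl (γ.injective hi)
    · exact hh
  have key : ∀ g : G, ∀ i, γ (face hs g i) = face hs g i := by
    intro g
    have hg : g ∈ Subgroup.closure (Set.range s) := by rw [hs.closure_eq_top]; trivial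
    induction hg using Subgroup.closure_induction_right with
    | one => exact h1
    | mul_right x _ y hy ih =>
      obtain ⟨j, rfl⟩ := hy
      exact step x j ih
    | mul_inv_cancel x _ y hy ih =>
      obtain ⟨j, rfl⟩ := hy
      rw [inv_eq_of_mul_eq_one_left (mul_self_eq_one hs j)]
      exact step x j ih
  ext x
  obtain ⟨g, hg⟩ := exists_eq_face x
  rw [hg, key]; rfl

/-- An element that fixes the base flag is `1` or `s 0`, and `s 0` moves the base vertex.
Conversely, an automorphism sends the base flag to some flag `face g`, and it then agrees with left
multiplication by `g`. -/
theorem leftMul_bijective : Function.Bijective (leftMul hs) := by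
  constructor
  · rw [injective_iff_map_eq_one]
    intro g hg
    have h : ∀ i, face hs g i = face hs 1 i := by
      intro i
      have := congrArg (fun γ => γ (face hs 1 i)) hg
      simpa using this
    rcases eq_or_eq_of_face_eq 0 fun i _ => h i with h' | h'
    · exact h'
    · rcases eq_or_eq_of_face_eq 1 fun i _ => h i with h'' | h''
      · exact h''
      · have := h 1
        rw [h'] at this
        exact absurd this (face_mul_generator_ne 1 rfl)
  · intro γ
    obtain ⟨g, hg⟩ := exists_map_face_eq γ 1
    refine ⟨g, ?_⟩
    have : (leftMul hs g)⁻¹ * γ = 1 := by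
      apply eq_refl_of_fixes_base
      intro i
      rw [RelIso.mul_apply, hg, ← map_inv, leftMul_face, inv_mul_cancel]
    rw [inv_mul_eq_one] at this
    exact this

/-- The automorphism group of the coset geometry. -/
noncomputable def autEquiv (hs : IsStringCGroup s) : G ≃* (CosetPoset hs ≃o CosetPoset hs) :=
  MulEquiv.ofBijective (leftMul hs) leftMul_bijective

@[simp] theorem autEquiv_face (g h : G) (i : Fin 5) :
    autEquiv hs g (face hs h i) = face hs (g * h) i := rfl

theorem areDistinguishedGenerators :
    AreDistinguishedGenerators (face hs 1) (fun i => autEquiv hs (s i)) := by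
  intro i j
  rw [autEquiv_face, mul_one]
  by_cases h : (j : ℕ) = i + 1
  · refine iff_of_false ?_ (by simpa using h)
    simpa using face_mul_generator_ne (hs := hs) 1 h
  · refine iff_of_true ?_ h
    simpa using face_mul_generator (hs := hs) 1 h

theorem flag_card (Φ : Flag (CosetPoset hs)) : (Φ : Set (CosetPoset hs)).ncard = 3 + 2 := by
  obtain ⟨g, hg⟩ := exists_flag_eq Φ
  rw [hg, ← Set.image_univ, Set.ncard_image_of_injective _ (face_strictMono g).injective,
    Set.ncard_univ, Nat.card_fin]

theorem flag_transitive (Φ Ψ : Flag (CosetPoset hs)) :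
    ∃ γ : CosetPoset hs ≃o CosetPoset hs, γ '' (Φ : Set (CosetPoset hs)) = Ψ := by
  obtain ⟨g, hg⟩ := exists_flag_eq Φ
  obtain ⟨h, hh⟩ := exists_flag_eq Ψ
  refine ⟨autEquiv hs (h * g⁻¹), ?_⟩
  rw [hg, hh, ← Set.range_comp]
  congr 1
  funext i
  show autEquiv hs (h * g⁻¹) (face hs g i) = _
  rw [autEquiv_face, inv_mul_cancel_right]

theorem exists_flag_of_pair {x y : CosetPoset hs} (h : x < y) :
    ∃ g, x = face hs g x.index ∧ y = face hs g y.index := by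
  obtain ⟨g, i, j, -, rfl, rfl⟩ := le_iff.1 h.le
  exact ⟨g, rfl, rfl⟩

theorem exists_flag_of_triple {x y z : CosetPoset hs} (h : x < y) (h' : y < z) :
    ∃ g, x = face hs g x.index ∧ y = face hs g y.index ∧ z = face hs g z.index := by
  have hC : IsChain (· ≤ ·) ({x, y, z} : Set (CosetPoset hs)) := by
    have := h.le
    have := h'.le
    have := (h.trans h').le
    rintro a (rfl | rfl | rfl) b (rfl | rfl | rfl) - <;> tauto
  obtain ⟨g, hg⟩ := exists_subset_range_face hC
  have key : ∀ a ∈ ({x, y, z} : Set (CosetPoset hs)), a = face hs g a.index := by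
    intro a ha
    obtain ⟨i, rfl⟩ := hg ha
    rfl
  exact ⟨g, key x (by simp), key y (by simp), key z (by simp)⟩

/-- A flag through `x` and `y` would supply a face strictly between them if the indices differed by
more. -/
theorem index_of_covBy {x y : CosetPoset hs} (h : x ⋖ y) : (y.index : ℕ) = x.index + 1 := by
  obtain ⟨g, hx, hy⟩ := exists_flag_of_pair h.lt
  have h1 : (x.index : ℕ) < y.index := index_strictMono h.lt
  by_contra hne
  have h2 : (x.index : ℕ) + 1 < y.index := by omega
  have h3 := y.index.isLt
  apply h.2 (c := face hs g ⟨x.index + 1, by omega⟩)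
  · exact hx.trans_lt (face_strictMono g (Fin.lt_def.2 (by simp)))
  · exact (face_strictMono g (Fin.lt_def.2 (by simpa using h2))).trans_eq hy.symm

/-- The faces which extend a flag without its face of rank `j`. -/
theorem eq_or_eq_of_between {g : G} {j : Fin 3} {x : CosetPoset hs}
    (h1 : face hs g ⟨j, by omega⟩ < x) (h2 : x < face hs g ⟨j + 2, by omega⟩) :
    x = face hs g ⟨j + 1, by omega⟩ ∨ x = face hs (g * s j) ⟨j + 1, by omega⟩ := by
  have hi : (x.index : ℕ) = j + 1 := by
    have h3 : (j : ℕ) < x.index := index_strictMono h1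
    have h4 : (x.index : ℕ) < j + 2 := index_strictMono h2
    omega
  have hi' : x.index = ⟨j + 1, by omega⟩ := Fin.ext hi
  -- Replacing the face of rank `j` of the flag `g` by `x` gives a flag equal or adjacent to `g`.
  obtain ⟨h, hh⟩ := exists_eq_face_of_monotone
    (F := fun i => if (i : ℕ) = j + 1 then x else face hs g i) (by
      intro a b hab
      have hab' : (a : ℕ) ≤ b := hab
      dsimp only
      split_ifs with ha hb hb
      · exact le_rfl
      · refine h2.le.trans (face_le_face g (Fin.le_def.2 ?_)); simp only; omega
      · refine (face_le_face g (Fin.le_def.2 ?_)).trans h1.le; simp only; omega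
      · exact face_le_face g hab) (by
      intro i
      split_ifs with h
      · rw [hi']; exact Fin.ext h.symm
      · rfl)
  have hx := hh ⟨j + 1, by omega⟩
  simp only [if_true] at hx
  have : h = g ∨ h = g * s j := by
    apply eq_or_eq_of_face_eq (hs := hs) j
    intro i hi
    rw [← hh, if_neg hi]
  rcases this with rfl | rfl
  · exact Or.inl hx
  · exact Or.inr hx

theorem ncard_Ioo_face (g : G) (j : Fin 3) :
    (Set.Ioo (face hs g ⟨j, by omega⟩) (face hs g ⟨j + 2, by omega⟩)).ncard = 2 := by
  have hne := face_mul_generator_ne (hs := hs) g (j := j) (i := ⟨j + 1, by omega⟩) rfl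
  refine Eq.trans (congrArg Set.ncard ?_) (Set.ncard_pair hne.symm)
  ext w
  simp only [Set.mem_Ioo, Set.mem_insert_iff, Set.mem_singleton_iff]
  constructor
  · rintro ⟨h1, h2⟩
    exact eq_or_eq_of_between h1 h2
  · rintro (rfl | rfl)
    · exact ⟨face_strictMono g (Fin.lt_def.2 (by simp)), face_strictMono g (Fin.lt_def.2 (by simp))⟩
    · rw [← face_mul_generator g (j := j) (i := ⟨j, by omega⟩) (by simp),
        ← face_mul_generator g (j := j) (i := ⟨j + 2, by omega⟩) (by simp)]
      exact ⟨face_strictMono _ (Fin.lt_def.2 (by simp)), face_strictMono _ (Fin.lt_def.2 (by simp))⟩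

theorem diamond {x z : CosetPoset hs} (h : ∃ y, x ⋖ y ∧ y ⋖ z) : (Set.Ioo x z).ncard = 2 := by
  obtain ⟨y, hxy, hyz⟩ := h
  have e1 := index_of_covBy hxy
  have e2 := index_of_covBy hyz
  obtain ⟨g, hx, -, hz⟩ := exists_flag_of_triple hxy.lt hyz.lt
  have hlt := z.index.isLt
  obtain ⟨j, hj⟩ : ∃ j : Fin 3, (j : ℕ) = x.index := ⟨⟨x.index, by omega⟩, rfl⟩
  have hx' : x = face hs g ⟨j, by omega⟩ := hx.trans (congrArg _ (Fin.ext hj.symm))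
  have hz' : z = face hs g ⟨j + 2, by omega⟩ :=
    hz.trans (congrArg _ (Fin.ext (by simp only; omega)))
  have := ncard_Ioo_face (hs := hs) g j
  rwa [← hx', ← hz'] at this

/-- By the intersection property, two flags through `x` and `z` differ by a word in the generators
that fix both `x` and `z`. Following the word, each letter changes one face of the flag only, and
the section has a second rank in which consecutive flags agree. -/
theorem connected (x z : CosetPoset hs) (h : ∃ y w : CosetPoset hs, x < y ∧ y < w ∧ w < z) :
    ∀ a ∈ Set.Ioo x z, ∀ b ∈ Set.Ioo x z, Relation.ReflTransGen
        (fun a b => a ∈ Set.Ioo x z ∧ b ∈ Set.Ioo x z ∧ (a ≤ b ∨ b ≤ a)) a b := by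
  obtain ⟨y, w, hxy, hyw, hwz⟩ := h
  have i1 : (x.index : ℕ) < y.index := index_strictMono hxy
  have i2 : (y.index : ℕ) < w.index := index_strictMono hyw
  have i3 : (w.index : ℕ) < z.index := index_strictMono hwz
  have i4 := z.index.isLt
  rintro a ⟨ha1, ha2⟩ b ⟨hb1, hb2⟩
  obtain ⟨g, hgx, hga, hgz⟩ := exists_flag_of_triple ha1 ha2
  obtain ⟨h, hhx, hhb, hhz⟩ := exists_flag_of_triple hb1 hb2
  have hmem : g⁻¹ * h ∈ Subgroup.closure
      (s '' {j | (j : ℕ) + 1 ≠ x.index ∧ (j : ℕ) + 1 ≠ z.index}) := by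
    have : g⁻¹ * h ∈ faceStabilizer s x.index ⊓ faceStabilizer s z.index :=
      ⟨face_eq_iff.1 (hgx.symm.trans hhx), face_eq_iff.1 (hgz.symm.trans hhz)⟩
    unfold faceStabilizer at this
    rw [hs.intersection] at this
    exact this
  have hIoo : ∀ k : G, x = face hs k x.index → z = face hs k z.index → ∀ i : Fin 5,
      x.index < i → i < z.index → face hs k i ∈ Set.Ioo x z := by
    intro k hkx hkz i h1 h2
    constructor
    · rw [hkx]; exact face_strictMono k h1
    · rw [hkz]; exact face_strictMono k h2
  have hcmp : ∀ k : G, x = face hs k x.index → z = face hs k z.index → ∀ i i' : Fin 5,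
      x.index < i → i < z.index → x.index < i' → i' < z.index →
      (fun a b => a ∈ Set.Ioo x z ∧ b ∈ Set.Ioo x z ∧ (a ≤ b ∨ b ≤ a)) (face hs k i)
        (face hs k i') := by
    intro k hkx hkz i i' h1 h2 h3 h4
    refine ⟨hIoo k hkx hkz i h1 h2, hIoo k hkx hkz i' h3 h4, ?_⟩
    rcases le_total i i' with h | h
    · exact Or.inl (face_le_face k h)
    · exact Or.inr (face_le_face k h)
  have step : ∀ (u : G) (j : Fin 3), ((j : ℕ) + 1 ≠ x.index ∧ (j : ℕ) + 1 ≠ z.index) →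
      (x = face hs (g * u) x.index ∧ z = face hs (g * u) z.index ∧
      ∀ i : Fin 5, x.index < i → i < z.index → Relation.ReflTransGen
        (fun a b => a ∈ Set.Ioo x z ∧ b ∈ Set.Ioo x z ∧ (a ≤ b ∨ b ≤ a)) a (face hs (g * u) i)) →
      (x = face hs (g * (u * s j)) x.index ∧ z = face hs (g * (u * s j)) z.index ∧
      ∀ i : Fin 5, x.index < i → i < z.index → Relation.ReflTransGen
        (fun a b => a ∈ Set.Ioo x z ∧ b ∈ Set.Ioo x z ∧ (a ≤ b ∨ b ≤ a)) a
          (face hs (g * (u * s j)) i)) := by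
    rintro u j ⟨hjx, hjz⟩ ⟨hux, huz, hu⟩
    rw [← mul_assoc]
    have hx' : x = face hs (g * u * s j) x.index := by
      rw [face_mul_generator _ hjx.symm]; exact hux
    have hz' : z = face hs (g * u * s j) z.index := by
      rw [face_mul_generator _ hjz.symm]; exact huz
    refine ⟨hx', hz', fun i h1 h2 => ?_⟩
    -- At least two indices lie strictly between those of `x` and `z`, so one of them is untouched
    -- by `s j`.
    obtain ⟨i', h3, h4, h5⟩ : ∃ i' : Fin 5, x.index < i' ∧ i' < z.index ∧ (i' : ℕ) ≠ j + 1 := by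
      by_cases hj : (x.index : ℕ) + 1 = j + 1
      · refine ⟨⟨x.index + 2, by omega⟩, Fin.lt_def.2 ?_, Fin.lt_def.2 ?_, ?_⟩ <;> simp only <;> omega
      · refine ⟨⟨x.index + 1, by omega⟩, Fin.lt_def.2 ?_, Fin.lt_def.2 ?_, ?_⟩ <;> simp only <;> omega
    refine (hu i' h3 h4).tail ?_
    rw [← face_mul_generator (g * u) h5]
    exact hcmp _ hx' hz' i' i h3 h4 h1 h2
  have key : ∀ u ∈ Subgroup.closure
      (s '' {j | (j : ℕ) + 1 ≠ x.index ∧ (j : ℕ) + 1 ≠ z.index}),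
      x = face hs (g * u) x.index ∧ z = face hs (g * u) z.index ∧
      ∀ i : Fin 5, x.index < i → i < z.index → Relation.ReflTransGen
        (fun a b => a ∈ Set.Ioo x z ∧ b ∈ Set.Ioo x z ∧ (a ≤ b ∨ b ≤ a)) a
          (face hs (g * u) i) := by
    intro u hu
    induction hu using Subgroup.closure_induction_right with
    | one =>
      rw [mul_one]
      refine ⟨hgx, hgz, fun i h1 h2 => Relation.ReflTransGen.single ?_⟩
      have := hcmp g hgx hgz a.index i (index_strictMono ha1) (index_strictMono ha2) h1 h2
      rwa [← hga] at this
    | mul_right u _ y hy ih =>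
      obtain ⟨j, hj, rfl⟩ := hy
      exact step u j hj ih
    | mul_inv_cancel u _ y hy ih =>
      obtain ⟨j, hj, rfl⟩ := hy
      rw [inv_eq_of_mul_eq_one_left (mul_self_eq_one hs j)]
      exact step u j hj ih
  have := (key _ hmem).2.2 b.index (index_strictMono hb1) (index_strictMono hb2)
  rwa [mul_inv_cancel_left, ← hhb] at this

theorem isAbstractRegularPolytope : IsAbstractRegularPolytope 3 (CosetPoset hs) where
  flag_card := flag_card
  connected := connected
  diamond _ _ := diamond
  flag_transitive := flag_transitive

theorem exists_eq_face_one (v : PolytopeVertex (CosetPoset hs)) : ∃ g, v.1 = face hs g 1 := by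
  obtain ⟨v, hv⟩ := v
  obtain ⟨g, hg⟩ := exists_eq_face v
  refine ⟨g, ?_⟩
  have h0 : v.index ≠ 0 := by
    intro h
    rw [h] at hg
    apply hv.1
    rw [hg]
    exact face_zero g 1
  have h1 : face hs g 1 ≤ v := by
    rw [hg]; exact face_le_face g (Fin.one_le_of_ne_zero h0)
  rcases (hv.le_iff.1 h1) with h | h
  · exact absurd (show (1 : Fin 5) = 0 from congrArg index h) (by decide)
  · exact h.symm

theorem isAtom_face_one (g : G) : IsAtom (face hs g 1) := by
  constructor
  · intro h
    exact absurd (show (1 : Fin 5) = 0 from congrArg index h) (by decide)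
  · intro x hx
    obtain ⟨h, hh⟩ := exists_eq_face x
    have h1 : x.index < 1 := index_strictMono hx
    rw [Fin.lt_one_iff] at h1
    rw [hh, h1]
    exact face_zero h 1

theorem faceStabilizer_one (s : Fin 3 → G) : faceStabilizer s 1 = Subgroup.closure {s 1, s 2} := by
  have : {j : Fin 3 | (j : ℕ) + 1 ≠ (1 : Fin 5)} = {1, 2} := by
    ext j; fin_cases j <;> simp
  unfold faceStabilizer
  rw [this, Set.image_pair]

/-- The base vertex. -/
def baseVertex (hs : IsStringCGroup s) : PolytopeVertex (CosetPoset hs) := ⟨face hs 1 1, isAtom_face_one 1⟩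

theorem exists_smul_baseVertex (v : PolytopeVertex (CosetPoset hs)) :
    ∃ g : G, autEquiv hs g • baseVertex hs = v := by
  obtain ⟨g, hg⟩ := exists_eq_face_one v
  refine ⟨g, Subtype.ext ?_⟩
  rw [hg]
  show autEquiv hs g (face hs 1 1) = _
  rw [autEquiv_face, mul_one]

theorem smul_baseVertex_iff (g : G) :
    autEquiv hs g • baseVertex hs = baseVertex hs ↔ g ∈ Subgroup.closure {s 1, s 2} := by
  have h : autEquiv hs g • baseVertex hs = baseVertex hs ↔ face hs (g * 1) 1 = face hs 1 1 :=
    ⟨fun h => congrArg Subtype.val h, fun h => Subtype.ext h⟩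
  rw [h, ← faceStabilizer_one, mul_one, eq_comm, face_eq_iff, inv_one, one_mul]

end CosetPoset

/-! ### Gauss sums and the explicit Weil representation -/

section WeilRepresentation

variable (p : ℕ) [Fact p.Prime]

/-- The quadratic character of `ZMod p` with complex values. -/
noncomputable def quadChar : MulChar (ZMod p) ℂ :=
  (quadraticChar (ZMod p)).ringHomComp (Int.castRingHom ℂ)

/-- The quadratic Gauss sum. -/
noncomputable def quadGaussSum : ℂ := gaussSum (quadChar p) ZMod.stdAddChar

variable {p}

theorem quadChar_mul_self {a : ZMod p} (ha : a ≠ 0) : quadChar p a * quadChar p a = 1 := by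
  rw [← map_mul, ← sq]
  simp [quadChar, quadraticChar_sq_one' ha]

theorem quadChar_inv (a : ZMod p) : quadChar p a⁻¹ = quadChar p a := by
  by_cases ha : a = 0
  · simp [ha]
  · have h := quadChar_mul_self ha
    have h2 : quadChar p a⁻¹ * quadChar p a = 1 := by
      rw [← map_mul, inv_mul_cancel₀ ha, map_one]
    exact mul_right_cancel₀ (right_ne_zero_of_mul_eq_one h) (h2.trans h.symm)

theorem two_ne_zero_zmod (hp : p ≠ 2) : (2 : ZMod p) ≠ 0 := by
  intro h
  have : ((2 : ℕ) : ZMod p) = 0 := by exact_mod_cast h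
  rw [ZMod.natCast_eq_zero_iff] at this
  exact hp ((Nat.prime_dvd_prime_iff_eq Fact.out Nat.prime_two).1 this)

theorem ringChar_zmod_ne_two (hp : p ≠ 2) : ringChar (ZMod p) ≠ 2 := by
  rwa [ZMod.ringChar_zmod_n]

theorem quadChar_ne_one (hp : p ≠ 2) : quadChar p ≠ 1 := by
  intro h
  obtain ⟨a, ha⟩ := quadraticChar_exists_neg_one' (ringChar_zmod_ne_two hp)
  have h2 : quadChar p a = 1 := by rw [h]; exact MulChar.one_apply a.isUnit
  simp [quadChar, ha] at h2
  norm_num at h2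

theorem isQuadratic_quadChar : (quadChar p).IsQuadratic :=
  (quadraticChar_isQuadratic (ZMod p)).comp _

theorem quadGaussSum_sq (hp : p ≠ 2) : quadGaussSum p ^ 2 = quadChar p (-1) * p := by
  have h := gaussSum_sq (χ := quadChar p) (quadChar_ne_one hp) isQuadratic_quadChar
    (ZMod.isPrimitive_stdAddChar p)
  rwa [ZMod.card] at h

theorem quadGaussSum_ne_zero (hp : p ≠ 2) : quadGaussSum p ≠ 0 := by
  have hp0 : (p : ℂ) ≠ 0 := by exact_mod_cast (Fact.out : p.Prime).ne_zero
  intro h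
  have h1 := quadGaussSum_sq hp
  rw [h, zero_pow two_ne_zero, eq_comm, mul_eq_zero] at h1
  rcases h1 with h1 | h1
  · have := quadChar_mul_self (p := p) (neg_ne_zero.2 one_ne_zero : (-1 : ZMod p) ≠ 0)
    rw [h1] at this; simp at this
  · exact hp0 h1

theorem sum_stdAddChar_mul (a : ZMod p) :
    ∑ x : ZMod p, (ZMod.stdAddChar (a * x) : ℂ) = if a = 0 then (p : ℂ) else 0 := by
  have := AddChar.sum_mulShift a (ZMod.isPrimitive_stdAddChar p)
  simp only [mul_comm a]
  rw [this, ZMod.card]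
  split_ifs <;> simp

/-- An element `x` has `1 + quadChar p x` square roots, and the summand `1` contributes zero because
`m ≠ 0`. -/
theorem sum_stdAddChar_sq (hp : p ≠ 2) {m : ZMod p} (hm : m ≠ 0) :
    ∑ u : ZMod p, (ZMod.stdAddChar (m * u ^ 2) : ℂ) = quadChar p m * quadGaussSum p := by
  have h1 : ∑ u : ZMod p, (ZMod.stdAddChar (m * u ^ 2) : ℂ) =
      ∑ x : ZMod p, (quadChar p x + 1) * ZMod.stdAddChar (m * x) := by
    rw [← Finset.sum_fiberwise (s := Finset.univ) (g := fun u : ZMod p => u ^ 2)]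
    apply Finset.sum_congr rfl
    intro x _
    rw [Finset.sum_congr rfl (g := fun _ => (ZMod.stdAddChar (m * x) : ℂ))
      (fun u hu => by rw [(Finset.mem_filter.1 hu).2])]
    rw [Finset.sum_const, nsmul_eq_mul]
    congr 1
    have h2 := quadraticChar_card_sqrts (ringChar_zmod_ne_two hp) x
    have h3 : (({u : ZMod p | u ^ 2 = x}.toFinset.card : ℤ) : ℂ) =
        ((quadraticChar (ZMod p) x + 1 : ℤ) : ℂ) := by rw [h2]
    rw [Set.toFinset_ofPred] at h3
    simpa [quadChar] using h3
  rw [h1]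
  simp only [add_mul, one_mul, Finset.sum_add_distrib]
  rw [sum_stdAddChar_mul, if_neg hm, add_zero]
  have h2 := gaussSum_mulShift_eq (quadChar p) ZMod.stdAddChar (Units.mk0 m hm)
  rw [isQuadratic_quadChar.inv] at h2
  simpa [gaussSum, AddChar.mulShift_apply, quadGaussSum] using h2

variable (p) in
/-- The normalizing factor of the Fourier transform in the Weil representation. -/
noncomputable def weilFactor : ℂ := quadChar p (-2) / quadGaussSum p

/-- This normalization makes the operators multiply exactly, and not only up to scalars. It also
shows that the factor has modulus `p ^ (-1/2)`. -/
theorem weilFactor_sq (hp : p ≠ 2) : weilFactor p ^ 2 * p = quadChar p (-1) := by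
  have h2 : (-2 : ZMod p) ≠ 0 := neg_ne_zero.2 (two_ne_zero_zmod hp)
  have hp0 : (p : ℂ) ≠ 0 := by exact_mod_cast (Fact.out : p.Prime).ne_zero
  have h1 := quadChar_mul_self (p := p) (neg_ne_zero.2 one_ne_zero : (-1 : ZMod p) ≠ 0)
  unfold weilFactor
  rw [div_pow, sq (quadChar p (-2)), quadChar_mul_self h2, quadGaussSum_sq hp]
  have : quadChar p (-1) ≠ 0 := left_ne_zero_of_mul_eq_one h1
  field_simp
  linear_combination -h1

/-- The operators of the Weil representation, for a matrix with given entries. -/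
noncomputable def weilOperator (a b c d : ZMod p) : (ZMod p → ℂ) →ₗ[ℂ] (ZMod p → ℂ) where
  toFun f t := if b = 0 then quadChar p a * ZMod.stdAddChar (-(c * d * t ^ 2) / 2) * f (d * t)
    else weilFactor p * quadChar p b *
      ∑ u, ZMod.stdAddChar ((-(d * t ^ 2) + 2 * t * u - a * u ^ 2) / (2 * b)) * f u
  map_add' f g := by
    funext t
    simp only [Pi.add_apply, mul_add, Finset.sum_add_distrib]
    split_ifs <;> rfl
  map_smul' z f := by
    funext t
    simp only [Pi.smul_apply, smul_eq_mul, RingHom.id_apply]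
    split_ifs
    · ring
    · simp only [Finset.mul_sum]
      exact Finset.sum_congr rfl fun u _ => by ring

theorem weilOperator_apply_zero {a b c d : ZMod p} (hb : b = 0) (f : ZMod p → ℂ) (t : ZMod p) :
    weilOperator a b c d f t =
      quadChar p a * ZMod.stdAddChar (-(c * d * t ^ 2) / 2) * f (d * t) := if_pos hb

theorem weilOperator_apply {a b c d : ZMod p} (hb : b ≠ 0) (f : ZMod p → ℂ) (t : ZMod p) :
    weilOperator a b c d f t = weilFactor p * quadChar p b *
      ∑ u, ZMod.stdAddChar ((-(d * t ^ 2) + 2 * t * u - a * u ^ 2) / (2 * b)) * f u := if_neg hb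

theorem heisenbergOperator_apply (v : Fin 2 → ZMod p) (f : ZMod p → ℂ) (t : ZMod p) :
    heisenbergOperator p v f t = ZMod.stdAddChar (v 1 * t + v 0 * v 1 / 2) * f (t + v 0) := rfl

theorem sl2_mulVec (a b c d : ZMod p) (h : a * d - b * c = 1) (v : Fin 2 → ZMod p) :
    (sl2 a b c d h).1.mulVec v = ![a * v 0 + b * v 1, c * v 0 + d * v 1] := by
  unfold sl2
  ext i
  fin_cases i <;> simp [Matrix.mulVec, dotProduct, Fin.sum_univ_two]

theorem weilOperator_intertwines (hp : p ≠ 2) (a b c d : ZMod p) (h : a * d - b * c = 1)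
    (v : Fin 2 → ZMod p) : weilOperator a b c d ∘ₗ heisenbergOperator p v =
      heisenbergOperator p ((sl2 a b c d h).1.mulVec v) ∘ₗ weilOperator a b c d := by
  have h2 := two_ne_zero_zmod hp
  apply LinearMap.ext
  intro f
  funext t
  rw [LinearMap.comp_apply, LinearMap.comp_apply, heisenbergOperator_apply, sl2_mulVec]
  simp only [Matrix.cons_val_zero, Matrix.cons_val_one]
  by_cases hb : b = 0
  · subst hb
    have had : a * d = 1 := by linear_combination h
    rw [weilOperator_apply_zero rfl, weilOperator_apply_zero rfl, heisenbergOperator_apply]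
    have e1 : d * (t + (a * v 0 + 0 * v 1)) = d * t + v 0 := by linear_combination v 0 * had
    have e2 : (ZMod.stdAddChar (-(c * d * t ^ 2) / 2) : ℂ) *
        ZMod.stdAddChar (v 1 * (d * t) + v 0 * v 1 / 2) =
        ZMod.stdAddChar ((c * v 0 + d * v 1) * t + (a * v 0 + 0 * v 1) * (c * v 0 + d * v 1) / 2) *
          ZMod.stdAddChar (-(c * d * (t + (a * v 0 + 0 * v 1)) ^ 2) / 2) := by
      rw [← AddChar.map_add_eq_mul, ← AddChar.map_add_eq_mul]
      congr 1
      field_simp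
      linear_combination (2 * t * c * v 0 + a * c * v 0 ^ 2 - v 0 * v 1) * had
    rw [e1]
    linear_combination (quadChar p a * f (d * t + v 0)) * e2
  · rw [weilOperator_apply hb, weilOperator_apply hb, mul_left_comm]
    congr 1
    rw [Finset.mul_sum]
    refine Fintype.sum_equiv (Equiv.addRight (v 0)) _ _ fun u => ?_
    rw [heisenbergOperator_apply, Equiv.coe_addRight, ← mul_assoc, ← mul_assoc,
      ← AddChar.map_add_eq_mul, ← AddChar.map_add_eq_mul]
    congr 2
    obtain rfl : c = (a * d - 1) / b := by field_simp; linear_combination -h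
    field_simp
    ring

/-- A form of Schur's lemma. The point mass at `0` is fixed by all operators with `v = (0, y)`, so
its image is fixed by those with `v = (b y, d y)`. If `b ≠ 0`, these move `0` to every point; if `b
= 0`, they force support at `0`. Either way the value at `0` determines the image, and translations
produce the other point masses. -/
theorem eq_zero_of_intertwines {a b c d : ZMod p} (h : a * d - b * c = 1)
    {Z : (ZMod p → ℂ) →ₗ[ℂ] (ZMod p → ℂ)}
    (hZ : ∀ v, Z ∘ₗ heisenbergOperator p v =
      heisenbergOperator p ((sl2 a b c d h).1.mulVec v) ∘ₗ Z)
    (h0 : Z (Pi.single 0 1) 0 = 0) : Z = 0 := by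
  have key : Z (Pi.single 0 1) = 0 := by
    have h1 : ∀ y t, Z (Pi.single 0 1) t =
        ZMod.stdAddChar (d * y * t + b * y * (d * y) / 2) * Z (Pi.single 0 1) (t + b * y) := by
      intro y t
      have h2 := congrFun (LinearMap.congr_fun (hZ ![0, y]) (Pi.single 0 1)) t
      rw [LinearMap.comp_apply, LinearMap.comp_apply, heisenbergOperator_apply, sl2_mulVec] at h2
      have h3 : heisenbergOperator p ![0, y] (Pi.single 0 1) = Pi.single 0 1 := by
        funext u
        rw [heisenbergOperator_apply]
        by_cases hu : u = 0
        · subst hu; simp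
        · simp [hu]
      rw [h3] at h2
      simpa using h2
    funext t
    by_cases hb : b = 0
    · by_cases ht : t = 0
      · rw [ht]; exact h0
      · have hd : d ≠ 0 := by rintro rfl; simp [hb] at h
        have h2 := h1 (d * t)⁻¹ t
        have h3 : d * (d * t)⁻¹ * t + b * (d * t)⁻¹ * (d * (d * t)⁻¹) / 2 = 1 := by
          rw [hb]; field_simp; ring
        rw [h3, hb, zero_mul, add_zero] at h2
        have h4 : (ZMod.stdAddChar (1 : ZMod p) : ℂ) ≠ 1 := by
          rw [← AddChar.map_zero_eq_one (ZMod.stdAddChar (N := p))]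
          exact fun h => one_ne_zero (ZMod.injective_stdAddChar h)
        by_contra h5
        exact h4 (mul_right_cancel₀ h5 (by rw [one_mul]; exact h2.symm))
    · rw [h1 (-t / b) t]
      have : t + b * (-t / b) = 0 := by field_simp; ring
      rw [this, h0, mul_zero]; rfl
  apply (Pi.basisFun ℂ (ZMod p)).ext
  intro u
  rw [Pi.basisFun_apply, LinearMap.zero_apply]
  have h2 := LinearMap.congr_fun (hZ ![-u, 0]) (Pi.single 0 1)
  rw [LinearMap.comp_apply, LinearMap.comp_apply, key, map_zero] at h2
  rw [← h2]
  congr 1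
  funext t
  rw [heisenbergOperator_apply]
  by_cases ht : t = u
  · subst ht; simp
  · have : t + -u ≠ 0 := by rwa [← sub_eq_add_neg, sub_ne_zero]
    simp [ht, this]

theorem eq_of_intertwines {a b c d : ZMod p} (h : a * d - b * c = 1)
    {X Y : (ZMod p → ℂ) →ₗ[ℂ] (ZMod p → ℂ)}
    (hX : ∀ v, X ∘ₗ heisenbergOperator p v =
      heisenbergOperator p ((sl2 a b c d h).1.mulVec v) ∘ₗ X)
    (hY : ∀ v, Y ∘ₗ heisenbergOperator p v =
      heisenbergOperator p ((sl2 a b c d h).1.mulVec v) ∘ₗ Y)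
    (h0 : X (Pi.single 0 1) 0 = Y (Pi.single 0 1) 0) : X = Y := by
  rw [← sub_eq_zero]
  apply eq_zero_of_intertwines h
  · intro v
    rw [LinearMap.sub_comp, LinearMap.comp_sub, hX, hY]
  · simp [h0]

theorem weilOperator_single_zero {a b c d : ZMod p} (hb : b = 0) (hd : d ≠ 0) (u : ZMod p) :
    weilOperator a b c d (Pi.single 0 1) u = quadChar p a * (Pi.single 0 1 : ZMod p → ℂ) u := by
  rw [weilOperator_apply_zero hb]
  by_cases hu : u = 0
  · subst hu; simp
  · simp [hu, hd]

theorem weilOperator_single {a b c d : ZMod p} (hb : b ≠ 0) (u : ZMod p) :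
    weilOperator a b c d (Pi.single 0 1) u =
      weilFactor p * quadChar p b * ZMod.stdAddChar (-(d * u ^ 2) / (2 * b)) := by
  rw [weilOperator_apply hb]
  congr 1
  rw [Finset.sum_eq_single 0]
  · simp
  · intro v _ hv; simp [hv]
  · simp

/-- Both sides intertwine the Heisenberg operators in the same way, so it suffices to compare the
values at `0` of the images of the point mass at `0`. -/
theorem weilOperator_mul (hp : p ≠ 2) (a b c d : ZMod p) (h : a * d - b * c = 1)
    (a' b' c' d' : ZMod p) (h' : a' * d' - b' * c' = 1) :
    weilOperator (a * a' + b * c') (a * b' + b * d') (c * a' + d * c') (c * b' + d * d') =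
      weilOperator a b c d ∘ₗ weilOperator a' b' c' d' := by
  have h2 := two_ne_zero_zmod hp
  have hdet : (a * a' + b * c') * (c * b' + d * d') - (a * b' + b * d') * (c * a' + d * c') = 1 := by
    linear_combination (a' * d' - b' * c') * h + h'
  apply eq_of_intertwines hdet
  · exact weilOperator_intertwines hp _ _ _ _ hdet
  · intro v
    rw [LinearMap.comp_assoc, weilOperator_intertwines hp a' b' c' d' h', ← LinearMap.comp_assoc,
      weilOperator_intertwines hp a b c d h, LinearMap.comp_assoc]
    congr 2
    rw [Matrix.mulVec_mulVec, ← Matrix.SpecialLinearGroup.coe_mul, sl2_mul]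
  rw [LinearMap.comp_apply]
  by_cases hb : b = 0
  · subst hb
    have had : a * d = 1 := by linear_combination h
    have hd : d ≠ 0 := right_ne_zero_of_mul_eq_one had
    have ha : a ≠ 0 := left_ne_zero_of_mul_eq_one had
    rw [weilOperator_apply_zero rfl]
    by_cases hb' : b' = 0
    · subst hb'
      have had' : a' * d' = 1 := by linear_combination h'
      have hd' : d' ≠ 0 := right_ne_zero_of_mul_eq_one had'
      rw [weilOperator_single_zero (by ring) (by simp [hd, hd']),
        weilOperator_single_zero rfl hd']
      simp
    · rw [weilOperator_single (by simpa using ⟨ha, hb'⟩), weilOperator_single hb']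
      simp
      ring
  · rw [weilOperator_apply hb]
    by_cases hb' : b' = 0
    · subst hb'
      have had' : a' * d' = 1 := by linear_combination h'
      have hd' : d' ≠ 0 := right_ne_zero_of_mul_eq_one had'
      have e : quadChar p d' = quadChar p a' := by
        rw [eq_inv_of_mul_eq_one_right had', quadChar_inv]
      rw [weilOperator_single (by simpa using ⟨hb, hd'⟩), Finset.sum_eq_single 0]
      · rw [weilOperator_single_zero rfl hd']
        simp [e]
        ring
      · intro u _ hu
        rw [weilOperator_single_zero rfl hd']
        simp [hu]
      · simp
    · have hbb : b * b' ≠ 0 := mul_ne_zero hb hb'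
      have hsum : ∑ u, (ZMod.stdAddChar ((-(d * (0 : ZMod p) ^ 2) + 2 * 0 * u - a * u ^ 2) / (2 * b)) : ℂ) *
          weilOperator a' b' c' d' (Pi.single 0 1) u =
          weilFactor p * quadChar p b' *
            ∑ u, (ZMod.stdAddChar (-(a * b' + b * d') / (2 * (b * b')) * u ^ 2) : ℂ) := by
        rw [Finset.mul_sum]
        apply Finset.sum_congr rfl
        intro u _
        rw [weilOperator_single hb', mul_left_comm, ← AddChar.map_add_eq_mul]
        congr 2
        field_simp
        ring
      rw [hsum]
      -- The remaining sum is `p` if the upper right entry of the product vanishes, and a quadratic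
      -- Gauss sum otherwise.
      by_cases hb'' : a * b' + b * d' = 0
      · have hd'' : c * b' + d * d' ≠ 0 := by
          intro h3; rw [h3, hb''] at hdet; simp at hdet
        rw [weilOperator_single_zero hb'' hd'', hb'']
        have e : a * a' + b * c' = -(b * b'⁻¹) := by
          field_simp
          linear_combination a' * hb'' - b * h'
        rw [e, neg_eq_neg_one_mul, map_mul, map_mul, quadChar_inv, ← weilFactor_sq hp]
        simp
        ring
      · have hm : -(a * b' + b * d') / (2 * (b * b')) ≠ 0 :=
          div_ne_zero (neg_ne_zero.2 hb'') (mul_ne_zero h2 hbb)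
        rw [sum_stdAddChar_sq hp hm, weilOperator_single hb'']
        have e1 : -(a * b' + b * d') / (2 * (b * b')) =
            (-2)⁻¹ * (a * b' + b * d') * b⁻¹ * b'⁻¹ := by
          field_simp
        rw [e1]
        simp only [map_mul, quadChar_inv]
        have e2 := quadChar_mul_self hb
        have e3 := quadChar_mul_self hb'
        have e4 := quadChar_mul_self (neg_ne_zero.2 h2)
        have e5 : weilFactor p * quadGaussSum p = quadChar p (-2) := by
          unfold weilFactor
          rw [div_mul_cancel₀ _ (quadGaussSum_ne_zero hp)]
        simp only [zero_pow two_ne_zero, mul_zero, neg_zero, zero_div, AddChar.map_zero_eq_one,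
          mul_one]
        linear_combination (-weilFactor p * quadChar p (a * b' + b * d') * (quadChar p b * quadChar p b) * (quadChar p b' * quadChar p b') * quadChar p (-2)) * e5 - weilFactor p * quadChar p (a * b' + b * d') * ((quadChar p b * quadChar p b) * (quadChar p b' * quadChar p b') * e4 + (quadChar p b' * quadChar p b') * e2 + e3)

theorem weilOperator_one : weilOperator (1 : ZMod p) 0 0 1 = 1 := by
  apply LinearMap.ext
  intro f
  funext t
  rw [weilOperator_apply_zero rfl]
  simp

/-- The Weil representation of `SL(2, p)`. -/
noncomputable def weilRepresentation (hp : p ≠ 2) : Representation ℂ SL(2, ZMod p) (ZMod p → ℂ) where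
  toFun g := weilOperator (g 0 0) (g 0 1) (g 1 0) (g 1 1)
  map_one' := weilOperator_one
  map_mul' g h := by
    obtain ⟨a, b, c, d, hd, rfl⟩ := sl2_eq g
    obtain ⟨a', b', c', d', hd', rfl⟩ := sl2_eq h
    rw [sl2_mul]
    exact weilOperator_mul hp a b c d hd a' b' c' d' hd'

theorem weilRepresentation_sl2 (hp : p ≠ 2) (a b c d : ZMod p) (h : a * d - b * c = 1) :
    weilRepresentation hp (sl2 a b c d h) = weilOperator a b c d := rfl

theorem isWeilRepresentation (hp : p ≠ 2) : IsWeilRepresentation p (weilRepresentation hp) := by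
  intro g v
  obtain ⟨a, b, c, d, h, rfl⟩ := sl2_eq g
  exact weilOperator_intertwines hp a b c d h v

end WeilRepresentation

/-! ### Trace under restriction of scalars -/

section Trace

theorem trace_restrictScalars_complex {V : Type*} [AddCommGroup V] [Module ℂ V] [Module ℝ V]
    [IsScalarTower ℝ ℂ V] [FiniteDimensional ℂ V] (T : V →ₗ[ℂ] V) :
    LinearMap.trace ℝ V (T.restrictScalars ℝ) = 2 * (LinearMap.trace ℂ V T).re := by
  classical
  set b := Module.finBasis ℂ V
  rw [LinearMap.trace_eq_matrix_trace ℂ b, LinearMap.trace_eq_matrix_trace ℝ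
    (Complex.basisOneI.smulTower b)]
  simp only [Matrix.trace, Matrix.diag, LinearMap.toMatrix_apply, Fintype.sum_prod_type,
    Module.Basis.smulTower_repr, Module.Basis.smulTower_apply, LinearMap.restrictScalars_apply,
    Fin.sum_univ_two, Complex.re_sum, Finset.mul_sum, ← Finset.sum_add_distrib]
  apply Finset.sum_congr rfl
  intro j _
  simp [Complex.coe_basisOneI_repr]
  ring

end Trace

/-! ### The odd part of the Weil representation: character, commutant, irreducibility -/

section OddFunctions

variable (p : ℕ) [Fact p.Prime]

/-- The odd functions on `ZMod p`. -/
def oddFunctions : Submodule ℂ (ZMod p → ℂ) where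
  carrier := {f | ∀ t, f (-t) = -f t}
  add_mem' hf hg t := by rw [Pi.add_apply, Pi.add_apply, hf, hg, neg_add]
  zero_mem' t := by simp
  smul_mem' c f hf t := by rw [Pi.smul_apply, Pi.smul_apply, hf, smul_neg]

variable {p}

theorem ne_two_of_mod_four (hp : p % 4 = 3) : p ≠ 2 := by rintro rfl; omega

theorem sq_ne_neg_one (hp : p % 4 = 3) (x : ZMod p) : x ^ 2 ≠ -1 := by
  intro h
  have : IsSquare (-1 : ZMod p) := ⟨x, by rw [← h, sq]⟩
  exact ZMod.exists_sq_eq_neg_one_iff.1 this hp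

theorem quadChar_neg_one (hp : p % 4 = 3) : quadChar p (-1) = -1 := by
  have h : ¬ IsSquare (-1 : ZMod p) := fun h => ZMod.exists_sq_eq_neg_one_iff.1 h hp
  simp [quadChar, quadraticChar_neg_one_iff_not_isSquare.2 h]

/-- The sign is `quadChar p (-1) = -1`. Because of it, the part on which `-1` acts trivially
consists of the odd functions, not of the even ones. -/
theorem weil_neg_one_apply (hp : p % 4 = 3) (f : ZMod p → ℂ) (t : ZMod p) :
    weilRepresentation (ne_two_of_mod_four hp) (-1) f t = -f (-t) := by
  rw [sl2_neg_one, weilRepresentation_sl2, weilOperator_apply_zero rfl, quadChar_neg_one hp]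
  simp

theorem mem_oddFunctions_iff (hp : p % 4 = 3) (f : ZMod p → ℂ) :
    f ∈ oddFunctions p ↔ weilRepresentation (ne_two_of_mod_four hp) (-1) f = f := by
  constructor
  · intro h
    funext t
    rw [weil_neg_one_apply hp, h t, neg_neg]
  · intro h t
    have := congrFun h t
    rw [weil_neg_one_apply hp] at this
    rw [← this, neg_neg]

theorem weil_mem_oddFunctions (hp : p % 4 = 3) (g : SL(2, ZMod p)) (f : ZMod p → ℂ)
    (hf : f ∈ oddFunctions p) :
    weilRepresentation (ne_two_of_mod_four hp) g f ∈ oddFunctions p := by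
  rw [mem_oddFunctions_iff hp] at hf ⊢
  rw [← Module.End.mul_apply, ← map_mul, neg_one_mul, ← mul_neg_one, map_mul, Module.End.mul_apply,
    hf]

/-- The restriction of the Weil representation to the odd functions. -/
noncomputable def oddWeil (hp : p % 4 = 3) :
    Representation ℂ SL(2, ZMod p) (oddFunctions p) where
  toFun g := (weilRepresentation (ne_two_of_mod_four hp) g).restrict (weil_mem_oddFunctions hp g)
  map_one' := by ext; simp
  map_mul' g h := by ext; simp

theorem oddWeil_coe (hp : p % 4 = 3) (g : SL(2, ZMod p)) (f : oddFunctions p) :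
    (oddWeil hp g f : ZMod p → ℂ) = weilRepresentation (ne_two_of_mod_four hp) g f := rfl

/-- The real representation of `PSL(2, p)` on the odd functions. -/
noncomputable def oddRep (hp : p % 4 = 3) : Representation ℝ PSL(2, ZMod p) (oddFunctions p) :=
  QuotientGroup.lift (Subgroup.center SL(2, ZMod p))
    { toFun := fun g => (oddWeil hp g).restrictScalars ℝ
      map_one' := by rw [map_one]; rfl
      map_mul' := fun g h => by rw [map_mul]; rfl } (by
    intro g hg
    rw [← QuotientGroup.eq_one_iff, psl2_mk_eq_one_iff] at hg
    rw [MonoidHom.mem_ker]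
    rcases hg with rfl | rfl
    · exact map_one _
    · apply LinearMap.ext
      intro f
      exact Subtype.ext ((mem_oddFunctions_iff hp _).1 f.2))

theorem oddRep_coe (hp : p % 4 = 3) (g : SL(2, ZMod p)) (f : oddFunctions p) :
    (oddRep hp (QuotientGroup.mk g) f : ZMod p → ℂ) =
      weilRepresentation (ne_two_of_mod_four hp) g f := rfl

theorem oddRep_smul (hp : p % 4 = 3) (g : PSL(2, ZMod p)) (z : ℂ) (f : oddFunctions p) :
    oddRep hp g (z • f) = z • oddRep hp g f := by
  obtain ⟨g, rfl⟩ := QuotientGroup.mk_surjective g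
  exact map_smul (oddWeil hp g) z f

/-- The trace on odd functions is that of `ρ g` composed with the projection `(1 + ρ (-1)) / 2`, and
the real trace of a complex-linear map is twice the real part of its trace. -/
theorem oddRep_character (hp : p % 4 = 3) (g : SL(2, ZMod p)) :
    (((oddRep hp).character (QuotientGroup.mk g) : ℝ) : ℂ) =
      evenCharacter (weilRepresentation (ne_two_of_mod_four hp)) g +
        (starRingEnd ℂ) (evenCharacter (weilRepresentation (ne_two_of_mod_four hp)) g) := by
  set ρ := weilRepresentation (ne_two_of_mod_four hp) with hρ
  have h1 : (oddRep hp).character (QuotientGroup.mk g) =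
      2 * (LinearMap.trace ℂ _ (oddWeil hp g)).re :=
    trace_restrictScalars_complex (oddWeil hp g)
  have h2 : LinearMap.trace ℂ _ (oddWeil hp g) = evenCharacter ρ g := by
    have hmem : ∀ f : ZMod p → ℂ, ((1 / 2 : ℂ) • ((1 : Module.End ℂ (ZMod p → ℂ)) + ρ (-1))) f ∈
        oddFunctions p := by
      intro f
      rw [mem_oddFunctions_iff hp, LinearMap.smul_apply, map_smul, LinearMap.add_apply, map_add,
        ← hρ, ← Module.End.mul_apply, ← Module.End.mul_apply, ← map_mul]
      simp [add_comm]
    set π : (ZMod p → ℂ) →ₗ[ℂ] oddFunctions p := LinearMap.codRestrict _ _ hmem with hπ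
    have h3 : π ∘ₗ (oddFunctions p).subtype = LinearMap.id := by
      ext f t
      have := congrFun ((mem_oddFunctions_iff hp _).1 f.2) t
      simp only [hπ, LinearMap.comp_apply, Submodule.subtype_apply, LinearMap.codRestrict_apply,
        LinearMap.smul_apply, LinearMap.add_apply, Module.End.one_apply, Pi.smul_apply,
        Pi.add_apply, LinearMap.id_apply, smul_eq_mul]
      rw [← hρ] at this
      rw [this]; ring
    have h4 : ((oddFunctions p).subtype ∘ₗ oddWeil hp g) ∘ₗ π =
        (1 / 2 : ℂ) • (ρ g + ρ (-g)) := by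
      refine LinearMap.ext fun f => ?_
      simp only [LinearMap.comp_apply, Submodule.subtype_apply, oddWeil_coe, hπ,
        LinearMap.codRestrict_apply, LinearMap.smul_apply, LinearMap.add_apply, map_smul, map_add]
      rw [← hρ, Module.End.one_apply, ← Module.End.mul_apply (ρ g), ← map_mul, mul_neg_one]
    have h5 := LinearMap.trace_comp_comm' π ((oddFunctions p).subtype ∘ₗ oddWeil hp g)
    rw [h4, ← LinearMap.comp_assoc, h3, LinearMap.id_comp, map_smul, map_add] at h5
    rw [← h5]
    unfold evenCharacter Representation.character
    rw [smul_eq_mul]; ring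
  rw [h1, h2, Complex.add_conj]

/-- The odd function supported at `s` and `-s`. -/
noncomputable def oddSingle (s : ZMod p) : oddFunctions p :=
  ⟨Pi.single s 1 - Pi.single (-s) 1, fun t => by
    have h : -t = s ↔ t = -s := neg_eq_iff_eq_neg
    simp only [Pi.sub_apply, Pi.single_apply, neg_inj, h]; ring⟩

theorem oddSingle_apply (s t : ZMod p) : (oddSingle s : ZMod p → ℂ) t =
    (if t = s then 1 else 0) - if t = -s then 1 else 0 := by
  simp only [oddSingle, Pi.sub_apply, Pi.single_apply]

theorem odd_apply_zero (f : oddFunctions p) : (f : ZMod p → ℂ) 0 = 0 := by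
  have := f.2 0
  rw [neg_zero] at this
  exact self_eq_neg.1 this

theorem neg_ne_self_zmod (hp : p ≠ 2) {s : ZMod p} (hs : s ≠ 0) : s ≠ -s := by
  intro h
  have : 2 * s = 0 := by linear_combination h
  rcases mul_eq_zero.1 this with h | h
  · exact two_ne_zero_zmod hp h
  · exact hs h

theorem oddSingle_self (hp : p ≠ 2) {s : ZMod p} (hs : s ≠ 0) :
    (oddSingle s : ZMod p → ℂ) s = 1 := by
  rw [oddSingle_apply, if_pos rfl, if_neg (neg_ne_self_zmod hp hs), sub_zero]

theorem odd_eq_sum (f : oddFunctions p) :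
    f = ∑ s, ((f : ZMod p → ℂ) s / 2) • oddSingle s := by
  apply Subtype.ext
  funext t
  rw [Submodule.coe_sum, Finset.sum_apply]
  simp only [Submodule.coe_smul, Pi.smul_apply, oddSingle_apply, smul_eq_mul, mul_sub,
    Finset.sum_sub_distrib, mul_ite, mul_one, mul_zero]
  have : ∀ s : ZMod p, t = -s ↔ s = -t := fun s => by constructor <;> (rintro rfl; simp)
  simp only [this, Finset.sum_ite_eq, Finset.mem_univ, if_true, Finset.sum_ite_eq']
  rw [f.2 t]; ring

/-- The lower unipotent matrices. -/
def lowerSL (c : ZMod p) : SL(2, ZMod p) := sl2 1 0 c 1 (by ring)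

theorem oddRep_lower (hp : p % 4 = 3) (c : ZMod p) (f : oddFunctions p) (t : ZMod p) :
    (oddRep hp (QuotientGroup.mk (lowerSL c)) f : ZMod p → ℂ) t =
      ZMod.stdAddChar (-(c * t ^ 2) / 2) * (f : ZMod p → ℂ) t := by
  rw [oddRep_coe]
  show weilOperator 1 0 c 1 f.1 t = _
  rw [weilOperator_apply_zero rfl]
  simp

theorem oddRep_lower_single (hp : p % 4 = 3) (c s : ZMod p) (w : ℂ) :
    oddRep hp (QuotientGroup.mk (lowerSL c)) (w • oddSingle s) =
      (ZMod.stdAddChar (-(c * s ^ 2) / 2) * w) • oddSingle s := by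
  apply Subtype.ext
  funext t
  rw [oddRep_lower]
  simp only [Submodule.coe_smul, Pi.smul_apply, oddSingle_apply, smul_eq_mul]
  by_cases h : t = s
  · subst h; ring
  · by_cases h' : t = -s
    · subst h'; rw [neg_sq]; ring
    · simp [h, h']

theorem oddRep_diag_single (hp : p % 4 = 3) {a : ZMod p} (ha : a ≠ 0) (s : ZMod p) (w : ℂ) :
    oddRep hp (QuotientGroup.mk (sl2 a 0 0 a⁻¹ (by field_simp; ring))) (w • oddSingle s) =
      (quadChar p a * w) • oddSingle (a * s) := by
  apply Subtype.ext
  funext t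
  rw [oddRep_coe]
  show weilOperator a 0 0 a⁻¹ _ t = _
  rw [weilOperator_apply_zero rfl]
  have h1 : a⁻¹ * t = s ↔ t = a * s := inv_mul_eq_iff_eq_mul₀ ha
  have h2 : a⁻¹ * t = -s ↔ t = -(a * s) := by rw [inv_mul_eq_iff_eq_mul₀ ha, mul_neg]
  simp only [Submodule.coe_smul, Pi.smul_apply, oddSingle_apply, smul_eq_mul, h1, h2]
  simp
  ring

/-- Averaging over the unipotent group projects to the multiples of `oddSingle s`. -/
theorem sum_oddRep_lower (hp : p % 4 = 3) {s : ZMod p} (hs : s ≠ 0) (f : oddFunctions p) :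
    ∑ c : ZMod p, (2 * (ZMod.stdAddChar (c * s ^ 2 / 2) : ℂ).re) •
      oddRep hp (QuotientGroup.mk (lowerSL c)) f =
      (p : ℝ) • ((f : ZMod p → ℂ) s • oddSingle s) := by
  have h2 := two_ne_zero_zmod (ne_two_of_mod_four hp)
  apply Subtype.ext
  funext t
  rw [Submodule.coe_sum, Finset.sum_apply]
  have h : ∀ c : ZMod p, ((((2 * (ZMod.stdAddChar (c * s ^ 2 / 2) : ℂ).re) •
      oddRep hp (QuotientGroup.mk (lowerSL c)) f : oddFunctions p)) : ZMod p → ℂ) t =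
      (ZMod.stdAddChar ((s ^ 2 - t ^ 2) / 2 * c) + ZMod.stdAddChar (-(s ^ 2 + t ^ 2) / 2 * c)) *
        (f : ZMod p → ℂ) t := by
    intro c
    rw [Submodule.coe_smul_of_tower, Pi.smul_apply, oddRep_lower, Complex.real_smul]
    have h3 : ((2 * (ZMod.stdAddChar (c * s ^ 2 / 2) : ℂ).re : ℝ) : ℂ) =
        ZMod.stdAddChar (c * s ^ 2 / 2) + ZMod.stdAddChar (-(c * s ^ 2 / 2)) := by
      rw [AddChar.map_neg_eq_conj, Complex.add_conj]
    rw [h3, ← mul_assoc, add_mul, ← AddChar.map_add_eq_mul, ← AddChar.map_add_eq_mul]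
    congr 3 <;> ring
  rw [Finset.sum_congr rfl fun c _ => h c, ← Finset.sum_mul, Finset.sum_add_distrib,
    sum_stdAddChar_mul, sum_stdAddChar_mul]
  -- The coefficients must be real, so the conjugate character enters too. It would select the
  -- points with `t ^ 2 = -s ^ 2`, and there are none.
  have h4 : -(s ^ 2 + t ^ 2) / 2 ≠ 0 := by
    intro h
    apply sq_ne_neg_one hp (t / s)
    field_simp at h ⊢
    linear_combination -h
  have h5 : (s ^ 2 - t ^ 2) / 2 = 0 ↔ t = s ∨ t = -s := by
    rw [div_eq_zero_iff, or_iff_left h2, sub_eq_zero, eq_comm, sq_eq_sq_iff_eq_or_eq_neg]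
  rw [if_neg h4, add_zero, Submodule.coe_smul_of_tower, Pi.smul_apply, Submodule.coe_smul,
    Pi.smul_apply, oddSingle_apply, Complex.real_smul]
  simp only [h5]
  by_cases e1 : t = s
  · subst e1
    simp [neg_ne_self_zmod (ne_two_of_mod_four hp) hs]
  · by_cases e2 : t = -s
    · subst e2
      simp [(neg_ne_self_zmod (ne_two_of_mod_four hp) hs).symm, f.2 s]
    · simp [e1, e2]

theorem stdAddChar_one_im_ne_zero (hp : p ≠ 2) : (ZMod.stdAddChar (1 : ZMod p) : ℂ).im ≠ 0 := by
  intro h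
  have h1 : (ZMod.stdAddChar (-1 : ZMod p) : ℂ) = ZMod.stdAddChar (1 : ZMod p) := by
    rw [AddChar.map_neg_eq_conj]; exact Complex.conj_eq_iff_im.2 h
  exact neg_ne_self_zmod hp (one_ne_zero : (1 : ZMod p) ≠ 0) (ZMod.injective_stdAddChar h1).symm

/-- A real-linear map from `ℂ` which commutes with multiplication by one nonreal number is
complex linear. -/
theorem eq_smul_of_commutes {V : Type*} [AddCommGroup V] [Module ℂ V] [Module ℝ V]
    [IsScalarTower ℝ ℂ V] (L : ℂ →ₗ[ℝ] V) {ζ : ℂ} (hζ : ζ.im ≠ 0)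
    (hL : ∀ w, L (ζ * w) = ζ • L w) (w : ℂ) : L w = w • L 1 := by
  have hw : w = (w.re - w.im / ζ.im * ζ.re) • (1 : ℂ) + (w.im / ζ.im) • (ζ * 1) := by
    apply Complex.ext
    · simp
    · simp; field_simp
  conv_lhs => rw [hw]
  rw [map_add, map_smul, map_smul, hL]
  conv_rhs => rw [hw]
  rw [add_smul, smul_assoc, smul_assoc, mul_one, one_smul]

/-- The projections `sum_oddRep_lower` are real combinations of group elements, so `D` preserves
each complex line of `oddSingle s`. A unipotent element acts there by a nonreal scalar, which makes
`D` complex linear on the line, and diagonal matrices carry the line of `1` to all others, so the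
scalar is the same everywhere. -/
theorem oddRep_commutant (hp : p % 4 = 3) (D : oddFunctions p →ₗ[ℝ] oddFunctions p)
    (hD : ∀ g f, D (oddRep hp g f) = oddRep hp g (D f)) : ∃ z : ℂ, ∀ f, D f = z • f := by
  have hp2 := ne_two_of_mod_four hp
  have h2 := two_ne_zero_zmod hp2
  have hp0 : (p : ℝ) ≠ 0 := by exact_mod_cast (Fact.out : p.Prime).ne_zero
  have h1 : ∀ s : ZMod p, s ≠ 0 → ∀ w : ℂ,
      D (w • oddSingle s) = ((D (w • oddSingle s) : oddFunctions p) : ZMod p → ℂ) s • oddSingle s := by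
    intro s hs w
    have e1 := sum_oddRep_lower hp hs (w • oddSingle s)
    have e2 := sum_oddRep_lower hp hs (D (w • oddSingle s))
    apply smul_right_injective _ hp0
    dsimp only
    rw [← e2, ← map_smul]
    rw [Submodule.coe_smul, Pi.smul_apply, oddSingle_self hp2 hs, smul_eq_mul, mul_one] at e1
    rw [← e1, map_sum]
    apply Finset.sum_congr rfl
    intro c _
    rw [map_smul, hD]
  have h3 : ∀ s : ZMod p, s ≠ 0 → ∀ w : ℂ, D (w • oddSingle s) = w • D (oddSingle s) := by
    intro s hs w
    have := eq_smul_of_commutes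
      (D ∘ₗ ((LinearMap.toSpanSingleton ℂ _ (oddSingle s)).restrictScalars ℝ))
      (stdAddChar_one_im_ne_zero hp2) (fun w => by
        simp only [LinearMap.comp_apply, LinearMap.restrictScalars_apply,
          LinearMap.toSpanSingleton_apply]
        -- With this parameter the eigenvalue on the line of `oddSingle s` is `ZMod.stdAddChar 1`.
        have e1 := oddRep_lower_single hp (-2 / s ^ 2) s w
        have e3 : -(-2 / s ^ 2 * s ^ 2) / 2 = 1 := by field_simp
        rw [e3] at e1
        rw [← e1, hD, h1 s hs w, oddRep_lower_single, e3, mul_smul]) w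
    simpa using this
  have h4 : ∀ s : ZMod p, s ≠ 0 →
      D (oddSingle s) = ((D (oddSingle 1) : oddFunctions p) : ZMod p → ℂ) 1 • oddSingle s := by
    intro s hs
    have e1 := oddRep_diag_single hp hs 1 1
    have e2 := h1 1 one_ne_zero 1
    rw [one_smul] at e1 e2
    have e3 := hD (QuotientGroup.mk (sl2 s 0 0 s⁻¹ (by field_simp; ring))) (oddSingle 1)
    rw [e1, e2, oddRep_diag_single hp hs, mul_one, mul_one, h3 s hs, mul_smul] at e3
    have e4 : quadChar p s ≠ 0 := left_ne_zero_of_mul_eq_one (quadChar_mul_self hs)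
    exact smul_right_injective _ e4 e3
  refine ⟨((D (oddSingle 1) : oddFunctions p) : ZMod p → ℂ) 1, fun f => ?_⟩
  conv_lhs => rw [odd_eq_sum f]
  conv_rhs => rw [odd_eq_sum f]
  rw [map_sum, Finset.smul_sum]
  apply Finset.sum_congr rfl
  intro s _
  by_cases hs : s = 0
  · subst hs
    rw [odd_apply_zero]; simp
  · rw [h3 s hs, h4 s hs, smul_comm]

theorem oddSingle_ne_zero (hp : p ≠ 2) {s : ZMod p} (hs : s ≠ 0) : oddSingle s ≠ 0 := by
  intro h
  have := oddSingle_self hp hs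
  rw [h] at this
  simp at this

/-- A nonzero invariant real subspace contains, by projection, a nonzero vector on some complex
line; a nonreal eigenvalue fills up the line, and diagonal matrices reach the other lines. -/
theorem oddRep_isIrreducible (hp : p % 4 = 3) : (oddRep hp).IsIrreducible := by
  have hp2 := ne_two_of_mod_four hp
  have h2 := two_ne_zero_zmod hp2
  have hp0 : (p : ℝ) ≠ 0 := by exact_mod_cast (Fact.out : p.Prime).ne_zero
  have hnt : Nontrivial (Subrepresentation (oddRep hp)) := by
    refine ⟨⊥, ⊤, fun h => ?_⟩
    have : (oddSingle 1 : oddFunctions p) ∈ (⊤ : Subrepresentation (oddRep hp)).toSubmodule :=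
      Submodule.mem_top
    rw [← h] at this
    exact oddSingle_ne_zero hp2 one_ne_zero ((Submodule.mem_bot ℝ).1 this)
  refine { eq_bot_or_eq_top := fun U => ?_ }
  by_cases hU : U.toSubmodule = ⊥
  · left; exact Subrepresentation.toSubmodule_injective hU
  right
  apply Subrepresentation.toSubmodule_injective
  obtain ⟨f, hf, hf0⟩ := (Submodule.ne_bot_iff _).1 hU
  obtain ⟨s, hs⟩ : ∃ s, (f : ZMod p → ℂ) s ≠ 0 := by
    by_contra! h
    exact hf0 (Subtype.ext (funext h))
  have hs0 : s ≠ 0 := by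
    rintro rfl; exact hs (odd_apply_zero f)
  have h1 : (f : ZMod p → ℂ) s • oddSingle s ∈ U.toSubmodule := by
    have e1 := sum_oddRep_lower hp hs0 f
    rw [← inv_smul_smul₀ hp0 ((f : ZMod p → ℂ) s • oddSingle s), ← e1]
    refine Submodule.smul_mem _ _ (Submodule.sum_mem _ fun c _ => Submodule.smul_mem _ _ ?_)
    exact U.apply_mem_toSubmodule _ hf
  have h3 : ∀ w : ℂ, w • oddSingle s ∈ U.toSubmodule := by
    intro w
    have hζ := stdAddChar_one_im_ne_zero hp2
    set ζ : ℂ := ZMod.stdAddChar (1 : ZMod p)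
    set w₀ := (f : ZMod p → ℂ) s
    have e1 := U.apply_mem_toSubmodule (QuotientGroup.mk (lowerSL (-2 / s ^ 2))) h1
    rw [oddRep_lower_single] at e1
    have e3 : -(-2 / s ^ 2 * s ^ 2) / 2 = 1 := by field_simp
    rw [e3] at e1
    -- The numbers `1` and `ζ` form a real basis of `ℂ`.
    have hw : w / w₀ = (((w / w₀).re - (w / w₀).im / ζ.im * ζ.re : ℝ) : ℂ) +
        (((w / w₀).im / ζ.im : ℝ) : ℂ) * ζ := by
      apply Complex.ext
      · simp
      · simp; field_simp
    have hw' : w = ((w / w₀).re - (w / w₀).im / ζ.im * ζ.re) • w₀ +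
        ((w / w₀).im / ζ.im) • (ζ * w₀) := by
      rw [Complex.real_smul, Complex.real_smul]
      conv_lhs => rw [← div_mul_cancel₀ w hs, hw]
      ring
    rw [hw', add_smul, smul_assoc, smul_assoc]
    exact Submodule.add_mem _ (Submodule.smul_mem _ _ h1) (Submodule.smul_mem _ _ e1)
  show U.toSubmodule = ⊤
  rw [eq_top_iff]
  intro f' _
  rw [odd_eq_sum f']
  refine Submodule.sum_mem _ fun t _ => ?_
  by_cases ht : t = 0
  · subst ht
    rw [odd_apply_zero]; simp
  · have hts : t / s ≠ 0 := div_ne_zero ht hs0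
    have e1 := U.apply_mem_toSubmodule
      (QuotientGroup.mk (sl2 (t / s) 0 0 (t / s)⁻¹ (by field_simp; ring)))
      (h3 (quadChar p (t / s) * ((f' : ZMod p → ℂ) t / 2)))
    rw [oddRep_diag_single hp hts, div_mul_cancel₀ _ hs0, ← mul_assoc, quadChar_mul_self hts,
      one_mul] at e1
    exact e1

end OddFunctions

/-! ### Many vectors fixed by the dihedral group -/

section WythoffVectors

variable {p : ℕ} [Fact p.Prime]

/-- The alternating sum of the point masses at the points of the orbit of `a` under multiplication
by `ν`, for `ν` of order `14`. -/
def alternatingOrbit (ν a : ZMod p) (t : ZMod p) : ℂ :=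
  ∑ i ∈ Finset.range 14, (-1) ^ i * if ν ^ i * t = a then 1 else 0

variable {ν : ZMod p}

theorem alternatingOrbit_mul (hν : ν ^ 14 = 1) (a t : ZMod p) :
    alternatingOrbit ν a (ν * t) = -alternatingOrbit ν a t := by
  have h : ∀ i, (-1 : ℂ) ^ i * (if ν ^ i * (ν * t) = a then 1 else 0) =
      -((-1) ^ (i + 1) * if ν ^ (i + 1) * t = a then 1 else 0) := by
    intro i
    rw [← mul_assoc, ← pow_succ, pow_succ]; ring
  unfold alternatingOrbit
  rw [Finset.sum_congr rfl fun i _ => h i, Finset.sum_neg_distrib]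
  have h1 := Finset.sum_range_succ (fun i => (-1 : ℂ) ^ i * if ν ^ i * t = a then 1 else 0) 14
  rw [Finset.sum_range_succ'] at h1
  rw [hν, pow_zero, pow_zero] at h1
  rw [neg_inj]
  have h2 : (-1 : ℂ) ^ 14 = 1 := by norm_num
  rw [h2] at h1
  exact add_right_cancel h1

theorem alternatingOrbit_pow_mul (hν : ν ^ 14 = 1) (a t : ZMod p) (k : ℕ) :
    alternatingOrbit ν a (ν ^ k * t) = (-1) ^ k * alternatingOrbit ν a t := by
  induction k with
  | zero => simp
  | succ k ih => rw [pow_succ', mul_assoc, alternatingOrbit_mul hν, ih]; ring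

theorem alternatingOrbit_apply_self (hν : orderOf ν = 14) {a : ZMod p} (ha : a ≠ 0) :
    alternatingOrbit ν a a = 1 := by
  unfold alternatingOrbit
  rw [Finset.sum_eq_single 0]
  · simp
  · intro i hi hi0
    rw [if_neg, mul_zero]
    intro h
    rw [mul_eq_right₀ ha, ← orderOf_dvd_iff_pow_eq_one, hν] at h
    exact hi0 (Nat.eq_zero_of_dvd_of_lt h (Finset.mem_range.1 hi))
  · intro h; exact absurd (Finset.mem_range.2 (by norm_num)) h

theorem alternatingOrbit_apply_of_ne {a b : ZMod p} (h : ∀ i : ℕ, ν ^ i * b ≠ a) :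
    alternatingOrbit ν a b = 0 := by
  unfold alternatingOrbit
  exact Finset.sum_eq_zero fun i _ => by rw [if_neg (h i), mul_zero]

theorem sum_norm_alternatingOrbit_le (hν0 : ν ≠ 0) (a : ZMod p) :
    ∑ t, ‖alternatingOrbit ν a t‖ ≤ 14 := by
  calc ∑ t, ‖alternatingOrbit ν a t‖
      ≤ ∑ t : ZMod p, ∑ i ∈ Finset.range 14, (if t = (ν ^ i)⁻¹ * a then (1 : ℝ) else 0) := by
        refine Finset.sum_le_sum fun t _ => (norm_sum_le _ _).trans (Finset.sum_le_sum fun i _ => ?_)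
        have h : ν ^ i * t = a ↔ t = (ν ^ i)⁻¹ * a := (eq_inv_mul_iff_mul_eq₀ (pow_ne_zero i hν0)).symm
        simp only [h]
        split_ifs <;> simp
    _ = 14 := by
        rw [Finset.sum_comm]
        simp

theorem neg_one_eq_pow_seven (hν : orderOf ν = 14) : ν ^ 7 = -1 := by
  have h : (ν ^ 7) ^ 2 = 1 := by
    rw [← pow_mul]; exact orderOf_dvd_iff_pow_eq_one.1 hν.dvd
  rcases sq_eq_one_iff.1 h with h | h
  · have := orderOf_dvd_of_pow_eq_one h
    rw [hν] at this
    exact absurd this (by norm_num)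
  · exact h

/-- The value is a sign whose seventh power is `quadChar p (-1) = -1`. For this reason vectors fixed
by `diag(ν, ν⁻¹)` alternate along the orbits of `ν`. -/
theorem quadChar_of_pow_seven (hp : p % 4 = 3) (hν : ν ^ 7 = -1) (hν0 : ν ≠ 0) :
    quadChar p ν = -1 := by
  have h1 := quadChar_neg_one hp
  have h2 := quadChar_mul_self hν0
  rw [← hν, map_pow] at h1
  linear_combination h1 - (quadChar p ν) * ((quadChar p ν) ^ 4 + (quadChar p ν) ^ 2 + 1) * h2

theorem norm_quadChar {a : ZMod p} (ha : a ≠ 0) : ‖quadChar p a‖ = 1 := by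
  have h := congrArg norm (quadChar_mul_self ha)
  rw [norm_mul, norm_one] at h
  nlinarith [norm_nonneg (quadChar p a)]

theorem norm_weilFactor_sq (hp : p ≠ 2) : ‖weilFactor p‖ ^ 2 * p = 1 := by
  have h := congrArg norm (weilFactor_sq hp)
  rwa [norm_quadChar (neg_ne_zero.2 one_ne_zero), norm_mul, norm_pow, Complex.norm_natCast] at h

/-- Linear combinations of alternating orbit sums. -/
def alternatingCombination (hν : orderOf ν = 14) {ι : Type*} [Fintype ι] (a : ι → ZMod p) :
    (ι → ℂ) →ₗ[ℂ] oddFunctions p where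
  toFun F := ⟨fun t => ∑ j, F j * alternatingOrbit ν (a j) t, fun t => by
    have h : -t = ν ^ 7 * t := by rw [neg_one_eq_pow_seven hν, neg_one_mul]
    rw [← Finset.sum_neg_distrib]
    refine Finset.sum_congr rfl fun j _ => ?_
    rw [h, alternatingOrbit_pow_mul (by rw [← hν, pow_orderOf_eq_one])]
    ring⟩
  map_add' F F' := by
    apply Subtype.ext
    funext t
    simp [add_mul, Finset.sum_add_distrib]
  map_smul' z F := by
    apply Subtype.ext
    funext t
    simp [mul_assoc, Finset.mul_sum]

section

variable (hν : orderOf ν = 14) {ι : Type*} [Fintype ι] (a : ι → ZMod p)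

theorem alternatingCombination_apply (F : ι → ℂ) (t : ZMod p) :
    (alternatingCombination hν a F : ZMod p → ℂ) t = ∑ j, F j * alternatingOrbit ν (a j) t := rfl

theorem alternatingCombination_mul (F : ι → ℂ) (t : ZMod p) :
    (alternatingCombination hν a F : ZMod p → ℂ) (ν * t) =
      -(alternatingCombination hν a F : ZMod p → ℂ) t := by
  simp only [alternatingCombination_apply,
    alternatingOrbit_mul (show ν ^ 14 = 1 by rw [← hν, pow_orderOf_eq_one]), mul_neg,
    Finset.sum_neg_distrib]

theorem alternatingCombination_apply_point (ha0 : ∀ j, a j ≠ 0)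
    (ha : ∀ j k (i : ℕ), ν ^ i * a k = a j → j = k) (F : ι → ℂ) (k : ι) :
    (alternatingCombination hν a F : ZMod p → ℂ) (a k) = F k := by
  classical
  rw [alternatingCombination_apply, Finset.sum_eq_single k, alternatingOrbit_apply_self hν (ha0 k),
    mul_one]
  · intro j _ hj
    rw [alternatingOrbit_apply_of_ne fun i h => hj (ha j k i h), mul_zero]
  · intro h; exact absurd (Finset.mem_univ k) h

theorem sum_norm_alternatingCombination_le (hν0 : ν ≠ 0) (F : ι → ℂ) :
    ∑ t, ‖(alternatingCombination hν a F : ZMod p → ℂ) t‖ ≤ 14 * ∑ j, ‖F j‖ := by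
  calc _ ≤ ∑ t, ∑ j, ‖F j‖ * ‖alternatingOrbit ν (a j) t‖ := by
        refine Finset.sum_le_sum fun t _ => ?_
        rw [alternatingCombination_apply]
        exact (norm_sum_le _ _).trans (Finset.sum_le_sum fun j _ => (norm_mul _ _).le)
    _ = ∑ j, ‖F j‖ * ∑ t, ‖alternatingOrbit ν (a j) t‖ := by
        rw [Finset.sum_comm]; simp only [Finset.mul_sum]
    _ ≤ ∑ j, ‖F j‖ * 14 := Finset.sum_le_sum fun j _ =>
        mul_le_mul_of_nonneg_left (sum_norm_alternatingOrbit_le hν0 _) (norm_nonneg _)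
    _ = _ := by rw [← Finset.sum_mul, mul_comm]

theorem norm_weilOperator_le (f : ZMod p → ℂ) (t : ZMod p) :
    ‖weilOperator 0 1 (-1) 0 f t‖ ≤ ‖weilFactor p‖ * ∑ u, ‖f u‖ := by
  rw [weilOperator_apply one_ne_zero, norm_mul, norm_mul, norm_quadChar one_ne_zero, mul_one]
  refine mul_le_mul_of_nonneg_left ((norm_sum_le _ _).trans (Finset.sum_le_sum fun u _ => ?_))
    (norm_nonneg _)
  rw [norm_mul, AddChar.norm_apply, one_mul]

/-- The sum of a function with its image under the involution `[[0, 1], [-1, 0]]`. -/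
noncomputable def symmetrize (hp : p % 4 = 3) : oddFunctions p →ₗ[ℂ] oddFunctions p :=
  LinearMap.id + oddWeil hp (sl2 0 1 (-1) 0 (by ring))

/-- A kernel element gives `u = -w u`. The coefficients are values of `u`, and every value of `w u`
is at most `p ^ (-1/2)` times the `ℓ¹` norm of `u`, which is at most `14 * ∑ ‖F j‖`. Summing over
the coefficients bounds `∑ ‖F j‖` by itself times a number below `1`. -/
theorem symmetrize_comp_injective (hp : p % 4 = 3) (hν0 : ν ≠ 0) (ha0 : ∀ j, a j ≠ 0)
    (ha : ∀ j k (i : ℕ), ν ^ i * a k = a j → j = k)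
    (hcard : (14 * Fintype.card ι) ^ 2 < p) :
    Function.Injective (symmetrize hp ∘ₗ alternatingCombination hν a) := by
  rw [← LinearMap.ker_eq_bot, LinearMap.ker_eq_bot']
  intro F hF
  set u := alternatingCombination hν a F with hu
  have h1 : ∀ t, (u : ZMod p → ℂ) t = -weilOperator 0 1 (-1) 0 u.1 t := fun t =>
    eq_neg_of_add_eq_zero_left (congrFun (congrArg Subtype.val hF) t)
  have h2 : ∀ k, ‖F k‖ ≤ ‖weilFactor p‖ * (14 * ∑ j, ‖F j‖) := by
    intro k
    rw [← alternatingCombination_apply_point hν a ha0 ha F k, ← hu, h1, norm_neg]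
    exact (norm_weilOperator_le _ _).trans (mul_le_mul_of_nonneg_left
      (sum_norm_alternatingCombination_le hν a hν0 F) (norm_nonneg _))
  have h3 : ∑ j, ‖F j‖ ≤ Fintype.card ι * (‖weilFactor p‖ * (14 * ∑ j, ‖F j‖)) := by
    calc _ ≤ ∑ _j : ι, ‖weilFactor p‖ * (14 * ∑ j, ‖F j‖) := Finset.sum_le_sum fun k _ => h2 k
      _ = _ := by rw [Finset.sum_const, Finset.card_univ, nsmul_eq_mul]
  have h4 : 14 * Fintype.card ι * ‖weilFactor p‖ < 1 := by
    have h5 := norm_weilFactor_sq (p := p) (ne_two_of_mod_four hp)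
    have h6 : ((14 * Fintype.card ι : ℝ)) ^ 2 < p := by exact_mod_cast hcard
    have h7 : 0 < ‖weilFactor p‖ := by
      rcases (norm_nonneg (weilFactor p)).eq_or_lt with h | h
      · rw [← h] at h5; norm_num at h5
      · exact h
    rw [← sq_lt_one_iff₀ (by positivity), mul_pow]
    calc _ < (p : ℝ) * ‖weilFactor p‖ ^ 2 := by gcongr
      _ = 1 := by rw [mul_comm, h5]
  have h5 : ∑ j, ‖F j‖ = 0 := by
    have h6 : 0 ≤ ∑ j, ‖F j‖ := Finset.sum_nonneg fun j _ => norm_nonneg _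
    nlinarith
  funext j
  exact norm_eq_zero.1 ((Finset.sum_eq_zero_iff_of_nonneg fun j _ => norm_nonneg _).1 h5 j
    (Finset.mem_univ j))

/-- The sign `quadChar p ν = -1` cancels the alternation, so `y` fixes `u`; as `y * w * y = w`, it
fixes `w u` too. The second generator is `w * y`, and `w` exchanges `u` and `w u`. -/
theorem oddRep_symmetrize_fixed (hp : p % 4 = 3) (hν0 : ν ≠ 0) (F : ι → ℂ) :
    ∀ h ∈ Subgroup.closure {(QuotientGroup.mk (sl2 0 1 (-1) 0 (by ring)) : PSL(2, ZMod p)),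
        QuotientGroup.mk (sl2 0 ν⁻¹ (-ν) 0 (by field_simp; ring))},
      oddRep hp h (symmetrize hp (alternatingCombination hν a F)) =
        symmetrize hp (alternatingCombination hν a F) := by
  set u := alternatingCombination hν a F with hu
  set w : SL(2, ZMod p) := sl2 0 1 (-1) 0 (by ring) with hw
  set y : SL(2, ZMod p) := sl2 ν 0 0 ν⁻¹ (by field_simp; ring) with hy
  have e1 : oddRep hp (QuotientGroup.mk y) u = u := by
    apply Subtype.ext
    funext t
    show weilOperator ν 0 0 ν⁻¹ u.1 t = u.1 t
    rw [weilOperator_apply_zero rfl, quadChar_of_pow_seven hp (neg_one_eq_pow_seven hν) hν0]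
    have h := alternatingCombination_mul hν a F (ν⁻¹ * t)
    rw [mul_inv_cancel_left₀ hν0, ← hu] at h
    rw [h]
    simp
  have e2 : symmetrize hp u = u + oddRep hp (QuotientGroup.mk w) u := rfl
  have e3 : (QuotientGroup.mk w : PSL(2, ZMod p)) * QuotientGroup.mk w = 1 := by
    rw [← QuotientGroup.mk_mul, psl2_mk_eq_one_iff, hw, sl2_mul]
    right
    rw [sl2_neg_one]
    apply sl2_congr <;> ring
  have e4 : y * w * y = w := by
    rw [hw, hy, sl2_mul, sl2_mul]
    apply sl2_congr <;> (field_simp; try ring)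
  have e5 : sl2 0 ν⁻¹ (-ν) 0 (by field_simp; ring) = w * y := by
    rw [hw, hy, sl2_mul]
    apply sl2_congr <;> ring
  have e6 : oddRep hp (QuotientGroup.mk w) (symmetrize hp u) = symmetrize hp u := by
    rw [e2, map_add, ← Module.End.mul_apply, ← map_mul, e3, map_one, Module.End.one_apply, add_comm]
  have e7 : oddRep hp (QuotientGroup.mk y) (symmetrize hp u) = symmetrize hp u := by
    rw [e2, map_add, e1]
    conv_lhs => rw [← e1]
    rw [← Module.End.mul_apply, ← Module.End.mul_apply, ← map_mul, ← map_mul, ← QuotientGroup.mk_mul,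
      ← QuotientGroup.mk_mul, e4, e1]
  intro h hh
  induction hh using Subgroup.closure_induction with
  | mem x hx =>
    rcases hx with rfl | rfl
    · exact e6
    · rw [e5, QuotientGroup.mk_mul, map_mul, Module.End.mul_apply, e7, e6]
  | one => rw [map_one, Module.End.one_apply]
  | mul x y _ _ hx hy => rw [map_mul, Module.End.mul_apply, hy, hx]
  | inv x _ hx =>
    conv_lhs => rw [← hx]
    rw [← Module.End.mul_apply, ← map_mul, inv_mul_cancel, map_one, Module.End.one_apply]

end

/-- There are many orbits of multiplication by `ν` on the nonzero residues. -/
theorem exists_orbit_representatives (hν0 : ν ≠ 0) (hν : orderOf ν = 14) {N : ℕ}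
    (hN : 14 * N < p) : ∃ a : Fin N → ZMod p, (∀ j, a j ≠ 0) ∧
      ∀ j k (i : ℕ), ν ^ i * a k = a j → j = k := by
  set z : (ZMod p)ˣ := Units.mk0 ν hν0 with hz
  have hzo : orderOf z = 14 := by rw [← orderOf_units, hz, Units.val_mk0, hν]
  have h1 : N ≤ Nat.card ((ZMod p)ˣ ⧸ Subgroup.zpowers z) := by
    have h2 := Subgroup.card_eq_card_quotient_mul_card_subgroup (Subgroup.zpowers z)
    rw [Nat.card_zpowers, hzo, Nat.card_eq_fintype_card, ZMod.card_units_eq_totient,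
      Nat.totient_prime Fact.out] at h2
    omega
  have : Fintype ((ZMod p)ˣ ⧸ Subgroup.zpowers z) := Fintype.ofFinite _
  rw [Nat.card_eq_fintype_card] at h1
  obtain ⟨φ⟩ : Nonempty (Fin N ↪ (ZMod p)ˣ ⧸ Subgroup.zpowers z) :=
    Function.Embedding.nonempty_of_card_le (by simpa using h1)
  refine ⟨fun j => ((φ j).out : (ZMod p)ˣ), fun j => Units.ne_zero _, fun j k i h => ?_⟩
  apply φ.injective
  rw [← QuotientGroup.out_eq' (φ j), ← QuotientGroup.out_eq' (φ k), eq_comm, QuotientGroup.eq]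
  have h3 : z ^ i * (φ k).out = (φ j).out := Units.ext (by simpa [hz] using h)
  rw [← h3, mul_comm (z ^ i), inv_mul_cancel_left]
  exact Subgroup.pow_mem _ (Subgroup.mem_zpowers z) i

/-- The Wythoff space of the odd part of the Weil representation, as a complex space. -/
noncomputable def oddWythoff (hp : p % 4 = 3) (H : Subgroup PSL(2, ZMod p)) :
    Submodule ℂ (oddFunctions p) where
  carrier := {v | ∀ h ∈ H, oddRep hp h v = v}
  add_mem' hv hw h hh := by rw [map_add, hv h hh, hw h hh]
  zero_mem' h _ := map_zero _
  smul_mem' c v hv h hh := by rw [oddRep_smul, hv h hh]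

theorem le_finrank_oddWythoff (hp : p % 4 = 3) (hν0 : ν ≠ 0) (hν : orderOf ν = 14) {N : ℕ}
    (hN : (14 * N) ^ 2 < p) :
    N ≤ Module.finrank ℂ (oddWythoff hp (Subgroup.closure
      {(QuotientGroup.mk (sl2 0 1 (-1) 0 (by ring)) : PSL(2, ZMod p)),
        QuotientGroup.mk (sl2 0 ν⁻¹ (-ν) 0 (by field_simp; ring))})) := by
  obtain ⟨a, ha0, ha⟩ := exists_orbit_representatives hν0 hν (N := N)
    ((Nat.le_self_pow two_ne_zero _).trans_lt hN)
  have h := LinearMap.finrank_le_finrank_of_injective (f := LinearMap.codRestrict (oddWythoff hp _)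
    (symmetrize hp ∘ₗ alternatingCombination hν a)
    (oddRep_symmetrize_fixed hν a hp hν0)) (by
      intro F F' hF
      exact symmetrize_comp_injective hν a hp hν0 ha0 ha (by simpa using hN)
        (congrArg Subtype.val hF))
  simpa using h

end WythoffVectors

/-! ### Transport of irreducibility -/

section Irreducible

variable {G G' S T : Type} [Group G] [Group G'] [AddCommGroup S] [Module ℝ S] [AddCommGroup T]
  [Module ℝ T]

theorem isIrreducible_iff_forall_submodule (τ : Representation ℝ G S) :
    τ.IsIrreducible ↔ Nontrivial S ∧
      ∀ W : Submodule ℝ S, (∀ g, ∀ v ∈ W, τ g v ∈ W) → W = ⊥ ∨ W = ⊤ := by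
  constructor
  · intro h
    refine ⟨?_, fun W hW => ?_⟩
    · by_contra hS
      rw [not_nontrivial_iff_subsingleton] at hS
      obtain ⟨U, U', hU⟩ := h.exists_pair_ne
      exact hU (Subrepresentation.toSubmodule_injective (Subsingleton.elim _ _))
    · rcases h.eq_bot_or_eq_top ⟨W, hW⟩ with h | h
      · left; exact congrArg Subrepresentation.toSubmodule h
      · right; exact congrArg Subrepresentation.toSubmodule h
  · rintro ⟨hS, h⟩
    have hnt : Nontrivial (Subrepresentation τ) := by
      refine ⟨⊥, ⊤, fun h => ?_⟩
      exact bot_ne_top (α := Submodule ℝ S) (congrArg Subrepresentation.toSubmodule h)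
    refine { eq_bot_or_eq_top := fun U => ?_ }
    rcases h U.toSubmodule (fun g v hv => U.apply_mem_toSubmodule g hv) with h | h
    · left; exact Subrepresentation.toSubmodule_injective h
    · right; exact Subrepresentation.toSubmodule_injective h

theorem isIrreducible_comp_mulEquiv {τ : Representation ℝ G S} (h : τ.IsIrreducible)
    (e : G' ≃* G) : Representation.IsIrreducible (τ.comp e.toMonoidHom) := by
  rw [isIrreducible_iff_forall_submodule] at h ⊢
  refine ⟨h.1, fun W hW => h.2 W fun g v hv => ?_⟩
  have := hW (e.symm g) v hv
  rwa [MonoidHom.comp_apply, MulEquiv.coe_toMonoidHom, MulEquiv.apply_symm_apply] at this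

theorem isIrreducible_of_equiv {τ : Representation ℝ G S} {σ : Representation ℝ G T}
    (h : τ.IsIrreducible) (φ : τ.Equiv σ) : σ.IsIrreducible := by
  rw [isIrreducible_iff_forall_submodule] at h ⊢
  obtain ⟨hS, h⟩ := h
  refine ⟨φ.toLinearEquiv.symm.toEquiv.nontrivial, fun W hW => ?_⟩
  have h1 : (W.comap φ.toLinearEquiv.toLinearMap).map φ.toLinearEquiv.toLinearMap = W :=
    Submodule.map_comap_eq_of_surjective φ.toLinearEquiv.surjective W
  rw [← h1]
  rcases h (W.comap φ.toLinearEquiv.toLinearMap) (fun g v hv => by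
    have h2 : φ (τ g v) = σ g (φ v) :=
      Representation.IntertwiningMap.isIntertwining _ _ φ.toIntertwiningMap g v
    show φ (τ g v) ∈ W
    rw [h2]
    exact hW g _ hv) with h | h
  · left; rw [h, Submodule.map_bot]
  · right; rw [h, Submodule.map_top]; exact LinearEquiv.range _

end Irreducible

/-! ### Invariant inner products and Wythoff's construction -/

section InvariantInnerProduct

variable {G S : Type} [Group G] [Finite G] [AddCommGroup S] [Module ℝ S] [FiniteDimensional ℝ S]

/-- Every real representation of a finite group is equivalent to an orthogonal one. -/
theorem exists_orthogonal_equiv (τ : Representation ℝ G S) :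
    ∃ (d : ℕ) (φ : S ≃ₗ[ℝ] EuclideanSpace ℝ (Fin d)), ∀ g v w,
      inner ℝ (φ (τ g v)) (φ (τ g w)) = inner ℝ (φ v) (φ w) := by
  classical
  have := Fintype.ofFinite G
  set b : S ≃ₗ[ℝ] EuclideanSpace ℝ (Fin (Module.finrank ℝ S)) :=
    LinearEquiv.ofFinrankEq _ _ (by simp) with hb
  let c : InnerProductSpace.Core ℝ S :=
    { inner := fun v w => ∑ g, inner ℝ (b (τ g v)) (b (τ g w))
      conj_inner_symm := fun v w => by
        simp only [map_sum, inner_conj_symm]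
      re_inner_nonneg := fun v => by
        rw [map_sum]
        exact Finset.sum_nonneg fun g _ => inner_self_nonneg
      add_left := fun u v w => by
        simp only [map_add, inner_add_left, Finset.sum_add_distrib]
      smul_left := fun u v r => by
        simp only [map_smul, inner_smul_left, Finset.mul_sum]
      definite := fun v hv => by
        have h := (Finset.sum_eq_zero_iff_of_nonneg
          (fun g _ => real_inner_self_nonneg (x := b (τ g v)))).1 hv 1 (Finset.mem_univ _)
        rw [inner_self_eq_zero, map_one] at h
        exact b.map_eq_zero_iff.1 h }
  let _ := c.toNormedAddCommGroup
  let _ := InnerProductSpace.ofCore c.toCore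
  refine ⟨_, (stdOrthonormalBasis ℝ S).repr.toLinearEquiv, fun g v w => ?_⟩
  have h1 : ∀ v w : S, inner ℝ ((stdOrthonormalBasis ℝ S).repr.toLinearEquiv v)
      ((stdOrthonormalBasis ℝ S).repr.toLinearEquiv w) =
        ∑ g, inner ℝ (b (τ g v)) (b (τ g w)) :=
    fun v w => (stdOrthonormalBasis ℝ S).repr.inner_map_map v w
  rw [h1, h1]
  refine Fintype.sum_equiv (Equiv.mulRight g) _ _ fun h => ?_
  rw [Equiv.coe_mulRight, map_mul]
  rfl

/-- Wythoff's construction: a vector of an irreducible representation which is fixed by a point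
stabilizer gives a pure realization. -/
theorem exists_realization_equiv {Ω : Type} [MulAction G Ω] {τ : Representation ℝ G S}
    (hτ : τ.IsIrreducible) {α : Ω} (hα : ∀ ω, ∃ g : G, g • α = ω) {v : S} (hv0 : v ≠ 0)
    (hv : v ∈ wythoffSpace τ (MulAction.stabilizer G α)) :
    ∃ (d : ℕ) (A : Realization G Ω (EuclideanSpace ℝ (Fin d))), Nonempty (τ.Equiv A.spanRep) := by
  obtain ⟨d, φ, hφ⟩ := exists_orthogonal_equiv τ
  choose γ hγ using hα
  -- The chosen transporters do not matter, since the stabilizer of `α` fixes `v`.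
  have hγv : ∀ g, τ (γ (g • α)) v = τ g v := by
    intro g
    have h1 := hv (g⁻¹ * γ (g • α)) (by
      rw [MulAction.mem_stabilizer_iff, mul_smul, hγ, inv_smul_smul])
    conv_rhs => rw [← h1]
    rw [← Module.End.mul_apply, ← map_mul, mul_inv_cancel_left]
  let A : Realization G Ω (EuclideanSpace ℝ (Fin d)) :=
    { rep :=
        { toFun := fun g => φ.conj (τ g)
          map_one' := by rw [map_one]; exact φ.conj_id
          map_mul' := fun g h => by rw [map_mul]; exact φ.conj_comp _ _ }
      orthogonal := fun g x y => by
        have := hφ g (φ.symm x) (φ.symm y)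
        rwa [φ.apply_symm_apply, φ.apply_symm_apply] at this
      toFun := fun ω => φ (τ (γ ω) v)
      equivariant := fun g ω => by
        show φ (τ (γ (g • ω)) v) = φ (τ g (φ.symm (φ (τ (γ ω) v))))
        obtain ⟨h, rfl⟩ : ∃ h : G, h • α = ω := ⟨γ ω, hγ ω⟩
        rw [φ.symm_apply_apply, ← mul_smul, hγv, hγv, map_mul, Module.End.mul_apply] }
  -- The preimage of the span in `S` is invariant and contains `v ≠ 0`, so it is everything by
  -- irreducibility.
  have hA : A.spanSubrep.toSubmodule = ⊤ := by
    rw [isIrreducible_iff_forall_submodule] at hτ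
    have h1 := hτ.2 (A.spanSubrep.toSubmodule.comap φ.toLinearMap) (fun g w hw => by
      have := A.spanSubrep.apply_mem_toSubmodule g hw
      have h2 : A.rep g (φ w) = φ (τ g w) := congrArg (fun x => φ (τ g x)) (φ.symm_apply_apply w)
      rwa [LinearEquiv.coe_coe, h2] at this)
    have h2 : A.spanSubrep.toSubmodule.comap φ.toLinearMap ≠ ⊥ := by
      rw [Submodule.ne_bot_iff]
      refine ⟨v, ?_, hv0⟩
      have h3 : A.toFun α = φ v := by
        have := hγv 1
        rw [one_smul, map_one] at this
        exact congrArg φ this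
      show φ v ∈ Submodule.span ℝ (Set.range A.toFun)
      rw [← h3]
      exact Submodule.subset_span ⟨α, rfl⟩
    have h3 := h1.resolve_left h2
    rw [eq_top_iff]
    intro x _
    have : φ.symm x ∈ A.spanSubrep.toSubmodule.comap φ.toLinearMap := by rw [h3]; trivial
    rwa [Submodule.mem_comap, LinearEquiv.coe_coe, φ.apply_symm_apply] at this
  refine ⟨d, A, ⟨Representation.Equiv.mk (φ.trans (LinearEquiv.ofTop _ hA).symm) fun g => ?_⟩⟩
  refine LinearMap.ext fun w => Subtype.ext ?_
  exact (congrArg (fun x => φ (τ g x)) (φ.symm_apply_apply w)).symm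

end InvariantInnerProduct

/-! ### Commutant ℂ and the essential Wythoff dimension -/

section ComplexType

variable {G S T : Type} [Group G] [AddCommGroup S] [Module ℝ S] [Module ℂ S] [IsScalarTower ℝ ℂ S]
  [AddCommGroup T] [Module ℝ T]

/-- Multiplication by complex numbers, transported to an equivalent representation. -/
def complexIntertwining {τ : Representation ℝ G S} {σ : Representation ℝ G T} (φ : τ.Equiv σ)
    (hτ : ∀ g (z : ℂ) v, τ g (z • v) = z • τ g v) : ℂ →ₐ[ℝ] σ.IntertwiningMap σ where
  toFun z := φ.toIntertwiningMap.comp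
    (Representation.IntertwiningMap.comp (σ := τ)
      ⟨(LinearMap.lsmul ℂ S z).restrictScalars ℝ, fun g => LinearMap.ext fun v => (hτ g z v).symm⟩
      φ.symm.toIntertwiningMap)
  map_one' := by
    apply Representation.IntertwiningMap.ext
    refine LinearMap.ext fun v => ?_
    show φ ((1 : ℂ) • φ.symm v) = v
    rw [one_smul, Representation.Equiv.apply_symm_apply]
  map_mul' z w := by
    apply Representation.IntertwiningMap.ext
    refine LinearMap.ext fun v => ?_
    show φ ((z * w) • φ.symm v) = φ (z • φ.symm (φ (w • φ.symm v)))
    rw [Representation.Equiv.symm_apply_apply, mul_smul]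
  map_zero' := by
    apply Representation.IntertwiningMap.ext
    refine LinearMap.ext fun v => ?_
    show φ ((0 : ℂ) • φ.symm v) = 0
    rw [zero_smul, map_zero]
  map_add' z w := by
    apply Representation.IntertwiningMap.ext
    refine LinearMap.ext fun v => ?_
    show φ ((z + w) • φ.symm v) = φ (z • φ.symm v) + φ (w • φ.symm v)
    rw [add_smul, map_add]
  commutes' r := by
    apply Representation.IntertwiningMap.ext
    refine LinearMap.ext fun v => ?_
    show φ ((r : ℂ) • φ.symm v) = r • v
    rw [show (r : ℂ) • φ.symm v = r • φ.symm v from algebraMap_smul ℂ r _, map_smul, Representation.Equiv.apply_symm_apply]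

variable {τ : Representation ℝ G S} {σ : Representation ℝ G T} (φ : τ.Equiv σ)
    (hτ : ∀ g (z : ℂ) v, τ g (z • v) = z • τ g v)

theorem complexIntertwining_apply (z : ℂ) (v : S) :
    complexIntertwining φ hτ z (φ v) = φ (z • v) := by
  show φ (z • φ.symm (φ v)) = φ (z • v)
  rw [Representation.Equiv.symm_apply_apply]

theorem complexIntertwining_bijective [Nontrivial S]
    (hcomm : ∀ D : S →ₗ[ℝ] S, (∀ g v, D (τ g v) = τ g (D v)) → ∃ z : ℂ, ∀ v, D v = z • v) :
    Function.Bijective (complexIntertwining φ hτ) := by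
  constructor
  · rw [injective_iff_map_eq_zero]
    intro z hz
    obtain ⟨v, hv⟩ := exists_ne (0 : S)
    have h := complexIntertwining_apply φ hτ z v
    rw [hz] at h
    have h1 : φ (z • v) = φ 0 := by rw [← h, map_zero]; rfl
    have h2 := φ.toLinearEquiv.injective h1
    exact (smul_eq_zero.1 h2).resolve_right hv
  · intro D
    obtain ⟨z, hz⟩ := hcomm
      (φ.symm.toIntertwiningMap.comp (D.comp φ.toIntertwiningMap)).toLinearMap
      (fun g v => Representation.IntertwiningMap.isIntertwining _ _ (φ.symm.toIntertwiningMap.comp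
        (D.comp φ.toIntertwiningMap)) g v)
    refine ⟨z, ?_⟩
    apply Representation.IntertwiningMap.ext
    refine LinearMap.ext fun v => ?_
    show φ (z • φ.symm v) = D v
    rw [← hz]
    show φ (φ.symm (D (φ (φ.symm v)))) = D v
    rw [Representation.Equiv.apply_symm_apply, Representation.Equiv.apply_symm_apply]

theorem isOfComplexType_of_equiv [Nontrivial S] {τ : Representation ℝ G S}
    {σ : Representation ℝ G T} (φ : τ.Equiv σ) (hτ : ∀ g (z : ℂ) v, τ g (z • v) = z • τ g v)
    (hcomm : ∀ D : S →ₗ[ℝ] S, (∀ g v, D (τ g v) = τ g (D v)) → ∃ z : ℂ, ∀ v, D v = z • v) :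
    IsOfComplexType σ :=
  ⟨(AlgEquiv.ofBijective _ (complexIntertwining_bijective φ hτ hcomm)).symm⟩

/-- The two dimensions are over different rings, `ℂ` and the commutant of `σ`; `φ` is semilinear
along the ring isomorphism `complexIntertwining`. -/
theorem essentialWythoffDim_eq_finrank [Nontrivial S] {τ : Representation ℝ G S}
    {σ : Representation ℝ G T} (φ : τ.Equiv σ) (hτ : ∀ g (z : ℂ) v, τ g (z • v) = z • τ g v)
    (hcomm : ∀ D : S →ₗ[ℝ] S, (∀ g v, D (τ g v) = τ g (D v)) → ∃ z : ℂ, ∀ v, D v = z • v)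
    (H : Subgroup G) (W : Submodule ℂ S) (hW : ∀ v, v ∈ W ↔ v ∈ wythoffSpace τ H) :
    essentialWythoffDim σ H = Module.finrank ℂ W := by
  have h1 : ∀ (g : G) (v : S), σ g (φ v) = φ (τ g v) := fun g v =>
    (Representation.IntertwiningMap.isIntertwining _ _ φ.toIntertwiningMap g v).symm
  have h2 : ∀ (g : G) (v : T), φ.symm (σ g v) = τ g (φ.symm v) := fun g v =>
    Representation.IntertwiningMap.isIntertwining _ _ φ.symm.toIntertwiningMap g v
  let j : W ≃+ wythoffSpace σ H :=
    { toFun := fun v => ⟨φ v.1, fun h hh => by rw [h1, (hW _).1 v.2 h hh]⟩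
      invFun := fun v => ⟨φ.symm v.1, (hW _).2 fun h hh => by rw [← h2, v.2 h hh]⟩
      left_inv := fun v => Subtype.ext (Representation.Equiv.symm_apply_apply φ v.1)
      right_inv := fun v => Subtype.ext (Representation.Equiv.apply_symm_apply φ v.1)
      map_add' := fun v w => Subtype.ext (map_add φ v.1 w.1) }
  exact congrArg Cardinal.toNat (rank_eq_of_equiv_equiv (complexIntertwining φ hτ) j
    (complexIntertwining_bijective φ hτ hcomm) fun z v =>
      Subtype.ext (complexIntertwining_apply φ hτ z v.1).symm).symm

end ComplexType

/-! ### Choice of the prime and the realization on the coset geometry -/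

section Existence

theorem exists_orderOf_eq_fourteen {p : ℕ} [Fact p.Prime] (h : p % 14 = 1) :
    ∃ ν : ZMod p, ν ≠ 0 ∧ orderOf ν = 14 := by
  obtain ⟨g, hg⟩ := IsCyclic.exists_ofOrder_eq_natCard (α := (ZMod p)ˣ)
  rw [Nat.card_eq_fintype_card, ZMod.card_units_eq_totient, Nat.totient_prime Fact.out] at hg
  have hp := (Fact.out : p.Prime).two_le
  have h1 : orderOf (g ^ ((p - 1) / 14)) = 14 := by
    rw [orderOf_pow_of_dvd (by omega) (by rw [hg]; exact Nat.div_dvd_of_dvd (by omega)), hg]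
    exact Nat.div_div_self (by omega) (by omega)
  exact ⟨(g ^ ((p - 1) / 14) : (ZMod p)ˣ), Units.ne_zero _, by rw [orderOf_units, h1]⟩

/-- Dirichlet's theorem for the residue `15` modulo `28`, which combines both congruences. -/
theorem exists_large_prime (B : ℕ) : ∃ p, p.Prime ∧ B < p ∧ p % 4 = 3 ∧ p % 7 = 1 := by
  obtain ⟨p, hB, hp, h⟩ := Nat.forall_exists_prime_gt_and_modEq B (q := 28) (a := 15)
    (by norm_num) (by norm_num)
  have h : p % 28 = 15 := h
  exact ⟨p, hp, hB, by omega, by omega⟩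

variable {p : ℕ} [Fact p.Prime]

theorem nontrivial_oddFunctions (hp : p % 4 = 3) : Nontrivial (oddFunctions p) :=
  ⟨oddSingle 1, 0, oddSingle_ne_zero (ne_two_of_mod_four hp) one_ne_zero⟩

/-- Translation by `g` maps fixed vectors to fixed vectors. It carries the bound from the base
vertex to every vertex. -/
theorem finrank_oddWythoff_le_of_conj (hp : p % 4 = 3) {H K : Subgroup PSL(2, ZMod p)}
    (g : PSL(2, ZMod p)) (h : ∀ k ∈ K, g⁻¹ * k * g ∈ H) :
    Module.finrank ℂ (oddWythoff hp H) ≤ Module.finrank ℂ (oddWythoff hp K) := by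
  have hinj : Function.Injective (oddRep hp g) := Function.LeftInverse.injective (g := oddRep hp g⁻¹)
    fun v => by rw [← Module.End.mul_apply, ← map_mul, inv_mul_cancel, map_one, Module.End.one_apply]
  let L : oddWythoff hp H →ₗ[ℂ] oddWythoff hp K :=
    { toFun := fun v => ⟨oddRep hp g v.1, fun k hk => by
        conv_rhs => rw [← v.2 _ (h k hk)]
        rw [← Module.End.mul_apply, ← Module.End.mul_apply, ← map_mul, ← map_mul]
        congr 2
        group⟩
      map_add' := fun v w => Subtype.ext (map_add _ v.1 w.1)
      map_smul' := fun z v => Subtype.ext (oddRep_smul hp g z v.1) }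
  exact LinearMap.finrank_le_finrank_of_injective (f := L)
    fun v w hvw => Subtype.ext (hinj (congrArg Subtype.val hvw))

-- The strict inequality also provides the nonzero fixed vector to which Wythoff's construction is
-- applied.
open CosetPoset in
theorem exists_realization_cosetPoset (hp : p % 4 = 3) {s : Fin 3 → PSL(2, ZMod p)}
    (hs : IsStringCGroup s) {N : ℕ}
    (hN : N < Module.finrank ℂ (oddWythoff hp (Subgroup.closure {s 1, s 2}))) :
    ∃ (d : ℕ) (A : Realization (CosetPoset hs ≃o CosetPoset hs) (PolytopeVertex (CosetPoset hs))
        (EuclideanSpace ℝ (Fin d))),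
      A.IsPure ∧ IsOfComplexType A.spanRep ∧
      (∀ α : PolytopeVertex (CosetPoset hs),
        N < essentialWythoffDim A.spanRep (MulAction.stabilizer _ α)) ∧
      ∀ g, A.spanRep.character (autEquiv hs g) = (oddRep hp).character g := by
  have : Nontrivial (oddFunctions p) := nontrivial_oddFunctions hp
  set e := autEquiv hs with he
  set τ : Representation ℝ (CosetPoset hs ≃o CosetPoset hs) (oddFunctions p) :=
    (oddRep hp).comp e.symm.toMonoidHom with hτ
  have hτe : ∀ g, τ (e g) = oddRep hp g := fun g => congrArg (oddRep hp) (e.symm_apply_apply g)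
  have : Finite (CosetPoset hs ≃o CosetPoset hs) := Finite.of_equiv _ e.toEquiv
  have hirr : τ.IsIrreducible := isIrreducible_comp_mulEquiv (oddRep_isIrreducible hp) e.symm
  obtain ⟨v, hv0⟩ : ∃ v : oddWythoff hp (Subgroup.closure {s 1, s 2}), v ≠ 0 := by
    have := Module.nontrivial_of_finrank_pos (Nat.zero_lt_of_lt hN)
    exact exists_ne 0
  have hlin : ∀ g (z : ℂ) v, τ g (z • v) = z • τ g v := fun g z v => oddRep_smul hp _ z v
  have hcomm : ∀ D : oddFunctions p →ₗ[ℝ] oddFunctions p,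
      (∀ g v, D (τ g v) = τ g (D v)) → ∃ z : ℂ, ∀ v, D v = z • v := by
    intro D hD
    refine oddRep_commutant hp D fun g f => ?_
    rw [← hτe]; exact hD _ _
  obtain ⟨d, A, ⟨φ⟩⟩ := exists_realization_equiv (Ω := PolytopeVertex (CosetPoset hs)) hirr
    (α := baseVertex hs) (fun ω => (exists_smul_baseVertex ω).imp' e fun _ h => h)
    (v := v.1) (fun h => hv0 (Subtype.ext h)) (by
      intro h hh
      obtain ⟨g, rfl⟩ := e.surjective h
      rw [hτe]
      exact v.2 g ((smul_baseVertex_iff g).1 hh))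
  refine ⟨d, A, isIrreducible_of_equiv hirr φ, isOfComplexType_of_equiv φ hlin hcomm, ?_, ?_⟩
  · intro α
    obtain ⟨g, rfl⟩ := exists_smul_baseVertex α
    set K := (MulAction.stabilizer _ (e g • baseVertex hs)).comap e.toMonoidHom with hK
    rw [essentialWythoffDim_eq_finrank φ hlin hcomm _ (oddWythoff hp K)]
    · refine hN.trans_le (finrank_oddWythoff_le_of_conj hp g fun k hk => ?_)
      rw [← smul_baseVertex_iff (hs := hs), ← he, map_mul, map_mul, map_inv, mul_smul, mul_smul,
        inv_smul_eq_iff]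
      exact hk
    · intro w
      constructor
      · intro hw h hh
        obtain ⟨k, rfl⟩ := e.surjective h
        rw [hτe]
        exact hw k hh
      · intro hw k hk
        rw [← hτe]
        exact hw (e k) hk
  · intro g
    rw [← Representation.char_iso φ, Representation.character, hτe]
    rfl

end Existence

/-- The real dimension of the commutant would be both `2` and `1`. -/
theorem not_isOfRealType_of_isOfComplexType {G S : Type} [Group G] [AddCommGroup S] [Module ℝ S]
    {σ : Representation ℝ G S} (h : IsOfComplexType σ) : ¬ IsOfRealType σ := by
  obtain ⟨f⟩ := h
  rintro ⟨f'⟩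
  have := (f.symm.trans f').toLinearEquiv.finrank_eq
  simp at this

theorem mainTheorem3 :
    (∀ N : ℕ, ∃ (p : ℕ) (_ : Fact p.Prime),
      (p : ℤ) ≡ -1 [ZMOD 4] ∧ (p : ℤ) ≡ 1 [ZMOD 7] ∧
      ∃ s : Fin 3 → PSL(2, ZMod p), IsStringCGroup s ∧
      ∃ (P : Type) (_ : PartialOrder P) (_ : BoundedOrder P) (_ : Finite P),
        IsAbstractRegularPolytope 3 P ∧
        ∃ (e : PSL(2, ZMod p) ≃* (P ≃o P)) (Φ : Fin 5 → P),
          StrictMono Φ ∧ AreDistinguishedGenerators Φ (fun i => e (s i)) ∧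
        ∃ (d : ℕ) (A : Realization (P ≃o P) (PolytopeVertex P) (EuclideanSpace ℝ (Fin d))),
          A.IsPure ∧
          IsOfComplexType A.spanRep ∧
          (∀ α : PolytopeVertex P,
            N ≤ essentialWythoffDim A.spanRep (MulAction.stabilizer (P ≃o P) α)) ∧
          ∃ ρ : Representation ℂ SL(2, ZMod p) (ZMod p → ℂ), IsWeilRepresentation p ρ ∧
            ∀ g : SL(2, ZMod p),
              ((A.spanRep.character (e (QuotientGroup.mk g)) : ℝ) : ℂ) =
                evenCharacter ρ g + (starRingEnd ℂ) (evenCharacter ρ g)) ∧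
    ¬ HermanMonsonAssertion := by
  have key : ∀ N : ℕ, ∃ (p : ℕ) (_ : Fact p.Prime) (hp : p % 4 = 3), p % 7 = 1 ∧
      ∃ (s : Fin 3 → PSL(2, ZMod p)) (hs : IsStringCGroup s),
      ∃ (d : ℕ) (A : Realization (CosetPoset hs ≃o CosetPoset hs) (PolytopeVertex (CosetPoset hs))
        (EuclideanSpace ℝ (Fin d))),
      A.IsPure ∧ IsOfComplexType A.spanRep ∧
      (∀ α : PolytopeVertex (CosetPoset hs),
        N < essentialWythoffDim A.spanRep (MulAction.stabilizer _ α)) ∧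
      ∀ g, A.spanRep.character (CosetPoset.autEquiv hs g) = (oddRep hp).character g := by
    intro N
    -- Taking `N + 1` orbits gives a dimension strictly above `N`; with `N = 1` this refutes the
    -- bound in `HermanMonsonAssertion`.
    obtain ⟨p, hprime, hB, hp4, hp7⟩ := exists_large_prime ((14 * (N + 1)) ^ 2)
    have : Fact p.Prime := ⟨hprime⟩
    obtain ⟨ν, hν0, hν⟩ := exists_orderOf_eq_fourteen (p := p) (by omega)
    obtain ⟨s, hs, hs1, hs2⟩ := exists_isStringCGroup_psl2 (sq_ne_neg_one hp4) hν0 hν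
    have h := le_finrank_oddWythoff hp4 hν0 hν hB
    rw [← hs1, ← hs2] at h
    exact ⟨p, this, hp4, hp7, s, hs, exists_realization_cosetPoset hp4 hs h⟩
  constructor
  · intro N
    obtain ⟨p, hprime, hp4, hp7, s, hs, d, A, hpure, hC, hdim, hchar⟩ := key N
    refine ⟨p, hprime, ?_, ?_, s, hs, CosetPoset hs, inferInstance, inferInstance, inferInstance,
      CosetPoset.isAbstractRegularPolytope, CosetPoset.autEquiv hs, CosetPoset.face hs 1,
      CosetPoset.face_strictMono 1, CosetPoset.areDistinguishedGenerators, d, A, hpure, hC,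
      fun α => (hdim α).le, weilRepresentation (ne_two_of_mod_four hp4), isWeilRepresentation _,
      fun g => ?_⟩
    · unfold Int.ModEq; omega
    · unfold Int.ModEq; omega
    · rw [hchar]
      exact oddRep_character hp4 g
  · intro hHM
    obtain ⟨p, hprime, hp4, hp7, s, hs, d, A, hpure, hC, hdim, hchar⟩ := key 1
    rcases hHM 3 (CosetPoset hs) CosetPoset.isAbstractRegularPolytope d A hpure
      (CosetPoset.baseVertex hs) with h | h
    · exact absurd h (not_le.2 (hdim _))
    · exact not_isOfRealType_of_isOfComplexType hC h
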